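/- **Theorem (direct limit theorem).** Let $(X,\mathcal A,\mu)$ be a $\sigma$-finite measure space with $\mu(X)=\infty$, let $T$ be a conservative, ergodic, measure preserving transformation of $(X,\mathcal A,\mu)$, and let $\widehat T:L^1(\mu)\to L^1(\mu)$ be its dual operator, characterized by $\int(\widehat Tf)\,g\,d\mu=\int f\,(g\circ T)\,d\mu$ for $f\in L^1(\mu)$, $g\in L^\infty(\mu)$. Let $d\ge 2$, and assume the following. 1. $X$ is the disjoint union of sets $Y,A_1,\dots,A_d\in\mathcal A$ with $0<\mu(Y)<\infty$ and $\mu(A_i)=\infty$ for all $i$, and $Y$ dynamically separates $A_1,\dots,A_d$: whenever $x\in A_i$ and $T^nx\in A_j$ with $i\ne j$ and $n\ge1$, there is $k\in\{1,\dots,n-1\}$ with $T^kx\in Y$. 2. For $k\ge0$ let $Y_k$ be the set of all $x$ with $\min\{j\ge0: T^jx\in Y\}=k$, and for $n\ge0$ put $$w(n)=\mu\Big(\bigcup_{k=0}^{n-1}T^{-k}Y\Big),\qquad w_i(n)=\mu\Big(\bigcup_{k=0}^{n-1}\big(T^{-k}Y\cap A_i\big)\Big)\qquad(i=1,\dots,d).$$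 For each $i$, the set $\mathfrak H_i=\big\{\frac1{w_i(n)}\sum_{k=0}^{n-1}\widehat T^k1_{Y_k\cap A_i}: n\ge1\big\}$ is strongly precompact in $L^1(\mu)$ (for the finitely many $n$ with $w_i(n)=0$, where the sum vanishes too, the quotient is read as $0$). 3. For some $\alpha\in[0,1]$ and $\beta=(\beta_1,\dots,\beta_d)\in[0,1]^d$ with $\sum_i\beta_i=1$, the sequence $w$ is regularly varying of index $1-\alpha$ at $\infty$, i.e. $w(\lfloor rx\rfloor)/w(\lfloor x\rfloor)\to r^{1-\alpha}$ as $x\to\infty$ for every $r>0$, and $w_i(n)/w(n)\to\beta_i$ as $n\to\infty$ for every $i$. Let $S_n=\big(\sum_{k=1}^n1_{A_1}\circ T^k,\dots,\sum_{k=1}^n1_{A_d}\circ T^k\big)$. Let $\zeta_{\alpha,\beta}$ be a random vector with the multidimensional generalized arcsine distribution: for $0<\alpha<1$ it has the law of $(\xi_1,\dots,\xi_d)/\sum_{j}\xi_j$, where $\xi_1,\dots,\xi_d$ are independent $[0,\infty)$-valued random variables with $\mathbb E[e^{-\lambda\xi_i}]=e^{-\beta_i\lambda^\alpha}$ for $\lambda>0$;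 for $\alpha=1$ it is a.s. equal to $\beta$; for $\alpha=0$ its law is $\sum_i\beta_i\delta_{e^{(i)}}$, with $e^{(i)}$ the $i$-th unit vector of $\mathbb R^d$. Then $S_n/n$ converges to $\zeta_{\alpha,\beta}$ strongly in distribution: for every probability measure $\nu\ll\mu$ on $(X,\mathcal A)$, the law of $S_n/n$ under $\nu$ converges weakly to the law of $\zeta_{\alpha,\beta}$ as $n\to\infty$. -/

import Mathlib

open MeasureTheory ProbabilityTheory Filter Topology Set
open scoped ENNReal NNReal

namespace OccupationTimes

/-- The weights `(-1) ^ (k + 1) * binom(α, k)`, `k ≥ 1`, and `0` at `k = 0`. -/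
noncomputable def sibuyaWeight (α : ℝ) (k : ℕ) : ℝ :=
  if k = 0 then 0 else -((-1) ^ k * Ring.choose α k)

theorem choose_succ_mul (α : ℝ) (k : ℕ) :
    Ring.choose α (k + 1) * (k + 1) = Ring.choose α k * (α - k) := by
  have h1 := Ring.descPochhammer_eq_factorial_smul_choose α (k + 1)
  have h2 := Ring.descPochhammer_eq_factorial_smul_choose α k
  rw [descPochhammer_succ_right, Polynomial.smeval_mul, h2] at h1
  simp only [Polynomial.smeval_sub, Polynomial.smeval_X, Polynomial.smeval_natCast, pow_one,
    pow_zero, nsmul_eq_mul, mul_one, Nat.factorial_succ, Nat.cast_mul] at h1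
  have h3 : (k.factorial : ℝ) ≠ 0 := by positivity
  apply mul_left_cancel₀ h3
  push_cast at h1
  linarith

theorem sibuyaWeight_nonneg {α : ℝ} (h0 : 0 < α) (h1 : α < 1) (k : ℕ) : 0 ≤ sibuyaWeight α k := by
  rcases k with _ | k
  · simp [sibuyaWeight]
  · induction k with
    | zero => simp [sibuyaWeight, h0.le]
    | succ k ih =>
      have h := choose_succ_mul α (k + 1)
      simp only [sibuyaWeight, Nat.succ_ne_zero, if_false] at ih ⊢
      have hk : (0 : ℝ) < (k + 1 : ℕ) + 1 := by positivity
      have : -((-1) ^ (k + 1 + 1) * Ring.choose α (k + 1 + 1))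
          = -((-1) ^ (k + 1) * Ring.choose α (k + 1)) * (((k + 1 : ℕ) : ℝ) - α)
            / (((k + 1 : ℕ) : ℝ) + 1) := by
        rw [eq_div_iff hk.ne', pow_succ (-1 : ℝ) (k + 1)]
        linear_combination (-1 : ℝ) ^ (k + 1) * h
      rw [this]
      have : (0 : ℝ) ≤ ((k + 1 : ℕ) : ℝ) - α := by
        push_cast; have : (0 : ℝ) ≤ k := by positivity
        linarith
      positivity

theorem hasSum_sibuyaWeight_mul_pow (α : ℝ) {s : ℝ} (hs0 : 0 ≤ s) (hs1 : s < 1) :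
    HasSum (fun k => sibuyaWeight α k * s ^ k) (1 - (1 - s) ^ α) := by
  have h := (Real.one_add_rpow_hasFPowerSeriesOnBall_zero (a := α)).hasSum
    (y := -s) (by simp [abs_of_nonneg hs0, enorm, ← NNReal.coe_lt_coe, hs1])
  have h' : HasSum (fun k : ℕ => Ring.choose α k * (-s) ^ k) ((1 - s) ^ α) := by
    simpa [sub_eq_add_neg, binomialSeries, FormalMultilinearSeries.coeff_ofScalars, mul_comm] using h
  have h2 := (hasSum_ite_eq (0 : ℕ) (1 : ℝ)).sub h'
  refine h2.congr_fun ?_ |> id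
  intro k
  rcases k with _ | k
  · simp [sibuyaWeight]
  · simp [sibuyaWeight, neg_pow s]; ring

theorem hasSum_sibuyaWeight {α : ℝ} (h0 : 0 < α) (h1 : α < 1) : HasSum (sibuyaWeight α) 1 := by
  have hnn := sibuyaWeight_nonneg h0 h1
  have hle : ∀ F : Finset ℕ, ∑ k ∈ F, sibuyaWeight α k ≤ 1 := by
    intro F
    have hc : ContinuousAt (fun s : ℝ => ∑ k ∈ F, sibuyaWeight α k * s ^ k) 1 := by fun_prop
    have ht : Tendsto (fun s : ℝ => ∑ k ∈ F, sibuyaWeight α k * s ^ k) (𝓝[<] 1)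
        (𝓝 (∑ k ∈ F, sibuyaWeight α k)) := by
      simpa using hc.tendsto.mono_left (nhdsWithin_le_nhds (s := Iio 1))
    refine le_of_tendsto ht ?_
    filter_upwards [Ioo_mem_nhdsLT (show (0 : ℝ) < 1 by norm_num)] with s hs
    have hsum := hasSum_sibuyaWeight_mul_pow α hs.1.le hs.2
    calc _ ≤ 1 - (1 - s) ^ α :=
          sum_le_hasSum F (fun k _ => mul_nonneg (hnn k) (pow_nonneg hs.1.le k)) hsum
      _ ≤ 1 := by have := Real.rpow_nonneg (sub_nonneg.2 hs.2.le) α; linarith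
  have hsm : Summable (sibuyaWeight α) := summable_of_sum_le hnn hle
  have hle1 : ∑' k, sibuyaWeight α k ≤ 1 := hsm.tsum_le_of_sum_le hle
  have hge : 1 ≤ ∑' k, sibuyaWeight α k := by
    have hc : ContinuousAt (fun s : ℝ => 1 - (1 - s) ^ α) 1 := by
      refine continuousAt_const.sub (ContinuousAt.rpow_const (by fun_prop) (Or.inr h0.le))
    have ht : Tendsto (fun s : ℝ => 1 - (1 - s) ^ α) (𝓝[<] 1) (𝓝 1) := by
      simpa [h0.ne'] using hc.tendsto.mono_left (nhdsWithin_le_nhds (s := Iio 1))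
    refine le_of_tendsto ht ?_
    filter_upwards [Ioo_mem_nhdsLT (show (0 : ℝ) < 1 by norm_num)] with s hs
    have hsum := hasSum_sibuyaWeight_mul_pow α hs.1.le hs.2
    exact hasSum_le (fun k => mul_le_of_le_one_right (hnn k) (pow_le_one₀ hs.1.le hs.2.le))
      hsum hsm.hasSum
  exact le_antisymm hle1 hge ▸ hsm.hasSum

/-- A probability measure on `[0, 1]` with Mellin transform `1 - (1 - exp (-ε * r)) ^ α`. -/
theorem exists_sibuya {α : ℝ} (h0 : 0 < α) (h1 : α < 1) {ε : ℝ} (hε : 0 ≤ ε) :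
    ∃ P : ProbabilityMeasure unitInterval, ∀ r : ℝ, 0 < r →
      ∫ s, (s : ℝ) ^ r ∂(P : Measure unitInterval) = 1 - (1 - Real.exp (-ε * r)) ^ α := by
  have hnn := sibuyaWeight_nonneg h0 h1
  have hs1 := hasSum_sibuyaWeight h0 h1
  let p : PMF ℕ := ⟨fun k => ENNReal.ofReal (sibuyaWeight α k), by
    have := ENNReal.ofReal_tsum_of_nonneg hnn hs1.summable
    rw [hs1.tsum_eq, ENNReal.ofReal_one] at this
    rw [this]; exact ENNReal.summable.hasSum⟩
  let f : ℕ → unitInterval := fun k => ⟨Real.exp (-ε * k), (Real.exp_pos _).le, by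
    rw [Real.exp_le_one_iff]; have : 0 ≤ ε * k := by positivity
    linarith⟩
  have hf : Measurable f := measurable_from_nat
  refine ⟨⟨p.toMeasure.map f, Measure.isProbabilityMeasure_map hf.aemeasurable⟩, fun r hr => ?_⟩
  have hm : Measurable (fun s : unitInterval => (s : ℝ) ^ r) := by fun_prop
  have hb : ∀ s : unitInterval, ‖(s : ℝ) ^ r‖ ≤ 1 := fun s => by
    rw [Real.norm_of_nonneg (Real.rpow_nonneg s.2.1 _)]
    exact Real.rpow_le_one s.2.1 s.2.2 hr.le
  rw [ProbabilityMeasure.coe_mk, integral_map hf.aemeasurable hm.aestronglyMeasurable,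
    PMF.integral_eq_tsum _ _ (Integrable.of_bound (measurable_from_nat (f := fun k => (f k : ℝ) ^ r)).aestronglyMeasurable 1
      (Eventually.of_forall fun k => hb (f k)))]
  have hterm : ∀ k : ℕ, (p k).toReal • ((f k : ℝ) ^ r)
      = sibuyaWeight α k * (Real.exp (-ε * r)) ^ k := by
    intro k
    have : (p k).toReal = sibuyaWeight α k := ENNReal.toReal_ofReal (hnn k)
    rw [this, smul_eq_mul]
    congr 1
    simp only [f]
    rw [← Real.exp_mul, ← Real.exp_nat_mul]
    congr 1; ring
  simp_rw [hterm]
  rcases hε.eq_or_lt with rfl | hε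
  · simp [h0.ne', hs1.tsum_eq]
  · refine (hasSum_sibuyaWeight_mul_pow α (Real.exp_pos _).le ?_).tsum_eq
    rw [Real.exp_lt_one_iff]
    have : 0 < ε * r := by positivity
    linarith

theorem exists_pow_mellin (P : ProbabilityMeasure unitInterval) (n : ℕ) :
    ∃ Q : ProbabilityMeasure unitInterval, ∀ r : ℝ, 0 < r →
      ∫ s, (s : ℝ) ^ r ∂(Q : Measure unitInterval)
        = (∫ s, (s : ℝ) ^ r ∂(P : Measure unitInterval)) ^ n := by
  induction n with
  | zero =>
    refine ⟨⟨Measure.dirac 1, inferInstance⟩, fun r _ => ?_⟩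
    simp
  | succ n ih =>
    obtain ⟨Q, hQ⟩ := ih
    have hmul : Measurable (fun z : unitInterval × unitInterval => z.1 * z.2) := by fun_prop
    refine ⟨⟨((Q : Measure unitInterval).prod (P : Measure unitInterval)).map
      (fun z => z.1 * z.2), Measure.isProbabilityMeasure_map hmul.aemeasurable⟩, fun r hr => ?_⟩
    have hm : Measurable (fun s : unitInterval => (s : ℝ) ^ r) := by fun_prop
    rw [ProbabilityMeasure.coe_mk, integral_map hmul.aemeasurable hm.aestronglyMeasurable,
      pow_succ, ← hQ r hr, ← integral_prod_mul]
    refine integral_congr_ae (Eventually.of_forall fun z => ?_)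
    simp [Real.mul_rpow z.1.2.1 z.2.2.1]

theorem tendsto_sibuya_pow {α : ℝ} (h0 : 0 < α) {r : ℝ} (hr : 0 < r) :
    Tendsto (fun n : ℕ => (1 - (1 - Real.exp (-((n : ℝ) ^ (-1 / α)) * r)) ^ α) ^ n) atTop
      (𝓝 (Real.exp (-r ^ α))) := by
  have key : Tendsto (fun n : ℕ => (n : ℝ) * (-(1 - Real.exp (-((n : ℝ) ^ (-1 / α)) * r)) ^ α))
      atTop (𝓝 (-r ^ α)) := by
    have hε : Tendsto (fun n : ℕ => (n : ℝ) ^ (-1 / α)) atTop (𝓝[≠] 0) := by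
      rw [tendsto_nhdsWithin_iff]
      constructor
      · have := (tendsto_rpow_neg_atTop (y := 1 / α) (by positivity)).comp
          tendsto_natCast_atTop_atTop
        simpa [Function.comp_def, neg_div] using this
      · filter_upwards [eventually_gt_atTop 0] with n hn
        have : (0 : ℝ) < n := by exact_mod_cast hn
        exact (Real.rpow_pos_of_pos this _).ne'
    have hd : HasDerivAt (fun x : ℝ => 1 - Real.exp (-x * r)) r 0 := by
      have h := (((hasDerivAt_id (0 : ℝ)).neg.mul_const r).exp).const_sub 1
      simpa using h
    have h1 := hd.tendsto_slope_zero.comp hε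
    have h2 := (h1.rpow_const (p := α) (Or.inr h0.le)).neg
    refine h2.congr' ?_
    filter_upwards [eventually_gt_atTop 0] with n hn
    have hn' : (0 : ℝ) < n := by exact_mod_cast hn
    have hpos : 0 < (n : ℝ) ^ (-1 / α) := Real.rpow_pos_of_pos hn' _
    have hnn : 0 ≤ 1 - Real.exp (-((n : ℝ) ^ (-1 / α)) * r) := by
      rw [sub_nonneg, Real.exp_le_one_iff]
      have : 0 < (n : ℝ) ^ (-1 / α) * r := by positivity
      linarith
    simp only [Function.comp, zero_add, neg_zero, zero_mul, Real.exp_zero, sub_self, sub_zero,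
      smul_eq_mul]
    rw [Real.mul_rpow (inv_nonneg.2 hpos.le) hnn, Real.inv_rpow hpos.le, ← Real.rpow_mul hn'.le,
      div_mul_cancel₀ _ h0.ne', Real.rpow_neg_one, inv_inv, mul_neg]
  have := Real.tendsto_one_add_pow_exp_of_tendsto key
  simpa [sub_eq_add_neg] using this

theorem exists_stable_mellin {α : ℝ} (h0 : 0 < α) (h1 : α < 1) :
    ∃ P : ProbabilityMeasure unitInterval, ∀ r : ℝ, 0 < r →
      ∫ s, (s : ℝ) ^ r ∂(P : Measure unitInterval) = Real.exp (-r ^ α) := by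
  have hex : ∀ n : ℕ, ∃ Q : ProbabilityMeasure unitInterval, ∀ r : ℝ, 0 < r →
      ∫ s, (s : ℝ) ^ r ∂(Q : Measure unitInterval)
        = (1 - (1 - Real.exp (-((n : ℝ) ^ (-1 / α)) * r)) ^ α) ^ n := by
    intro n
    obtain ⟨P, hP⟩ := exists_sibuya h0 h1 (ε := (n : ℝ) ^ (-1 / α)) (by positivity)
    obtain ⟨Q, hQ⟩ := exists_pow_mellin P n
    exact ⟨Q, fun r hr => by rw [hQ r hr, hP r hr]⟩
  choose Q hQ using hex
  obtain ⟨P, -, hP⟩ := isCompact_univ.exists_mapClusterPt (f := atTop) (u := Q) (by simp)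
  refine ⟨P, fun r hr => ?_⟩
  let g : BoundedContinuousFunction unitInterval ℝ :=
    BoundedContinuousFunction.mkOfCompact
      ⟨fun s => (s : ℝ) ^ r, continuous_subtype_val.rpow_const fun _ => Or.inr hr.le⟩
  have hcont : Continuous fun P : ProbabilityMeasure unitInterval =>
      ∫ s, g s ∂(P : Measure unitInterval) :=
    continuous_iff_continuousAt.2 fun P =>
      (ProbabilityMeasure.tendsto_iff_forall_integral_tendsto.1 tendsto_id) g
  have hcl := hP.continuousAt_comp (hcont.continuousAt)
  have hlim : Tendsto ((fun P : ProbabilityMeasure unitInterval =>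
      ∫ s, g s ∂(P : Measure unitInterval)) ∘ Q) atTop (𝓝 (Real.exp (-r ^ α))) := by
    refine (tendsto_sibuya_pow h0 hr).congr fun n => ?_
    exact (hQ n r hr).symm
  exact eq_of_nhds_neBot (hcl.clusterPt.mono hlim)

/-- Existence of the one-sided stable laws. -/
theorem exists_stableLaw {α b : ℝ} (h0 : 0 < α) (h1 : α < 1) (hb : 0 ≤ b) :
    ∃ P : Measure ℝ, IsProbabilityMeasure P ∧ P (Iio 0) = 0 ∧
      ∀ r : ℝ, 0 < r → ∫ x, Real.exp (-r * x) ∂P = Real.exp (-b * r ^ α) := by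
  obtain ⟨P, hP⟩ := exists_stable_mellin h0 h1
  have hpos : ∀ᵐ s : unitInterval ∂(P : Measure unitInterval), (0 : ℝ) < (s : ℝ) := by
    have hS : MeasurableSet {s : unitInterval | (0 : ℝ) < (s : ℝ)} :=
      measurableSet_lt measurable_const measurable_subtype_coe
    have hu := tendsto_one_div_add_atTop_nhds_zero_nat (𝕜 := ℝ)
    have hlim1 : Tendsto (fun n : ℕ => ∫ s, (s : ℝ) ^ (1 / ((n : ℝ) + 1))
        ∂(P : Measure unitInterval)) atTop
        (𝓝 (∫ s, {s : unitInterval | (0 : ℝ) < (s : ℝ)}.indicator (fun _ => (1 : ℝ)) s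
          ∂(P : Measure unitInterval))) := by
      refine tendsto_integral_of_dominated_convergence (fun _ => 1) ?_ (integrable_const _) ?_ ?_
      · intro n
        exact (show Measurable (fun s : unitInterval => (s : ℝ) ^ (1 / ((n : ℝ) + 1))) by
          fun_prop).aestronglyMeasurable
      · intro n
        refine Eventually.of_forall fun s => ?_
        rw [Real.norm_of_nonneg (Real.rpow_nonneg s.2.1 _)]
        exact Real.rpow_le_one s.2.1 s.2.2 (by positivity)
      · refine Eventually.of_forall fun s => ?_
        rcases (s.2.1 : (0 : ℝ) ≤ s).eq_or_lt with hs | hs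
        · have : ∀ n : ℕ, (s : ℝ) ^ (1 / ((n : ℝ) + 1)) = 0 := fun n => by
            rw [← hs, Real.zero_rpow (by positivity)]
          have hmem : s ∉ {s : unitInterval | (0 : ℝ) < (s : ℝ)} := fun h => h.ne hs
          rw [indicator_of_notMem hmem]
          simp only [this]
          exact tendsto_const_nhds
        · have hmem : s ∈ {s : unitInterval | (0 : ℝ) < (s : ℝ)} := hs
          rw [indicator_of_mem hmem]
          have h := (tendsto_const_nhds (x := (s : ℝ)) (f := (atTop : Filter ℕ))).rpow hu
            (Or.inl hs.ne')
          rwa [Real.rpow_zero] at h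
    have hlim2 : Tendsto (fun n : ℕ => ∫ s, (s : ℝ) ^ (1 / ((n : ℝ) + 1))
        ∂(P : Measure unitInterval)) atTop (𝓝 1) := by
      have h : Tendsto (fun n : ℕ => Real.exp (-(1 / ((n : ℝ) + 1)) ^ α)) atTop (𝓝 1) := by
        have := ((hu.rpow_const (p := α) (Or.inr h0.le)).neg).rexp
        simpa [h0.ne'] using this
      exact h.congr fun n => (hP _ (by positivity)).symm
    have h1' := tendsto_nhds_unique hlim1 hlim2
    rw [integral_indicator hS, setIntegral_const, smul_eq_mul, mul_one, measureReal_def,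
      ENNReal.toReal_eq_one_iff] at h1'
    exact (mem_ae_iff_prob_eq_one hS).2 h1'
  let f : unitInterval → ℝ := fun s => b ^ (1 / α) * (-Real.log s)
  have hf : Measurable f := by fun_prop
  refine ⟨(P : Measure unitInterval).map f, Measure.isProbabilityMeasure_map hf.aemeasurable,
    ?_, fun r hr => ?_⟩
  · rw [Measure.map_apply hf measurableSet_Iio]
    convert measure_empty (μ := (P : Measure unitInterval))
    ext s
    simp only [mem_preimage, mem_Iio, mem_empty_iff_false, iff_false, not_lt, f]
    exact mul_nonneg (by positivity) (neg_nonneg.2 (Real.log_nonpos s.2.1 s.2.2))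
  · rw [integral_map hf.aemeasurable (by fun_prop)]
    rcases hb.eq_or_lt with rfl | hb
    · simp [f, h0.ne']
    have hc : 0 < b ^ (1 / α) := by positivity
    calc _ = ∫ s, (s : ℝ) ^ (b ^ (1 / α) * r) ∂(P : Measure unitInterval) := by
          refine integral_congr_ae ?_
          filter_upwards [hpos] with s hs
          rw [Real.rpow_def_of_pos hs]
          simp only [f]; congr 1; ring
      _ = _ := by
          rw [hP _ (by positivity), Real.mul_rpow hc.le hr.le, ← Real.rpow_mul hb.le,
            one_div_mul_cancel h0.ne', Real.rpow_one, neg_mul]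

/-- The one-sided `α`-stable law on `[0, ∞)` with Laplace transform `exp (-b * r ^ α)`, for
`0 < α < 1` and `b ≥ 0` (a finite measure on the half-line is determined by its Laplace
transform); outside this range of parameters the value is not used. -/
noncomputable def stableLaw (α b : ℝ) : Measure ℝ :=
  open Classical in
  if h : 0 < α ∧ α < 1 ∧ 0 ≤ b then (exists_stableLaw h.1 h.2.1 h.2.2).choose else Measure.dirac 0

instance (α b : ℝ) : IsProbabilityMeasure (stableLaw α b) := by
  unfold stableLaw
  split_ifs with h
  · exact (exists_stableLaw h.1 h.2.1 h.2.2).choose_spec.1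
  · infer_instance

theorem stableLaw_Iio {α b : ℝ} (h0 : 0 < α) (h1 : α < 1) (hb : 0 ≤ b) :
    stableLaw α b (Iio 0) = 0 := by
  rw [stableLaw, dif_pos ⟨h0, h1, hb⟩]
  exact (exists_stableLaw h0 h1 hb).choose_spec.2.1

theorem integral_exp_stableLaw {α b : ℝ} (h0 : 0 < α) (h1 : α < 1) (hb : 0 ≤ b) {r : ℝ}
    (hr : 0 < r) : ∫ x, Real.exp (-r * x) ∂(stableLaw α b) = Real.exp (-b * r ^ α) := by
  rw [stableLaw, dif_pos ⟨h0, h1, hb⟩]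
  exact (exists_stableLaw h0 h1 hb).choose_spec.2.2 r hr

/-- The multidimensional generalized arcsine distribution with parameters `α` and `β`: for
`0 < α < 1` the law of `(ξ₁, …, ξ_d) / ∑ ξⱼ` with independent `ξᵢ` of law `stableLaw α (β i)`,
for `α = 1` the point mass at `β`, for `α = 0` the law giving mass `β i` to the `i`-th unit
vector. -/
noncomputable def arcsineLaw {d : ℕ} (α : ℝ) (β : Fin d → ℝ) : Measure (Fin d → ℝ) :=
  open Classical in
  if α = 0 then ∑ i, ENNReal.ofReal (β i) • Measure.dirac (Pi.single i (1 : ℝ))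
  else if α = 1 then Measure.dirac β
  else (Measure.pi fun i => stableLaw α (β i)).map fun x i => x i / ∑ j, x j

theorem isProbabilityMeasure_arcsineLaw {d : ℕ} (α : ℝ) {β : Fin d → ℝ} (hβ : ∀ i, 0 ≤ β i)
    (hsum : ∑ i, β i = 1) : IsProbabilityMeasure (arcsineLaw α β) := by
  unfold arcsineLaw
  split_ifs with h h
  · constructor
    simp [← ENNReal.ofReal_sum_of_nonneg fun i _ => hβ i, hsum]
  · infer_instance
  · refine Measure.isProbabilityMeasure_map (Measurable.aemeasurable ?_)
    fun_prop

section Convergence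

variable {X : Type*} [MeasurableSpace X] {Ω : Type*} [MeasurableSpace Ω] {E : Type*}
  [TopologicalSpace E] [MeasurableSpace E] [OpensMeasurableSpace E]

/-- Strong convergence in distribution with respect to `μ`: convergence in distribution to `ζ`
under every probability measure that is absolutely continuous with respect to `μ`. -/
def TendstoStronglyInDistribution (μ : Measure X) (F : ℕ → X → E) (ζ : Ω → E) (P : Measure Ω)
    [IsProbabilityMeasure P] : Prop :=
  ∀ (ν : Measure X) [IsProbabilityMeasure ν], ν ≪ μ →
    TendstoInDistribution F atTop ζ (fun _ => ν) P

end Convergence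

section RegularVariation

/-- `f` is regularly varying of index `ρ` at infinity. -/
def IsRegularlyVarying (f : ℝ → ℝ) (ρ : ℝ) : Prop :=
  Measurable f ∧ (∀ᶠ x in atTop, 0 < f x) ∧
    ∀ r : ℝ, 0 < r → Tendsto (fun x => f (r * x) / f x) atTop (𝓝 (r ^ ρ))

/-- The sequence `a` is regularly varying of index `ρ`, i.e. `x ↦ a ⌊x⌋` is. -/
def IsRegularlyVaryingSeq (a : ℕ → ℝ) (ρ : ℝ) : Prop :=
  IsRegularlyVarying (fun x => a ⌊x⌋₊) ρ

end RegularVariation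

section DualOperator

variable {X : Type*} [MeasurableSpace X]

/-- The density with respect to `μ` of the image under `T` of the measure with density `f`, for
nonnegative `f` (negative values are replaced by `0`). -/
noncomputable def imageDensity (μ : Measure X) (T : X → X) (f : X → ℝ) : X → ℝ :=
  fun x => (((μ.withDensity fun y => ENNReal.ofReal (f y)).map T).rnDeriv μ x).toReal

theorem isFiniteMeasure_withDensity_map (μ : Measure X) (T : X → X) (f : Lp ℝ 1 μ) :
    IsFiniteMeasure ((μ.withDensity fun y => ENNReal.ofReal (f y)).map T) :=
  have : IsFiniteMeasure (μ.withDensity fun y => ENNReal.ofReal (f y)) :=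
    isFiniteMeasure_withDensity_ofReal (L1.integrable_coeFn f).2
  inferInstance

theorem integrable_imageDensity (μ : Measure X) (T : X → X) (f : Lp ℝ 1 μ) :
    Integrable (imageDensity μ T f) μ :=
  have := isFiniteMeasure_withDensity_map μ T f
  Measure.integrable_toReal_rnDeriv

/-- The dual (transfer) operator of `T` on `L¹(μ)`: the density of the image under `T` of the
signed measure `f dμ`, i.e. of the image of `f⁺ dμ` minus the image of `f⁻ dμ`. -/
noncomputable def dualOperator (μ : Measure X) (T : X → X) (f : Lp ℝ 1 μ) : Lp ℝ 1 μ :=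
  (integrable_imageDensity μ T f).toL1 _ - (integrable_imageDensity μ T (-f)).toL1 _

theorem integral_imageDensity_mul {μ : Measure X} [SigmaFinite μ] {T : X → X}
    (hT : MeasurePreserving T μ μ) (f : Lp ℝ 1 μ) {g : X → ℝ} (hg : Measurable g) :
    ∫ x, imageDensity μ T f x * g x ∂μ = ∫ x, max (f x) 0 * g (T x) ∂μ := by
  have := isFiniteMeasure_withDensity_map μ T f
  have hfm : AEMeasurable (fun y => ENNReal.ofReal (f y)) μ :=
    (Lp.aestronglyMeasurable f).aemeasurable.ennreal_ofReal
  have hac : (μ.withDensity fun y => ENNReal.ofReal (f y)).map T ≪ μ := by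
    have h := (withDensity_absolutelyContinuous μ fun y => ENNReal.ofReal (f y)).map hT.measurable
    rwa [hT.map_eq] at h
  simp only [imageDensity]
  simp_rw [← smul_eq_mul]
  rw [integral_rnDeriv_smul hac, integral_map hT.measurable.aemeasurable hg.aestronglyMeasurable,
    integral_withDensity_eq_integral_toReal_smul₀ hfm (by simp)]
  simp [ENNReal.toReal_ofReal']

/-- The characterizing duality of the dual operator, for bounded measurable `g`. -/
theorem integral_dualOperator_mul {μ : Measure X} [SigmaFinite μ] {T : X → X}
    (hT : MeasurePreserving T μ μ) (f : Lp ℝ 1 μ) {g : X → ℝ} (hg : Measurable g)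
    {C : ℝ} (hC : ∀ x, |g x| ≤ C) :
    ∫ x, dualOperator μ T f x * g x ∂μ = ∫ x, f x * g (T x) ∂μ := by
  have hi : ∀ u : X → ℝ, Integrable u μ → Integrable (fun x => u x * g x) μ := fun u hu =>
    hu.mul_bdd (c := C) hg.aestronglyMeasurable (Eventually.of_forall hC)
  have hi' : ∀ u : X → ℝ, Integrable u μ → Integrable (fun x => u x * g (T x)) μ := fun u hu =>
    hu.mul_bdd (c := C) (hg.comp hT.measurable).aestronglyMeasurable
      (Eventually.of_forall fun x => hC (T x))
  have h1 : ∫ x, dualOperator μ T f x * g x ∂μ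
      = ∫ x, (imageDensity μ T f x * g x - imageDensity μ T (-f : Lp ℝ 1 μ) x * g x) ∂μ := by
    refine integral_congr_ae ?_
    filter_upwards [Lp.coeFn_sub ((integrable_imageDensity μ T f).toL1 _)
      ((integrable_imageDensity μ T (-f)).toL1 _),
      (integrable_imageDensity μ T f).coeFn_toL1,
      (integrable_imageDensity μ T (-f)).coeFn_toL1] with x h1 h2 h3
    rw [dualOperator, h1, Pi.sub_apply, h2, h3, sub_mul]
  rw [h1, integral_sub (hi _ (integrable_imageDensity μ T f))
    (hi _ (integrable_imageDensity μ T (-f))), integral_imageDensity_mul hT f hg,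
    integral_imageDensity_mul hT (-f) hg,
    ← integral_sub (hi' _ (L1.integrable_coeFn f).pos_part)
      (hi' _ (L1.integrable_coeFn (-f)).pos_part)]
  refine integral_congr_ae ?_
  filter_upwards [Lp.coeFn_neg f] with x hx
  rw [hx, Pi.neg_apply, ← sub_mul, max_zero_sub_max_neg_zero_eq_self]

end DualOperator

section Rays

variable {X : Type*}

/-- `Y` dynamically separates the sets `A i` for `T`: an orbit that goes from `A i` to `A j`,
`i ≠ j`, visits `Y` strictly in between. -/
def DynamicallySeparates {d : ℕ} (T : X → X) (Y : Set X) (A : Fin d → Set X) : Prop :=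
  ∀ i j, i ≠ j → ∀ n, 1 ≤ n → ∀ x ∈ A i, T^[n] x ∈ A j → ∃ k, 1 ≤ k ∧ k < n ∧ T^[k] x ∈ Y

/-- `X` is the disjoint union of the junction `Y`, of positive finite measure, and the rays
`A i`, of infinite measure, and `Y` dynamically separates the rays. -/
structure IsRayDecomposition [MeasurableSpace X] {d : ℕ} (μ : Measure X) (T : X → X)
    (Y : Set X) (A : Fin d → Set X) : Prop where
  measurableSet_junction : MeasurableSet Y
  measurableSet_ray : ∀ i, MeasurableSet (A i)
  disjoint_ray : Pairwise fun i j => Disjoint (A i) (A j)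
  disjoint_junction : ∀ i, Disjoint Y (A i)
  union_eq : Y ∪ ⋃ i, A i = univ
  junction_pos : 0 < μ Y
  junction_lt_top : μ Y < ∞
  ray_eq_top : ∀ i, μ (A i) = ∞
  separates : DynamicallySeparates T Y A

/-- The set `Y_k` of points whose orbit visits `Y` for the first time at time `k ≥ 0`. -/
def firstVisit (T : X → X) (Y : Set X) (k : ℕ) : Set X :=
  {x | T^[k] x ∈ Y ∧ ∀ j < k, T^[j] x ∉ Y}

variable [MeasurableSpace X]

/-- The wandering rate `w(n) = μ(⋃_{k < n} T⁻ᵏ Y)` of `Y`. -/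
noncomputable def wanderingRate (μ : Measure X) (T : X → X) (Y : Set X) (n : ℕ) : ℝ :=
  μ.real (⋃ k ∈ Finset.range n, T^[k] ⁻¹' Y)

/-- The wandering rate `μ(⋃_{k < n} (T⁻ᵏ Y ∩ B))` of `Y` starting from `B`. -/
noncomputable def wanderingRateFrom (μ : Measure X) (T : X → X) (Y B : Set X) (n : ℕ) : ℝ :=
  μ.real (⋃ k ∈ Finset.range n, T^[k] ⁻¹' Y ∩ B)

theorem measurableSet_firstVisit_inter {T : X → X} (hT : Measurable T) {Y B : Set X}
    (hY : MeasurableSet Y) (hB : MeasurableSet B) (k : ℕ) :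
    MeasurableSet (firstVisit T Y k ∩ B) := by
  have : firstVisit T Y k = T^[k] ⁻¹' Y ∩ ⋂ j ∈ Finset.range k, (T^[j] ⁻¹' Y)ᶜ := by
    ext x; simp [firstVisit]
  rw [this]
  exact (((hT.iterate k) hY).inter
    (Finset.measurableSet_biInter _ fun j _ => ((hT.iterate j) hY).compl)).inter hB

theorem measure_firstVisit_inter_ne_top {μ : Measure X} {T : X → X}
    (hT : MeasurePreserving T μ μ) {Y : Set X} (hY : MeasurableSet Y) (hYfin : μ Y < ∞)
    (B : Set X) (k : ℕ) : μ (firstVisit T Y k ∩ B) ≠ ∞ := by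
  have h : μ (T^[k] ⁻¹' Y) = μ Y := (hT.iterate k).measure_preimage hY.nullMeasurableSet
  exact ((measure_mono fun x hx => hx.1.1).trans_lt (h.trans_lt hYfin)).ne

/-- The class in `L¹(μ)` of the indicator function of `Y_k ∩ A i`. -/
noncomputable def firstVisitIndicator {μ : Measure X} {T : X → X} {d : ℕ} {Y : Set X}
    {A : Fin d → Set X} (hT : MeasurePreserving T μ μ) (h : IsRayDecomposition μ T Y A)
    (i : Fin d) (k : ℕ) : Lp ℝ 1 μ :=
  indicatorConstLp 1
    (measurableSet_firstVisit_inter hT.measurable h.measurableSet_junction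
      (h.measurableSet_ray i) k)
    (measure_firstVisit_inter_ne_top hT h.measurableSet_junction h.junction_lt_top (A i) k) 1

/-- The set of normalized sums `w_i(n)⁻¹ ∑_{k < n} T̂ᵏ 1_{Y_k ∩ A i}`, `n ≥ 1`, in `L¹(μ)`. For the
finitely many `n` with `w_i(n) = 0` the sum vanishes, and the element is `0`. -/
noncomputable def normalizedEntrances {μ : Measure X} {T : X → X} {d : ℕ} {Y : Set X}
    {A : Fin d → Set X} (hT : MeasurePreserving T μ μ) (h : IsRayDecomposition μ T Y A)
    (i : Fin d) : Set (Lp ℝ 1 μ) :=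
  {u | ∃ n : ℕ, 1 ≤ n ∧ u = (wanderingRateFrom μ T Y (A i) n)⁻¹ •
    ∑ k ∈ Finset.range n, (dualOperator μ T)^[k] (firstVisitIndicator hT h i k)}

/-- The vector `S_n` of the occupation times `∑_{k=1}^n 1_{A i}(Tᵏ x)` of the rays. -/
noncomputable def occupationTime {d : ℕ} (T : X → X) (A : Fin d → Set X) (n : ℕ) (x : X) :
    Fin d → ℝ :=
  fun i => ∑ k ∈ Finset.Icc 1 n, (A i).indicator (fun _ => (1 : ℝ)) (T^[k] x)

end Rays

end OccupationTimes

/-! The law of the occupation times is read off from a resolvent. For rates `s > 0` and `κ i ≥ 0`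
let V(x) = ∑ₙ exp(-s n - κ · S_n(x)), evaluate it at the rates q/N and κ/N, and put R_N = (1 -
exp(-q/N)) V, a function with values in [0, 1]. For a probability ν, the integral ∫ R_N dν is an
Abel mean over n of the Laplace transforms E_ν exp(-κ · S_n / N). It remains to compute its limit
and to undo the averaging.

Ergodicity. One step of T changes R_N by a uniformly small amount, so every weak-star limit of R_N
in L^∞(μ) is T-invariant, hence constant. Thus ∫ u R_N dμ depends asymptotically only on ∫ u dμ, and
uniformly so for u in a totally bounded subset of L¹(μ) (`eventually_abs_integral_mul_sub_le`). In
particular ∫ R_N dν has the same asymptotics as the mean ρ_N of R_N over Y.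

Renewal. Between visits to Y the orbit stays in a single ray. Let W be the discount factor up to the
first visit to Y, and D the product of W and the value of V at the point of that visit. Cutting V at
the visit and using the invariance of μ gives an exact identity between ∫_Y V, the ∫_{A i} D and the
∫_{A i} W (`renewal_identity`). The means of R_N under the normalized entrance densities are ρ_N up
to a uniform o(1), because these densities form a precompact set; summation by parts then gives (1 -
exp(-q/N)) ∫_{A i} D = (ρ_N + o(1)) ∫_{A i} W. The identity becomes a linear equation for ρ_N.

Regular variation. An Abelian theorem gives ∫_{A i} W ~ β_i Γ(2 - α) (q + κ_i)^(α - 1) w(N), read as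
o(w(N)) if β_i = 0, while μ(Y) = o(w(N)). Hence ρ_N tends to q ∑ β_i (q + κ_i)^(α - 1) / ∑ β_i (q +
κ_i)^α, which is q ∫ (q + κ · x)⁻¹ under the generalized arcsine law, for all α in [0, 1] at once
(`integral_inv_arcsineLaw`).

Inversion. S_n / N is Lipschitz in n / N, so the Abel means, known for integers q, determine the
limit on the diagonal n = N (`tendsto_diagonal_of_tendsto_laplace`). Stone-Weierstrass on the unit
cube turns convergence of Laplace transforms into weak convergence. -/

namespace OccupationTimes

/-! ### Weak-star limits and ergodicity -/

section WeakLimits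

variable {X : Type*} [MeasurableSpace X]

theorem integrable_mul_of_abs_le {μ : Measure X} {u g : X → ℝ} (hu : Integrable u μ)
    (hg : Measurable g) {C : ℝ} (hC : ∀ x, |g x| ≤ C) : Integrable (fun x => u x * g x) μ :=
  hu.mul_bdd (c := C) hg.aestronglyMeasurable (Eventually.of_forall hC)

theorem abs_integral_mul_le {μ : Measure X} {u g : X → ℝ} (hu : Integrable u μ)
    {C : ℝ} (hC : ∀ x, |g x| ≤ C) :
    |∫ x, u x * g x ∂μ| ≤ C * ∫ x, |u x| ∂μ := by
  rw [← integral_const_mul, ← Real.norm_eq_abs]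
  refine norm_integral_le_of_norm_le (hu.abs.const_mul C) (Eventually.of_forall fun x => ?_)
  rw [Real.norm_eq_abs, abs_mul, mul_comm]
  exact mul_le_mul_of_nonneg_right (hC x) (abs_nonneg _)

/-- A sequence of functions bounded by `1` has a weak limit in `L²` along every ultrafilter. -/
theorem exists_tendsto_integral_mul_of_isFiniteMeasure {m : Measure X} [IsFiniteMeasure m]
    {R : ℕ → X → ℝ} (hRm : ∀ n, Measurable (R n)) (hR1 : ∀ n x, |R n x| ≤ 1) (U : Ultrafilter ℕ) :
    ∃ r : X → ℝ, Measurable r ∧ (∀ x, |r x| ≤ 1) ∧ ∀ f : X → ℝ, MemLp f 2 m →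
      Tendsto (fun n => ∫ x, f x * R n x ∂m) U (𝓝 (∫ x, f x * r x ∂m)) := by
  have hmem : ∀ n, MemLp (R n) 2 m := fun n =>
    MemLp.of_bound (hRm n).aestronglyMeasurable 1 (Eventually.of_forall (hR1 n))
  -- Each `R n` is viewed as a functional on L²(m). The norms are bounded since m is finite, so
  -- Banach-Alaoglu yields a limit along the ultrafilter.
  let Φ : ℕ → WeakDual ℝ (Lp ℝ 2 m) := fun n =>
    StrongDual.toWeakDual (InnerProductSpace.toDual ℝ (Lp ℝ 2 m) ((hmem n).toLp (R n)))
  obtain ⟨C, hC⟩ : ∃ C : ℝ, ∀ n, ‖(hmem n).toLp (R n)‖ ≤ C := by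
    refine ⟨(m univ).toReal ^ ((2 : ℝ≥0∞).toReal)⁻¹ * 1, fun n => ?_⟩
    refine Lp.norm_le_of_ae_bound zero_le_one ?_
    filter_upwards [(hmem n).coeFn_toLp] with x hx
    rw [hx]; exact hR1 n x
  have hcomp := WeakDual.isCompact_closedBall (𝕜 := ℝ) (E := Lp ℝ 2 m) 0 C
  obtain ⟨φ, -, hφ⟩ := hcomp.ultrafilter_le_nhds' (U.map Φ) (by
    refine Ultrafilter.mem_map.2 (Filter.mem_of_superset univ_mem fun n _ => ?_)
    simp only [mem_preimage, Φ, Metric.mem_closedBall, dist_zero_right]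
    change ‖InnerProductSpace.toDual ℝ (Lp ℝ 2 m) ((hmem n).toLp (R n))‖ ≤ C
    rw [LinearIsometryEquiv.norm_map]
    exact hC n)
  have hlim : ∀ v : Lp ℝ 2 m, Tendsto (fun n => Φ n v) U (𝓝 (φ v)) := fun v =>
    ((WeakDual.eval_continuous v).tendsto φ).comp hφ
  let r₀ : Lp ℝ 2 m := (InnerProductSpace.toDual ℝ (Lp ℝ 2 m)).symm (WeakDual.toStrongDual φ)
  have hr₀ : ∀ v : Lp ℝ 2 m, φ v = inner ℝ r₀ v := fun v => by
    rw [InnerProductSpace.toDual_symm_apply]; rfl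
  have hlim2 : ∀ f : X → ℝ, MemLp f 2 m →
      Tendsto (fun n => ∫ x, f x * R n x ∂m) U (𝓝 (∫ x, f x * r₀ x ∂m)) := by
    intro f hf
    have h := hlim (hf.toLp f)
    rw [hr₀] at h
    have e1 : inner ℝ r₀ (hf.toLp f) = ∫ x, f x * r₀ x ∂m := by
      rw [L2.inner_def]
      refine integral_congr_ae ?_
      filter_upwards [hf.coeFn_toLp] with x hx
      simp [hx]
    rw [e1] at h
    refine h.congr fun n => ?_
    change inner ℝ ((hmem n).toLp (R n)) (hf.toLp f) = _
    rw [L2.inner_def]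
    refine integral_congr_ae ?_
    filter_upwards [hf.coeFn_toLp, (hmem n).coeFn_toLp] with x hx hx'
    simp [hx, hx']
  have hint : Integrable r₀ m := (Lp.memLp r₀).integrable (by norm_num)
  have hset : ∀ s, MeasurableSet s →
      Tendsto (fun n => ∫ x in s, R n x ∂m) U (𝓝 (∫ x in s, r₀ x ∂m)) := by
    intro s hs
    have h := hlim2 (s.indicator fun _ => 1)
      (memLp_indicator_const 2 hs 1 (Or.inr (measure_ne_top m s)))
    simp only [← integral_indicator hs]
    convert h using 2
    all_goals
      try funext n
      refine integral_congr_ae (Eventually.of_forall fun x => ?_)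
      by_cases hx : x ∈ s <;> simp [hx]
  have hRi : ∀ n, Integrable (R n) m := fun n => (hmem n).integrable (by norm_num)
  -- The bounds -1 and 1 pass to the weak limit because they can be tested by integrals over sets.
  have hle : ∀ᵐ x ∂m, r₀ x ≤ 1 := by
    refine ae_le_of_forall_setIntegral_le hint (integrable_const _) fun s hs _ => ?_
    refine le_of_tendsto (hset s hs) (Eventually.of_forall fun n => ?_)
    exact setIntegral_mono (hRi n).integrableOn (integrable_const _).integrableOn
      fun x => (abs_le.1 (hR1 n x)).2
  have hge : ∀ᵐ x ∂m, -1 ≤ r₀ x := by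
    refine ae_le_of_forall_setIntegral_le (integrable_const _) hint fun s hs _ => ?_
    refine ge_of_tendsto (hset s hs) (Eventually.of_forall fun n => ?_)
    exact setIntegral_mono (integrable_const _).integrableOn (hRi n).integrableOn
      fun x => (abs_le.1 (hR1 n x)).1
  have hsm : AEMeasurable r₀ m := (Lp.aestronglyMeasurable r₀).aemeasurable
  -- Truncating a measurable version makes the bound hold everywhere instead of almost everywhere.
  refine ⟨fun x => max (-1) (min 1 (hsm.mk r₀ x)),
    measurable_const.max (measurable_const.min hsm.measurable_mk), fun x => ?_, fun f hf => ?_⟩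
  · exact abs_le.2 ⟨le_max_left _ _, max_le (by norm_num) (min_le_left _ _)⟩
  · convert hlim2 f hf using 2
    refine integral_congr_ae ?_
    filter_upwards [hle, hge, hsm.ae_eq_mk] with x h1 h2 h3
    rw [← h3, min_eq_right h1, max_eq_right h2]

/-- A sequence of functions bounded by `1` has a weak-star limit in `L^∞(μ)` along every
ultrafilter. -/
theorem exists_tendsto_integral_mul {μ : Measure X} [SigmaFinite μ]
    {R : ℕ → X → ℝ} (hRm : ∀ n, Measurable (R n)) (hR1 : ∀ n x, |R n x| ≤ 1) (U : Ultrafilter ℕ) :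
    ∃ r : X → ℝ, Measurable r ∧ (∀ x, |r x| ≤ 1) ∧ ∀ u : X → ℝ, Integrable u μ →
      Tendsto (fun n => ∫ x, u x * R n x ∂μ) U (𝓝 (∫ x, u x * r x ∂μ)) := by
  -- The finite measure with density `p` reduces the σ-finite case to the preceding L² result.
  obtain ⟨p, hp0, hpm, hpint⟩ := exists_pos_lintegral_lt_of_sigmaFinite μ one_ne_zero
  let m : Measure X := μ.withDensity fun x => (p x : ℝ≥0∞)
  have : IsFiniteMeasure m := isFiniteMeasure_withDensity (hpint.trans ENNReal.one_lt_top).ne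
  obtain ⟨r, hrm, hr1, hr⟩ := exists_tendsto_integral_mul_of_isFiniteMeasure (m := m) hRm hR1 U
  refine ⟨r, hrm, hr1, fun u hu => ?_⟩
  obtain ⟨v, hvm, huv⟩ := hu.1.aemeasurable
  have hv : Integrable v μ := hu.congr huv
  have hcongr : ∀ g : X → ℝ, ∫ x, u x * g x ∂μ = ∫ x, v x * g x ∂μ := fun g =>
    integral_congr_ae (huv.mono fun x hx => by simp only [hx])
  simp only [hcongr]
  -- On `S k` the quotient `v / p` is bounded by k, hence in L²(m). These truncations approximate
  -- `v` in L¹(μ), uniformly against functions bounded by 1.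
  let S : ℕ → Set X := fun k => {x | |v x| ≤ k * p x}
  have hS : ∀ k, MeasurableSet (S k) := fun k =>
    measurableSet_le hvm.abs (measurable_const.mul hpm.coe_nnreal_real)
  let vk : ℕ → X → ℝ := fun k => (S k).indicator v
  have hvk : ∀ k, Integrable (vk k) μ := fun k => hv.indicator (hS k)
  have hlimk : Tendsto (fun k => ∫ x, |v x - vk k x| ∂μ) atTop (𝓝 0) := by
    have h0 : (0 : ℝ) = ∫ _x, (0 : ℝ) ∂μ := by simp
    rw [h0]
    refine tendsto_integral_of_dominated_convergence (fun x => |v x|)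
      (fun k => (hv.sub (hvk k)).abs.aestronglyMeasurable) hv.abs (fun k => ?_) ?_
    · refine Eventually.of_forall fun x => ?_
      by_cases hx : x ∈ S k <;> simp [vk, hx]
    · refine Eventually.of_forall fun x => ?_
      obtain ⟨K, hK⟩ := exists_nat_ge (|v x| / p x)
      have hpx : (0 : ℝ) < p x := hp0 x
      refine tendsto_const_nhds.congr' ?_
      filter_upwards [eventually_ge_atTop K] with k hk
      have : x ∈ S k := by
        rw [div_le_iff₀ hpx] at hK
        exact hK.trans (mul_le_mul_of_nonneg_right (by exact_mod_cast hk) hpx.le)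
      simp [vk, this]
  have hkN : ∀ k, Tendsto (fun n => ∫ x, vk k x * R n x ∂μ) U (𝓝 (∫ x, vk k x * r x ∂μ)) := by
    intro k
    have hmeas : Measurable fun x => vk k x / p x :=
      (hvm.indicator (hS k)).div hpm.coe_nnreal_real
    have hb : MemLp (fun x => vk k x / p x) 2 m := by
      refine MemLp.of_bound hmeas.aestronglyMeasurable k
        (Eventually.of_forall fun x => ?_)
      have hpx : (0 : ℝ) < p x := hp0 x
      by_cases hx : x ∈ S k
      · simp only [vk, indicator_of_mem hx, norm_div, Real.norm_eq_abs, abs_of_pos hpx]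
        rw [div_le_iff₀ hpx]; exact hx
      · simp [vk, hx]
    have hconv : ∀ g : X → ℝ, ∫ x, vk k x / p x * g x ∂m = ∫ x, vk k x * g x ∂μ := by
      intro g
      simp only [m]
      rw [integral_withDensity_eq_integral_smul hpm]
      refine integral_congr_ae (Eventually.of_forall fun x => ?_)
      have hpx : (0 : ℝ) < p x := hp0 x
      simp only [NNReal.smul_def, smul_eq_mul]
      field_simp
    simpa only [hconv] using hr _ hb
  rw [Metric.tendsto_nhds]
  intro ε hε
  obtain ⟨k, hk⟩ := ((hlimk.eventually (gt_mem_nhds (show (0 : ℝ) < ε / 3 by positivity)))).exists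
  filter_upwards [Metric.tendsto_nhds.1 (hkN k) (ε / 3) (by positivity)] with n hn
  have hdiff : ∀ g : X → ℝ, Measurable g → (∀ x, |g x| ≤ 1) →
      |∫ x, v x * g x ∂μ - ∫ x, vk k x * g x ∂μ| ≤ ∫ x, |v x - vk k x| ∂μ := by
    intro g hgm hg
    rw [← integral_sub (integrable_mul_of_abs_le hv hgm hg)
      (integrable_mul_of_abs_le (hvk k) hgm hg)]
    simp only [← sub_mul]
    simpa using abs_integral_mul_le (hv.sub (hvk k)) hg
  have h1 := hdiff (R n) (hRm n) (hR1 n)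
  have h2 := hdiff r hrm hr1
  rw [Real.dist_eq] at hn ⊢
  rw [abs_lt] at hn ⊢
  rw [abs_le] at h1 h2
  constructor <;> linarith [hn.1, hn.2, h1.1, h1.2, h2.1, h2.2]

/-- Asymptotically `T`-invariant bounded functions are asymptotically constant, weakly-star, if `T`
is ergodic. -/
theorem tendsto_integral_mul_of_asymptotically_invariant {μ : Measure X} [SigmaFinite μ]
    {T : X → X} (hT : Ergodic T μ) {R : ℕ → X → ℝ} (hRm : ∀ n, Measurable (R n))
    (hR1 : ∀ n x, |R n x| ≤ 1)
    (hinv : ∀ ε : ℝ, 0 < ε → ∀ᶠ n in atTop, ∀ x, |R n (T x) - R n x| ≤ ε)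
    {u : X → ℝ} (hu : Integrable u μ) (hu0 : ∫ x, u x ∂μ = 0) :
    Tendsto (fun n => ∫ x, u x * R n x ∂μ) atTop (𝓝 0) := by
  -- Ultrafilters provide limit points without extracting subsequences, which would require
  -- separability of L¹(μ).
  rw [tendsto_iff_ultrafilter]
  intro U hU
  obtain ⟨r, hrm, hr1, hr⟩ := exists_tendsto_integral_mul (μ := μ) hRm hR1 U
  have hTm := hT.measurable
  -- The weak-star limit is invariant: the integral of `v` against `R n ∘ T` is that of the dual
  -- image of `v` against `R n`, so it converges to the integral against `r ∘ T`; by asymptotic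
  -- invariance it also has the limit of the integral against `R n`.
  have key : ∀ v : X → ℝ, Integrable v μ → ∫ x, v x * r (T x) ∂μ = ∫ x, v x * r x ∂μ := by
    intro v hv
    let v' : Lp ℝ 1 μ := hv.toL1 v
    have hdual : ∀ g : X → ℝ, Measurable g → (∀ x, |g x| ≤ 1) →
        ∫ x, dualOperator μ T v' x * g x ∂μ = ∫ x, v x * g (T x) ∂μ := by
      intro g hgm hg
      rw [integral_dualOperator_mul hT.toMeasurePreserving v' hgm hg]
      refine integral_congr_ae ?_
      filter_upwards [hv.coeFn_toL1] with x hx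
      rw [hx]
    have h1 := hr _ (L1.integrable_coeFn (dualOperator μ T v'))
    rw [hdual r hrm hr1] at h1
    simp only [fun n => hdual (R n) (hRm n) (hR1 n)] at h1
    have h2 := hr v hv
    have h3 : Tendsto (fun n => ∫ x, v x * R n (T x) ∂μ - ∫ x, v x * R n x ∂μ) atTop (𝓝 0) := by
      rw [Metric.tendsto_nhds]
      intro ε hε
      have hI : 0 ≤ ∫ x, |v x| ∂μ := integral_nonneg fun x => abs_nonneg _
      filter_upwards [hinv (ε / (2 * (∫ x, |v x| ∂μ + 1))) (by positivity)] with n hn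
      have hi : Integrable (fun x => v x * R n (T x)) μ :=
        integrable_mul_of_abs_le hv ((hRm n).comp hTm) fun x => hR1 n (T x)
      rw [← integral_sub hi (integrable_mul_of_abs_le hv (hRm n) (hR1 n))]
      simp only [← mul_sub]
      rw [Real.dist_eq, sub_zero]
      refine (abs_integral_mul_le hv hn).trans_lt ?_
      rw [div_mul_eq_mul_div, div_lt_iff₀ (by positivity)]
      nlinarith
    have h4 := (h1.sub h2)
    exact sub_eq_zero.1 (tendsto_nhds_unique h4 (h3.mono_left hU))
  have hae : r ∘ T =ᵐ[μ] r := by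
    obtain ⟨p, hp0, hpm, hpint⟩ := exists_pos_lintegral_lt_of_sigmaFinite μ one_ne_zero
    have hp : Integrable (fun x => (p x : ℝ)) μ := by
      refine ⟨hpm.coe_nnreal_real.aestronglyMeasurable, ?_⟩
      simpa [HasFiniteIntegral] using hpint.trans ENNReal.one_lt_top
    have hg : Measurable fun x => r (T x) - r x := (hrm.comp hTm).sub hrm
    have hg2 : ∀ x, |r (T x) - r x| ≤ 2 := fun x =>
      (abs_sub _ _).trans (by linarith [hr1 x, hr1 (T x)])
    -- Testing invariance on `p (r ∘ T - r)` leaves the integral of `p (r ∘ T - r)²`, which must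
    -- then vanish.
    have hv := integrable_mul_of_abs_le hp hg hg2
    have h := key _ hv
    have hi : Integrable (fun x => (p x : ℝ) * (r (T x) - r x) * r (T x)) μ :=
      integrable_mul_of_abs_le hv (hrm.comp hTm) fun x => hr1 (T x)
    rw [← sub_eq_zero, ← integral_sub hi (integrable_mul_of_abs_le hv hrm hr1)] at h
    have hnn : 0 ≤ᵐ[μ] fun x => (p x : ℝ) * (r (T x) - r x) * r (T x)
        - (p x : ℝ) * (r (T x) - r x) * r x := Eventually.of_forall fun x => by
      have : (p x : ℝ) * (r (T x) - r x) * r (T x) - (p x : ℝ) * (r (T x) - r x) * r x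
        = p x * (r (T x) - r x) ^ 2 := by ring
      simp only [Pi.zero_apply]
      rw [this]; positivity
    rw [integral_eq_zero_iff_of_nonneg_ae hnn
      (hi.sub (integrable_mul_of_abs_le hv hrm hr1))] at h
    filter_upwards [h] with x hx
    have hpx : (0 : ℝ) < p x := hp0 x
    have : (p x : ℝ) * (r (T x) - r x) ^ 2 = 0 := by
      simp only [Pi.zero_apply] at hx
      linear_combination hx
    rcases mul_eq_zero.1 this with h | h
    · exact absurd h hpx.ne'
    · simpa using sub_eq_zero.1 (pow_eq_zero_iff two_ne_zero |>.1 h)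
  obtain ⟨c, hc⟩ := hT.ae_eq_const_of_ae_eq_comp₀ hrm.nullMeasurable hae
  have : ∫ x, u x * r x ∂μ = 0 := by
    rw [integral_congr_ae (g := fun x => u x * c) (hc.mono fun x hx => by simp only [hx]; rfl),
      integral_mul_const, hu0, zero_mul]
  rw [← this]
  exact hr u hu

/-- The convergence in `tendsto_integral_mul_of_asymptotically_invariant` is uniform on totally
bounded sets. -/
theorem eventually_abs_integral_mul_sub_le {μ : Measure X} [SigmaFinite μ]
    {T : X → X} (hT : Ergodic T μ) {R : ℕ → X → ℝ} (hRm : ∀ n, Measurable (R n))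
    (hR1 : ∀ n x, |R n x| ≤ 1)
    (hinv : ∀ ε : ℝ, 0 < ε → ∀ᶠ n in atTop, ∀ x, |R n (T x) - R n x| ≤ ε)
    {v : X → ℝ} (hv : Integrable v μ) (hv1 : ∫ x, v x ∂μ = 1)
    {K : Set (Lp ℝ 1 μ)} (hK : TotallyBounded K) {ε : ℝ} (hε : 0 < ε) :
    ∀ᶠ n in atTop, ∀ u ∈ K,
      |∫ x, u x * R n x ∂μ - (∫ x, u x ∂μ) * ∫ x, v x * R n x ∂μ| ≤ ε := by
  have hv0 : 0 ≤ ∫ x, |v x| ∂μ := integral_nonneg fun x => abs_nonneg _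
  -- Replacing `u` by a point of the finite net costs at most δ in the first term and δ ∫|v| in the
  -- second, together ε / 2.
  set δ := ε / (2 * (1 + ∫ x, |v x| ∂μ)) with hδ
  have hδ0 : 0 < δ := by positivity
  obtain ⟨t, htf, ht⟩ := Metric.totallyBounded_iff.1 hK δ hδ0
  have hone : ∀ w : Lp ℝ 1 μ, Tendsto (fun n => ∫ x, w x * R n x ∂μ -
      (∫ x, w x ∂μ) * ∫ x, v x * R n x ∂μ) atTop (𝓝 0) := by
    intro w
    have hw := L1.integrable_coeFn w
    have hw' := hv.const_mul (∫ x, w x ∂μ)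
    -- Subtracting the right multiple of the probability density `v` gives a function of integral
    -- zero.
    have h := tendsto_integral_mul_of_asymptotically_invariant hT hRm hR1 hinv
      (u := fun x => w x - (∫ x, w x ∂μ) * v x) (hw.sub hw')
      (by rw [integral_sub hw hw', integral_const_mul, hv1]; ring)
    refine h.congr fun n => ?_
    rw [← integral_const_mul, ← integral_sub (integrable_mul_of_abs_le hw (hRm n) (hR1 n))
      ((integrable_mul_of_abs_le hv (hRm n) (hR1 n)).const_mul _)]
    refine integral_congr_ae (Eventually.of_forall fun x => ?_)
    simp only; ring
  have hall : ∀ᶠ n in atTop, ∀ w ∈ t, |∫ x, w x * R n x ∂μ -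
      (∫ x, w x ∂μ) * ∫ x, v x * R n x ∂μ| < ε / 2 := by
    rw [htf.eventually_all] 
    intro w _
    have := Metric.tendsto_nhds.1 (hone w) (ε / 2) (by positivity)
    simpa [Real.dist_eq] using this
  filter_upwards [hall] with n hn u hu
  obtain ⟨w, hwt, huw⟩ := mem_iUnion₂.1 (ht hu)
  have hw := L1.integrable_coeFn w
  have hu' := L1.integrable_coeFn u
  have hdist : ∫ x, |u x - w x| ∂μ < δ := by
    have : dist u w = ∫ x, |u x - w x| ∂μ := by
      rw [L1.dist_eq_integral_dist]; rfl
    rw [← this]; exact huw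
  have e1 : |∫ x, u x * R n x ∂μ - ∫ x, w x * R n x ∂μ| ≤ δ := by
    rw [← integral_sub (integrable_mul_of_abs_le hu' (hRm n) (hR1 n))
      (integrable_mul_of_abs_le hw (hRm n) (hR1 n))]
    simp only [← sub_mul]
    have := abs_integral_mul_le (hu'.sub hw) (hR1 n)
    simp only [Pi.sub_apply, one_mul] at this
    exact this.trans hdist.le
  have e2 : |∫ x, u x ∂μ - ∫ x, w x ∂μ| ≤ δ := by
    rw [← integral_sub hu' hw]
    exact (abs_integral_le_integral_abs).trans hdist.le
  have e3 : |∫ x, v x * R n x ∂μ| ≤ ∫ x, |v x| ∂μ := by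
    simpa using abs_integral_mul_le hv (hR1 n)
  have e4 : |(∫ x, u x ∂μ - ∫ x, w x ∂μ) * ∫ x, v x * R n x ∂μ| ≤ δ * ∫ x, |v x| ∂μ := by
    rw [abs_mul]; exact mul_le_mul e2 e3 (abs_nonneg _) hδ0.le
  have e5 := (hn w hwt).le
  have e6 : δ * (1 + ∫ x, |v x| ∂μ) = ε / 2 := by
    rw [hδ]; field_simp
  rw [abs_le] at e1 e4 e5 ⊢
  constructor <;> nlinarith

end WeakLimits

/-! ### Discounted sums along orbits -/

section DiscountedSum

variable {X : Type*} {T : X → X} {a : X → ℝ} {r : ℝ}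

/-- The sum `∑ₙ ∏_{1 ≤ k ≤ n} a (Tᵏ x)`. -/
noncomputable def discountedSum (T : X → X) (a : X → ℝ) (x : X) : ℝ :=
  ∑' n : ℕ, ∏ k ∈ Finset.range n, a (T^[k + 1] x)

theorem prod_iterate_le_pow (ha0 : ∀ x, 0 ≤ a x) (har : ∀ x, a x ≤ r) (x : X)
    (n : ℕ) :
    ∏ k ∈ Finset.range n, a (T^[k + 1] x) ≤ r ^ n := by
  simpa using Finset.prod_le_prod (s := Finset.range n) (f := fun k => a (T^[k + 1] x))
    (g := fun _ => r) (fun k _ => ha0 _) fun k _ => har _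

theorem prod_iterate_nonneg (ha0 : ∀ x, 0 ≤ a x) (x : X) (n : ℕ) :
    0 ≤ ∏ k ∈ Finset.range n, a (T^[k + 1] x) :=
  Finset.prod_nonneg fun _ _ => ha0 _

theorem summable_prod_iterate (ha0 : ∀ x, 0 ≤ a x) (har : ∀ x, a x ≤ r) (hr : r < 1) (x : X) :
    Summable fun n : ℕ => ∏ k ∈ Finset.range n, a (T^[k + 1] x) :=
  Summable.of_nonneg_of_le (prod_iterate_nonneg ha0 x) (prod_iterate_le_pow ha0 har x)
    (summable_geometric_of_lt_one ((ha0 x).trans (har x)) hr)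

theorem discountedSum_eq (ha0 : ∀ x, 0 ≤ a x) (har : ∀ x, a x ≤ r) (hr : r < 1) (x : X) :
    discountedSum T a x = 1 + a (T x) * discountedSum T a (T x) := by
  rw [discountedSum, (summable_prod_iterate ha0 har hr x).tsum_eq_zero_add, discountedSum,
    ← tsum_mul_left]
  simp [Finset.prod_range_succ', Function.iterate_succ_apply, mul_comm]

theorem discountedSum_nonneg (ha0 : ∀ x, 0 ≤ a x) (x : X) : 0 ≤ discountedSum T a x :=
  tsum_nonneg (prod_iterate_nonneg ha0 x)

theorem discountedSum_le (ha0 : ∀ x, 0 ≤ a x) (har : ∀ x, a x ≤ r) (hr : r < 1) (x : X) :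
    discountedSum T a x ≤ (1 - r)⁻¹ := by
  have hr0 := (ha0 x).trans (har x)
  rw [← tsum_geometric_of_lt_one hr0 hr]
  exact (summable_prod_iterate ha0 har hr x).tsum_le_tsum (prod_iterate_le_pow ha0 har x)
    (summable_geometric_of_lt_one hr0 hr)

theorem measurable_discountedSum [MeasurableSpace X] (hT : Measurable T) (ha : Measurable a) :
    Measurable (discountedSum T a) :=
  Measurable.tsum fun _ => Finset.measurable_prod _ fun k _ => ha.comp (hT.iterate (k + 1))

end DiscountedSum

/-! ### First visits and recurrence -/

section Entrance

variable {X : Type*} {T : X → X} {Y : Set X} {x : X} {n : ℕ}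

/-- The time of the first visit to `Y` of the orbit of a point. -/
noncomputable def entranceTime (T : X → X) (Y : Set X) (x : X) : ℕ := sInf {n | T^[n] x ∈ Y}

theorem firstVisit_zero (T : X → X) (Y : Set X) : firstVisit T Y 0 = Y := by
  ext; simp [firstVisit]

theorem mem_firstVisit_succ : x ∈ firstVisit T Y (n + 1) ↔ x ∉ Y ∧ T x ∈ firstVisit T Y n := by
  simp only [firstVisit, mem_ofPred_eq, ← Function.iterate_succ_apply]
  constructor
  · rintro ⟨h1, h2⟩
    exact ⟨h2 0 n.succ_pos, h1, fun j hj => h2 (j + 1) (by omega)⟩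
  · rintro ⟨h0, h1, h2⟩
    refine ⟨h1, fun j hj => ?_⟩
    rcases j with _ | j
    · exact h0
    · exact h2 j (by omega)

theorem entranceTime_eq (h : x ∈ firstVisit T Y n) : entranceTime T Y x = n :=
  le_antisymm (Nat.sInf_le h.1)
    (le_csInf ⟨n, h.1⟩ fun k hk => not_lt.1 fun hlt => h.2 k hlt hk)

theorem exists_mem_firstVisit (h : ∃ n, T^[n] x ∈ Y) : ∃ n, x ∈ firstVisit T Y n :=
  ⟨sInf {n | T^[n] x ∈ Y}, Nat.sInf_mem h, fun _ hj hY => Nat.notMem_of_lt_sInf hj hY⟩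

theorem disjoint_firstVisit (T : X → X) (Y : Set X) :
    Pairwise (Function.onFun Disjoint (firstVisit T Y)) := fun _ _ hmn =>
  Set.disjoint_left.2 fun _ hm hn => hmn ((entranceTime_eq hm).symm.trans (entranceTime_eq hn))

theorem measurable_entranceTime [MeasurableSpace X] (hT : Measurable T) (hY : MeasurableSet Y) :
    Measurable (entranceTime T Y) := by
  have hf : ∀ k, MeasurableSet (firstVisit T Y k) := fun k => by
    simpa using measurableSet_firstVisit_inter hT hY MeasurableSet.univ k
  refine measurable_to_countable' fun n => ?_
  -- Orbits that never visit `Y` have entrance time 0, the default value of `sInf ∅`, and so enter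
  -- the level set n = 0.
  have key : entranceTime T Y ⁻¹' {n}
      = firstVisit T Y n ∪ {x | n = 0 ∧ x ∈ (⋃ k, firstVisit T Y k)ᶜ} := by
    ext x
    simp only [mem_preimage, mem_singleton_iff, mem_union, mem_ofPred_eq, mem_compl_iff, mem_iUnion]
    constructor
    · intro h
      by_cases hx : ∃ k, x ∈ firstVisit T Y k
      · obtain ⟨k, hk⟩ := hx
        rw [entranceTime_eq hk] at h
        exact Or.inl (h ▸ hk)
      · refine Or.inr ⟨?_, hx⟩
        rw [← h, entranceTime, Nat.sInf_eq_zero]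
        refine Or.inr (eq_empty_iff_forall_notMem.2 fun k hk => hx ?_)
        exact exists_mem_firstVisit ⟨k, hk⟩
    · rintro (h | ⟨rfl, h⟩)
      · exact entranceTime_eq h
      · rw [entranceTime, Nat.sInf_eq_zero]
        exact Or.inr (eq_empty_iff_forall_notMem.2 fun k hk => h (exists_mem_firstVisit ⟨k, hk⟩))
  rw [key]
  refine (hf n).union ?_
  by_cases hn : n = 0
  · simp only [hn, true_and]
    exact (MeasurableSet.iUnion hf).compl
  · simp [hn]

/-- The orbit of almost every point visits `Y` infinitely often. -/
theorem ae_frequently_mem [MeasurableSpace X] {μ : Measure X} (hcons : Conservative T μ)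
    (herg : Ergodic T μ) (hY : MeasurableSet Y) (hpos : 0 < μ Y) :
    ∀ᵐ x ∂μ, ∃ᶠ n in atTop, T^[n] x ∈ Y := by
  let E : Set X := {x | ∃ᶠ n in atTop, T^[n] x ∈ Y}
  have hE : MeasurableSet E := by
    have : E = ⋂ N : ℕ, ⋃ n ∈ Ici N, T^[n] ⁻¹' Y := by
      ext x; simp [E, frequently_atTop]
    rw [this]
    exact MeasurableSet.iInter fun N => MeasurableSet.biUnion (to_countable _) fun n _ =>
      (herg.measurable.iterate n) hY
  have hinv : T ⁻¹' E = E := by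
    ext x
    simp only [E, mem_preimage, mem_ofPred_eq, ← Function.iterate_succ_apply]
    exact (frequently_map (f := atTop) (m := fun n : ℕ => n + 1)
      (P := fun n => T^[n] x ∈ Y)).symm.trans (by rw [map_add_atTop_eq_nat 1])
  -- The invariant set of points with infinitely many visits is null or conull. Conservativity puts
  -- almost all of `Y` into it, and `Y` has positive measure.
  rcases herg.ae_mem_or_ae_notMem hE hinv with h | h
  · exact h
  · exfalso
    have := hcons.ae_mem_imp_frequently_image_mem hY.nullMeasurableSet
    refine hpos.ne' (measure_eq_zero_iff_ae_notMem.2 ?_)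
    filter_upwards [h, this] with x h1 h2 h3
    exact h1 (h2 h3)

end Entrance

/-! ### The resolvent and its decomposition at the entrance to the junction -/

section KillingRate

variable {X : Type*} {d : ℕ}

/-- The function with value `s` on the junction and `s + κ i` on the ray `A i`. -/
noncomputable def killingRate (A : Fin d → Set X) (s : ℝ) (κ : Fin d → ℝ) (x : X) : ℝ :=
  s + ∑ i, (A i).indicator (fun _ => κ i) x

variable {T : X → X} {Y : Set X} {A : Fin d → Set X} {s : ℝ} {κ : Fin d → ℝ} {x : X} {i : Fin d}

theorem le_killingRate (hκ : ∀ i, 0 ≤ κ i) (x : X) : s ≤ killingRate A s κ x :=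
  le_add_of_nonneg_right (Finset.sum_nonneg fun i _ => indicator_nonneg (fun _ _ => hκ i) x)

theorem killingRate_le (hκ : ∀ i, 0 ≤ κ i) (x : X) : killingRate A s κ x ≤ s + ∑ i, κ i :=
  add_le_add_right (Finset.sum_le_sum fun i _ => indicator_le_self' (fun _ _ => hκ i) x) s

/-- The factor `exp (-c)`. -/
noncomputable def survival (A : Fin d → Set X) (s : ℝ) (κ : Fin d → ℝ) (x : X) : ℝ :=
  Real.exp (-killingRate A s κ x)

/-- The resolvent `∑ₙ exp (-s n - κ · S_n)`. -/
noncomputable def resolvent (T : X → X) (A : Fin d → Set X) (s : ℝ) (κ : Fin d → ℝ) : X → ℝ :=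
  discountedSum T (survival A s κ)

/-- The probability of survival until the entrance to `Y`. -/
noncomputable def entranceWeight (T : X → X) (Y : Set X) (A : Fin d → Set X) (s : ℝ)
    (κ : Fin d → ℝ) (x : X) : ℝ :=
  Real.exp (-(killingRate A s κ x * entranceTime T Y x))

/-- The contribution to the resolvent of the times after the entrance to `Y`. -/
noncomputable def entranceResolvent (T : X → X) (Y : Set X) (A : Fin d → Set X) (s : ℝ)
    (κ : Fin d → ℝ) (x : X) : ℝ :=
  entranceWeight T Y A s κ x * resolvent T A s κ (T^[entranceTime T Y x] x)

theorem survival_nonneg (x : X) : 0 ≤ survival A s κ x := (Real.exp_pos _).le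

theorem survival_le (hκ : ∀ i, 0 ≤ κ i) (x : X) : survival A s κ x ≤ Real.exp (-s) :=
  Real.exp_le_exp.2 (neg_le_neg (le_killingRate hκ x))

theorem le_survival (hκ : ∀ i, 0 ≤ κ i) (x : X) :
    Real.exp (-(s + ∑ i, κ i)) ≤ survival A s κ x :=
  Real.exp_le_exp.2 (neg_le_neg (killingRate_le hκ x))

theorem resolvent_eq (hs : 0 < s) (hκ : ∀ i, 0 ≤ κ i) (x : X) :
    resolvent T A s κ x = 1 + survival A s κ (T x) * resolvent T A s κ (T x) :=
  discountedSum_eq survival_nonneg (survival_le hκ) (by simpa using hs) x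

theorem resolvent_nonneg (x : X) : 0 ≤ resolvent T A s κ x :=
  discountedSum_nonneg survival_nonneg x

theorem one_sub_exp_mul_resolvent_le (hs : 0 < s) (hκ : ∀ i, 0 ≤ κ i) (x : X) :
    (1 - Real.exp (-s)) * resolvent T A s κ x ≤ 1 := by
  have h1 : Real.exp (-s) < 1 := by simpa using hs
  have := discountedSum_le (T := T) survival_nonneg (survival_le (A := A) hκ) h1 x
  exact (mul_le_mul_of_nonneg_left this (sub_pos.2 h1).le).trans_eq
    (mul_inv_cancel₀ (sub_pos.2 h1).ne')

theorem abs_one_sub_exp_mul_resolvent_le (hs : 0 < s) (hκ : ∀ i, 0 ≤ κ i) (x : X) :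
    |(1 - Real.exp (-s)) * resolvent T A s κ x| ≤ 1 := by
  have h1 : Real.exp (-s) < 1 := by simpa using hs
  rw [abs_of_nonneg (mul_nonneg (sub_pos.2 h1).le (resolvent_nonneg x))]
  exact one_sub_exp_mul_resolvent_le hs hκ x

/-- By the one-step equation the difference is R(Tx)(1 - a(Tx)) - (1 - exp(-s)), with R the
normalized resolvent in [0, 1] and a the survival factor, which is at least exp(-(s + ∑ κ)). The
bound vanishes when all rates tend to 0, uniformly in x. -/
theorem abs_resolvent_map_sub_le (hs : 0 < s) (hκ : ∀ i, 0 ≤ κ i) (x : X) :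
    |(1 - Real.exp (-s)) * resolvent T A s κ (T x) - (1 - Real.exp (-s)) * resolvent T A s κ x|
      ≤ (1 - Real.exp (-s)) + (1 - Real.exp (-(s + ∑ i, κ i))) := by
  have h1 : Real.exp (-s) < 1 := by simpa using hs
  have h2 := one_sub_exp_mul_resolvent_le (T := T) (A := A) hs hκ (T x)
  have h3 := mul_nonneg (sub_pos.2 h1).le (resolvent_nonneg (T := T) (A := A) (s := s) (κ := κ) (T x))
  have h4 := le_survival (A := A) (s := s) hκ (T x)
  have h5 := survival_le (A := A) (s := s) hκ (T x)
  rw [resolvent_eq hs hκ x]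
  set B := (1 - Real.exp (-s)) * resolvent T A s κ (T x)
  have : B - (1 - Real.exp (-s)) * (1 + survival A s κ (T x) * resolvent T A s κ (T x))
    = B * (1 - survival A s κ (T x)) - (1 - Real.exp (-s)) := by simp only [B]; ring
  rw [this, abs_le]
  constructor <;> nlinarith

theorem entranceWeight_of_mem_junction (hx : x ∈ Y) : entranceWeight T Y A s κ x = 1 := by
  have : x ∈ firstVisit T Y 0 := by rwa [firstVisit_zero]
  simp [entranceWeight, entranceTime_eq this]

theorem entranceResolvent_of_mem_junction (hx : x ∈ Y) :
    entranceResolvent T Y A s κ x = resolvent T A s κ x := by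
  have : x ∈ firstVisit T Y 0 := by rwa [firstVisit_zero]
  simp [entranceResolvent, entranceTime_eq this, entranceWeight]

variable [MeasurableSpace X] {μ : Measure X}

theorem IsRayDecomposition.notMem_ray (h : IsRayDecomposition μ T Y A) (hx : x ∈ Y) : x ∉ A i :=
  Set.disjoint_left.1 (h.disjoint_junction i) hx

theorem IsRayDecomposition.exists_mem_ray (h : IsRayDecomposition μ T Y A) (hx : x ∉ Y) :
    ∃ i, x ∈ A i := by
  have : x ∈ Y ∪ ⋃ i, A i := h.union_eq ▸ mem_univ x
  simpa [hx] using this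

/-- A change of ray in a single step would need a visit to `Y` strictly between times 0 and 1. -/
theorem IsRayDecomposition.map_mem (h : IsRayDecomposition μ T Y A) (hx : x ∈ A i)
    (hTx : T x ∉ Y) : T x ∈ A i := by
  obtain ⟨j, hj⟩ := h.exists_mem_ray hTx
  by_cases hij : i = j
  · exact hij ▸ hj
  · obtain ⟨k, h1, h2, -⟩ := h.separates i j hij 1 le_rfl x hx hj
    omega

theorem IsRayDecomposition.eq_of_mem (h : IsRayDecomposition μ T Y A) {j : Fin d} (hi : x ∈ A i)
    (hj : x ∈ A j) : i = j := by
  by_contra hij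
  exact Set.disjoint_left.1 (h.disjoint_ray hij) hi hj

theorem killingRate_of_mem_junction (h : IsRayDecomposition μ T Y A) (hx : x ∈ Y) :
    killingRate A s κ x = s := by
  simp [killingRate, h.notMem_ray hx]

theorem killingRate_of_mem_ray (h : IsRayDecomposition μ T Y A) (hx : x ∈ A i) :
    killingRate A s κ x = s + κ i := by
  rw [killingRate, Finset.sum_eq_single i, indicator_of_mem hx]
  · intro j _ hj
    exact indicator_of_notMem (fun hxj => hj (h.eq_of_mem hxj hx)) _
  · simp

theorem measurable_killingRate (h : IsRayDecomposition μ T Y A) (s : ℝ) (κ : Fin d → ℝ) :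
    Measurable (killingRate A s κ) :=
  measurable_const.add (Finset.measurable_sum _ fun i _ =>
    measurable_const.indicator (h.measurableSet_ray i))

theorem measurable_resolvent (hT : Measurable T) (h : IsRayDecomposition μ T Y A) (s : ℝ)
    (κ : Fin d → ℝ) : Measurable (resolvent T A s κ) :=
  measurable_discountedSum hT (measurable_killingRate h s κ).neg.exp

theorem entranceWeight_of_mem (h : IsRayDecomposition μ T Y A) {n : ℕ}
    (hx : x ∈ firstVisit T Y n ∩ A i) :
    entranceWeight T Y A s κ x = Real.exp (-(s + κ i)) ^ n := by
  rw [entranceWeight, killingRate_of_mem_ray h hx.2, entranceTime_eq hx.1, ← Real.exp_nat_mul]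
  ring_nf

theorem entranceResolvent_of_mem (h : IsRayDecomposition μ T Y A) {n : ℕ}
    (hx : x ∈ firstVisit T Y n ∩ A i) :
    entranceResolvent T Y A s κ x
      = Real.exp (-(s + κ i)) ^ n * resolvent T A s κ (T^[n] x) := by
  rw [entranceResolvent, entranceWeight_of_mem h hx, entranceTime_eq hx.1]

/-- Until it enters `Y` the orbit stays in one ray, so the rate is constant while each step lowers
the entrance time by one. If the step ends in `Y`, the remaining weight is 1. -/
theorem entranceWeight_of_mem_ray (h : IsRayDecomposition μ T Y A) (hx : x ∈ A i)
    (hv : ∃ n, T^[n] x ∈ Y) :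
    entranceWeight T Y A s κ x = Real.exp (-(s + κ i)) * entranceWeight T Y A s κ (T x) := by
  obtain ⟨n, hn⟩ := exists_mem_firstVisit hv
  rcases n with _ | n
  · rw [firstVisit_zero] at hn
    exact absurd hx (h.notMem_ray hn)
  rw [entranceWeight_of_mem h ⟨hn, hx⟩]
  have hTx := (mem_firstVisit_succ.1 hn).2
  by_cases hTY : T x ∈ Y
  · have : n = 0 := by
      rw [← entranceTime_eq hTx]
      exact entranceTime_eq (by rwa [firstVisit_zero])
    simp [this, entranceWeight_of_mem_junction hTY]
  · rw [entranceWeight_of_mem h ⟨hTx, h.map_mem hx hTY⟩]; ring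

theorem entranceResolvent_of_mem_ray (h : IsRayDecomposition μ T Y A) (hx : x ∈ A i)
    (hv : ∃ n, T^[n] x ∈ Y) :
    entranceResolvent T Y A s κ x
      = Real.exp (-(s + κ i)) * entranceResolvent T Y A s κ (T x) := by
  obtain ⟨n, hn⟩ := exists_mem_firstVisit hv
  rcases n with _ | n
  · rw [firstVisit_zero] at hn
    exact absurd hx (h.notMem_ray hn)
  have hTx := (mem_firstVisit_succ.1 hn).2
  rw [entranceResolvent, entranceResolvent, entranceWeight_of_mem_ray h hx hv, entranceTime_eq hn,
    entranceTime_eq hTx, Function.iterate_succ_apply, mul_assoc]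

/-- Decomposition of the resolvent at the entrance to `Y`. -/
theorem survival_mul_resolvent (h : IsRayDecomposition μ T Y A) (hs : 0 < s) (hκ : ∀ i, 0 ≤ κ i)
    (n : ℕ) : ∀ x ∈ firstVisit T Y n, (x ∈ A i ∨ x ∈ Y) →
    survival A s κ x * resolvent T A s κ x
      = (1 - entranceWeight T Y A s κ x) / (Real.exp (s + κ i) - 1)
        + Real.exp (-s) * entranceResolvent T Y A s κ x := by
  -- The fraction is the geometric sum of exp(-(s + κ i) k) for k from 1 to the entrance time; on
  -- `Y` it is 0. Admitting points of `Y` for any i lets the induction along the ray end there.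
  have hY : ∀ x ∈ Y, survival A s κ x * resolvent T A s κ x
      = (1 - entranceWeight T Y A s κ x) / (Real.exp (s + κ i) - 1)
        + Real.exp (-s) * entranceResolvent T Y A s κ x := fun x hx => by
    rw [survival, killingRate_of_mem_junction h hx, entranceWeight_of_mem_junction hx,
      entranceResolvent_of_mem_junction hx]
    simp
  induction n with
  | zero =>
    intro x hx _
    exact hY x (by rwa [firstVisit_zero] at hx)
  | succ n ih =>
    intro x hx hxA
    obtain ⟨hxY, hTx⟩ := mem_firstVisit_succ.1 hx
    have hxi : x ∈ A i := hxA.resolve_right hxY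
    have hv : ∃ n, T^[n] x ∈ Y := ⟨_, hx.1⟩
    have hTx' : T x ∈ A i ∨ T x ∈ Y := by
      by_cases hTY : T x ∈ Y
      · exact Or.inr hTY
      · exact Or.inl (h.map_mem hxi hTY)
    rw [resolvent_eq hs hκ, ih (T x) hTx hTx', entranceWeight_of_mem_ray h hxi hv,
      entranceResolvent_of_mem_ray h hxi hv, survival, killingRate_of_mem_ray h hxi]
    have hc : 1 < Real.exp (s + κ i) := by
      rw [Real.one_lt_exp_iff]; linarith [hκ i]
    have hc' : Real.exp (s + κ i) - 1 ≠ 0 := by linarith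
    rw [Real.exp_neg (s + κ i)]
    have hc0 : Real.exp (s + κ i) ≠ 0 := by positivity
    field_simp
    ring

/-- The first step decomposition of the resolvent on the junction. -/
theorem resolvent_of_mem_junction (h : IsRayDecomposition μ T Y A) (hs : 0 < s)
    (hκ : ∀ i, 0 ≤ κ i) (hv : ∃ n, T^[n] (T x) ∈ Y) :
    resolvent T A s κ x = 1 + ∑ i, (A i).indicator
        (fun y => (1 - entranceWeight T Y A s κ y) / (Real.exp (s + κ i) - 1)) (T x)
      + Real.exp (-s) * entranceResolvent T Y A s κ (T x) := by
  obtain ⟨n, hn⟩ := exists_mem_firstVisit hv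
  rw [resolvent_eq hs hκ]
  by_cases hTY : T x ∈ Y
  · have hz : ∀ i, (A i).indicator
        (fun y => (1 - entranceWeight T Y A s κ y) / (Real.exp (s + κ i) - 1)) (T x) = 0 := fun i =>
      indicator_of_notMem (h.notMem_ray hTY) _
    simp [hz, survival, killingRate_of_mem_junction h hTY, entranceResolvent_of_mem_junction hTY]
  · obtain ⟨i, hi⟩ := h.exists_mem_ray hTY
    rw [survival_mul_resolvent h hs hκ n _ hn (Or.inl hi), Finset.sum_eq_single i,
      indicator_of_mem hi]
    · ring
    · intro j _ hj
      exact indicator_of_notMem (fun hxj => hj (h.eq_of_mem hxj hi)) _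
    · simp

end KillingRate

/-! ### Mass balance and the renewal identity -/

section Renewal

variable {X : Type*} [MeasurableSpace X] {μ : Measure X} {T : X → X} {Y : Set X} {d : ℕ}
  {A : Fin d → Set X} {s : ℝ} {κ : Fin d → ℝ}

theorem measurableSet_firstVisit (hT : Measurable T) (hY : MeasurableSet Y) (k : ℕ) :
    MeasurableSet (firstVisit T Y k) := by
  simpa using measurableSet_firstVisit_inter hT hY MeasurableSet.univ k

theorem integral_comp_of_measurePreserving (hT : MeasurePreserving T μ μ) {f : X → ℝ}
    (hf : AEStronglyMeasurable f μ) : ∫ x, f (T x) ∂μ = ∫ x, f x ∂μ := by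
  have h := integral_map (μ := μ) hT.measurable.aemeasurable (f := f) (by rwa [hT.map_eq])
  rw [hT.map_eq] at h
  exact h.symm

theorem measureReal_firstVisit_inter_le (hT : MeasurePreserving T μ μ) (hY : MeasurableSet Y)
    (hfin : μ Y < ∞) (B : Set X) (n : ℕ) : μ.real (firstVisit T Y n ∩ B) ≤ μ.real Y := by
  have h : μ.real (T^[n] ⁻¹' Y) = μ.real Y :=
    (hT.iterate n).measureReal_preimage hY.nullMeasurableSet
  rw [← h]
  refine measureReal_mono (fun x hx => hx.1.1) ?_
  rw [(hT.iterate n).measure_preimage hY.nullMeasurableSet]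
  exact hfin.ne

theorem IsRayDecomposition.compl_junction (h : IsRayDecomposition μ T Y A) : Yᶜ = ⋃ i, A i := by
  ext x
  refine ⟨fun hx => mem_iUnion.2 (h.exists_mem_ray hx), fun hx hxY => ?_⟩
  obtain ⟨i, hi⟩ := mem_iUnion.1 hx
  exact h.notMem_ray hxY hi

theorem IsRayDecomposition.integral_eq (h : IsRayDecomposition μ T Y A) {f : X → ℝ}
    (hf : Integrable f μ) : ∫ x, f x ∂μ = ∫ x in Y, f x ∂μ + ∑ i, ∫ x in A i, f x ∂μ := by
  rw [← integral_add_compl h.measurableSet_junction hf, h.compl_junction,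
    integral_iUnion_fintype h.measurableSet_ray h.disjoint_ray fun i => hf.integrableOn]

theorem ae_exists_mem (hrec : ∀ᵐ x ∂μ, ∃ᶠ n in atTop, T^[n] x ∈ Y) :
    ∀ᵐ x ∂μ, (∃ n, T^[n] x ∈ Y) ∧ ∃ n, T^[n] (T x) ∈ Y := by
  filter_upwards [hrec] with x hx
  refine ⟨hx.exists, ?_⟩
  obtain ⟨n, hn, hn'⟩ := (frequently_atTop.1 hx) 1
  obtain ⟨k, rfl⟩ := Nat.exists_eq_add_of_le' hn
  exact ⟨k, by rwa [← Function.iterate_succ_apply]⟩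

theorem ae_mem_iUnion_firstVisit (hrec : ∀ᵐ x ∂μ, ∃ᶠ n in atTop, T^[n] x ∈ Y) :
    ∀ᵐ x ∂μ, x ∈ ⋃ n, firstVisit T Y n := by
  filter_upwards [hrec] with x hx
  exact mem_iUnion.2 (exists_mem_firstVisit hx.exists)

theorem measurable_entranceWeight (hT : Measurable T) (h : IsRayDecomposition μ T Y A) (s : ℝ)
    (κ : Fin d → ℝ) : Measurable (entranceWeight T Y A s κ) :=
  ((measurable_killingRate h s κ).mul (measurable_from_nat (f := fun n : ℕ => (n : ℝ)) |>.comp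
    (measurable_entranceTime hT h.measurableSet_junction))).neg.exp

theorem measurable_entranceResolvent (hT : Measurable T) (h : IsRayDecomposition μ T Y A) (s : ℝ)
    (κ : Fin d → ℝ) : Measurable (entranceResolvent T Y A s κ) := by
  have h1 : Measurable fun z : ℕ × X => T^[z.1] z.2 :=
    measurable_from_prod_countable_right fun n => hT.iterate n
  have h2 : Measurable fun x => T^[entranceTime T Y x] x :=
    h1.comp (f := fun x => (entranceTime T Y x, x))
      ((measurable_entranceTime hT h.measurableSet_junction).prodMk measurable_id)
  have h2 := (measurable_resolvent hT h s κ).comp h2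
  unfold entranceResolvent
  exact (measurable_entranceWeight hT h s κ).mul h2

/-- On Y_n the weight is at most exp(-s n), and μ(Y_n) ≤ μ(Y); the sets Y_n cover almost everything.
-/
theorem integrable_entranceWeight (hT : MeasurePreserving T μ μ) (h : IsRayDecomposition μ T Y A)
    (hrec : ∀ᵐ x ∂μ, ∃ᶠ n in atTop, T^[n] x ∈ Y) (hs : 0 < s) (hκ : ∀ i, 0 ≤ κ i) :
    Integrable (entranceWeight T Y A s κ) μ := by
  have hF := measurableSet_firstVisit hT.measurable h.measurableSet_junction
  have hm := measurable_entranceWeight hT.measurable h s κ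
  have hle : ∀ n, ∀ x ∈ firstVisit T Y n,
      ‖entranceWeight T Y A s κ x‖ ≤ Real.exp (-s) ^ n := by
    intro n x hx
    rw [entranceWeight, Real.norm_of_nonneg (Real.exp_pos _).le, entranceTime_eq hx,
      ← Real.exp_nat_mul, Real.exp_le_exp]
    have := mul_le_mul_of_nonneg_right (le_killingRate (A := A) (s := s) hκ x)
      (Nat.cast_nonneg (α := ℝ) n)
    linarith
  have hfin : ∀ n, μ (firstVisit T Y n) < ∞ := fun n => by
    simpa using (measure_firstVisit_inter_ne_top hT h.measurableSet_junction h.junction_lt_top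
      univ n).lt_top
  have hon : ∀ n, IntegrableOn (entranceWeight T Y A s κ) (firstVisit T Y n) μ := fun n =>
    IntegrableOn.of_bound (hfin n) hm.aestronglyMeasurable _
      (ae_restrict_of_forall_mem (hF n) (hle n))
  rw [← integrableOn_univ, ← integrableOn_congr_set_ae
    (eventuallyEq_univ.2 (ae_mem_iUnion_firstVisit hrec))]
  refine integrableOn_iUnion_of_summable_integral_norm hon ?_
  have hr : Real.exp (-s) < 1 := by simpa using hs
  refine Summable.of_nonneg_of_le (fun n => integral_nonneg fun x => norm_nonneg _) (fun n => ?_)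
    ((summable_geometric_of_lt_one (Real.exp_pos _).le hr).mul_right (μ.real Y))
  calc ∫ x in firstVisit T Y n, ‖entranceWeight T Y A s κ x‖ ∂μ
      ≤ ∫ _x in firstVisit T Y n, Real.exp (-s) ^ n ∂μ :=
        setIntegral_mono_on (hon n).norm (integrableOn_const (hfin n).ne) (hF n) (hle n)
    _ = Real.exp (-s) ^ n * μ.real (firstVisit T Y n) := by
        rw [setIntegral_const, smul_eq_mul, mul_comm]
    _ ≤ _ := by
        refine mul_le_mul_of_nonneg_left ?_ (by positivity)
        simpa using measureReal_firstVisit_inter_le hT h.measurableSet_junction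
          h.junction_lt_top univ n

theorem integrable_entranceResolvent (hT : MeasurePreserving T μ μ)
    (h : IsRayDecomposition μ T Y A) (hrec : ∀ᵐ x ∂μ, ∃ᶠ n in atTop, T^[n] x ∈ Y) (hs : 0 < s)
    (hκ : ∀ i, 0 ≤ κ i) : Integrable (entranceResolvent T Y A s κ) μ := by
  have hr : Real.exp (-s) < 1 := by simpa using hs
  refine ((integrable_entranceWeight hT h hrec hs hκ).const_mul (1 - Real.exp (-s))⁻¹).mono'
    (measurable_entranceResolvent hT.measurable h s κ).aestronglyMeasurable
    (Eventually.of_forall fun x => ?_)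
  have h1 : 0 ≤ entranceWeight T Y A s κ x := (Real.exp_pos _).le
  have h2 : resolvent T A s κ (T^[entranceTime T Y x] x) ≤ (1 - Real.exp (-s))⁻¹ :=
    discountedSum_le survival_nonneg (survival_le hκ) hr _
  rw [entranceResolvent, Real.norm_of_nonneg (mul_nonneg h1 (resolvent_nonneg _)), mul_comm]
  exact mul_le_mul_of_nonneg_right h2 h1

theorem eq_of_hasSum_of_eq_add {y e : ℕ → ℝ} {S : ℝ} (hy : ∀ n, y n = y (n + 1) + e n)
    (h0 : Tendsto y atTop (𝓝 0)) (he : HasSum e S) : S = y 0 := by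
  have h1 : ∀ n, ∑ k ∈ Finset.range n, e k = y 0 - y n := fun n => by
    induction n with
    | zero => simp
    | succ n ih => rw [Finset.sum_range_succ, ih, hy n]; ring
  have h2 := he.tendsto_sum_nat
  simp only [h1] at h2
  simpa using tendsto_nhds_unique h2 (tendsto_const_nhds.sub h0)

/-- The preimage of Y_n ∩ B has the same measure and splits into a part in `Y` and a part outside.
The outer part is Y_{n+1} ∩ B as soon as `B` is not left or entered by steps that start outside `Y`.
-/
theorem measureReal_firstVisit_eq_add (hT : MeasurePreserving T μ μ) (hY : MeasurableSet Y)
    (hfin : μ Y < ∞) {B : Set X} (hB : MeasurableSet B) {n : ℕ}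
    (hinv : ∀ x, x ∉ Y → T x ∈ firstVisit T Y n → (T x ∈ B ↔ x ∈ B)) :
    μ.real (firstVisit T Y n ∩ B) = μ.real (firstVisit T Y (n + 1) ∩ B)
      + μ.real (Y ∩ T ⁻¹' (firstVisit T Y n ∩ B)) := by
  have hF := measurableSet_firstVisit_inter hT.measurable hY hB n
  have hne := measure_firstVisit_inter_ne_top hT hY hfin B n
  have hpre : μ (T ⁻¹' (firstVisit T Y n ∩ B)) = μ (firstVisit T Y n ∩ B) :=
    hT.measure_preimage hF.nullMeasurableSet
  have h1 := measureReal_inter_add_sdiff (μ := μ) (s := T ⁻¹' (firstVisit T Y n ∩ B)) hY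
    (by rw [hpre]; exact hne)
  have h2 : T ⁻¹' (firstVisit T Y n ∩ B) \ Y = firstVisit T Y (n + 1) ∩ B := by
    ext x
    simp only [Set.mem_sdiff, mem_preimage, mem_inter_iff, mem_firstVisit_succ]
    constructor
    · rintro ⟨⟨h1, h2⟩, h3⟩
      exact ⟨⟨h3, h1⟩, (hinv x h3 h1).1 h2⟩
    · rintro ⟨⟨h3, h1⟩, h2⟩
      exact ⟨⟨h1, (hinv x h3 h1).2 h2⟩, h3⟩
  rw [h2, measureReal_def, measureReal_def, measureReal_def, hpre] at h1
  rw [measureReal_def, measureReal_def, measureReal_def, ← h1, inter_comm Y, add_comm]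

/-- Up to a null set, Y ∩ T⁻¹B is partitioned by the entrance time of the image point. -/
theorem hasSum_measureReal_junction_inter (hT : MeasurePreserving T μ μ) (hY : MeasurableSet Y)
    (hfin : μ Y < ∞) (hrec : ∀ᵐ x ∂μ, ∃ᶠ n in atTop, T^[n] x ∈ Y) {B : Set X}
    (hB : MeasurableSet B) :
    HasSum (fun n => μ.real (Y ∩ T ⁻¹' (firstVisit T Y n ∩ B))) (μ.real (Y ∩ T ⁻¹' B)) := by
  have hU : μ (⋃ n, Y ∩ T ⁻¹' (firstVisit T Y n ∩ B)) = μ (Y ∩ T ⁻¹' B) := by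
    refine measure_congr ?_
    filter_upwards [ae_exists_mem hrec] with x hx
    obtain ⟨n, hn⟩ := exists_mem_firstVisit hx.2
    refine propext ⟨fun hxU => ?_, fun hxY => mem_iUnion.2 ⟨n, hxY.1, hn, hxY.2⟩⟩
    obtain ⟨k, hk⟩ := mem_iUnion.1 hxU
    exact ⟨hk.1, hk.2.2⟩
  rw [measure_iUnion (fun m n hmn => ?_) fun n => hY.inter
    (hT.measurable (measurableSet_firstVisit_inter hT.measurable hY hB n))] at hU
  · rw [measureReal_def, ← hU, ENNReal.tsum_toReal_eq fun n =>
      ((measure_mono inter_subset_left).trans_lt hfin).ne]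
    refine (ENNReal.summable_toReal ?_).hasSum
    rw [hU]
    exact ((measure_mono inter_subset_left).trans_lt hfin).ne
  · exact ((((disjoint_firstVisit T Y hmn).mono inter_subset_left inter_subset_left).preimage
      T).mono inter_subset_right inter_subset_right)

/-- The mass balance telescopes to μ(Y) - μ(Y_n), and its total is μ(Y) because almost every point
returns to `Y`. -/
theorem tendsto_measureReal_firstVisit (hT : MeasurePreserving T μ μ) (hY : MeasurableSet Y)
    (hfin : μ Y < ∞) (hrec : ∀ᵐ x ∂μ, ∃ᶠ n in atTop, T^[n] x ∈ Y) :
    Tendsto (fun n => μ.real (firstVisit T Y n)) atTop (𝓝 0) := by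
  have hstep : ∀ n, μ.real (firstVisit T Y n) = μ.real (firstVisit T Y (n + 1))
      + μ.real (Y ∩ T ⁻¹' firstVisit T Y n) := fun n => by
    simpa using measureReal_firstVisit_eq_add hT hY hfin MeasurableSet.univ (n := n) (by simp)
  have hsum := hasSum_measureReal_junction_inter hT hY hfin hrec MeasurableSet.univ
  simp only [inter_univ, preimage_univ] at hsum
  have h1 : ∀ n, ∑ k ∈ Finset.range n, μ.real (Y ∩ T ⁻¹' firstVisit T Y k)
      = μ.real Y - μ.real (firstVisit T Y n) := fun n => by
    induction n with
    | zero => simp [firstVisit_zero]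
    | succ n ih => rw [Finset.sum_range_succ, ih, hstep n]; ring
  have h2 := hsum.tendsto_sum_nat
  simp only [h1] at h2
  simpa using h2.const_sub (μ.real Y)

/-- The flux into the ray `A i` equals the flux out of it. -/
theorem measureReal_junction_inter_preimage_ray (hT : MeasurePreserving T μ μ)
    (h : IsRayDecomposition μ T Y A) (hrec : ∀ᵐ x ∂μ, ∃ᶠ n in atTop, T^[n] x ∈ Y) (i : Fin d) :
    μ.real (Y ∩ T ⁻¹' A i) = μ.real (firstVisit T Y 1 ∩ A i) := by
  have hY := h.measurableSet_junction
  have hsum := hasSum_measureReal_junction_inter hT hY h.junction_lt_top hrec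
    (h.measurableSet_ray i)
  -- The term n = 0 vanishes, so the flux is a telescoping sum starting from Y_1 ∩ A i.
  have hz : firstVisit T Y 0 ∩ A i = ∅ := by
    rw [firstVisit_zero]; exact (h.disjoint_junction i).inter_eq
  rw [← hasSum_nat_add_iff' 1] at hsum
  simp only [Finset.sum_range_one, hz, preimage_empty, inter_empty, measureReal_empty,
    sub_zero] at hsum
  refine eq_of_hasSum_of_eq_add (y := fun n => μ.real (firstVisit T Y (n + 1) ∩ A i))
    (fun n => ?_) ?_ hsum
  · refine measureReal_firstVisit_eq_add hT hY h.junction_lt_top (h.measurableSet_ray i)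
      fun x hx hTx => ⟨fun hi => ?_, fun hi => h.map_mem hi (mem_firstVisit_succ.1 hTx).1⟩
    obtain ⟨j, hj⟩ := h.exists_mem_ray hx
    rwa [h.eq_of_mem hi (h.map_mem hj (mem_firstVisit_succ.1 hTx).1)]
  · refine squeeze_zero (fun _ => measureReal_nonneg) (fun n => measureReal_mono inter_subset_left ?_)
      ((tendsto_measureReal_firstVisit hT hY h.junction_lt_top hrec).comp (tendsto_add_atTop_nat 1))
    simpa using measure_firstVisit_inter_ne_top hT hY h.junction_lt_top univ (n + 1)

/-- Invariance of μ is applied to the weight restricted to `A i`: this ray is reached only from `Y`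
and from `A i` itself, and along `A i` a step multiplies the weight by exp(s + κ i). -/
theorem exp_sub_one_mul_setIntegral_entranceWeight (hT : MeasurePreserving T μ μ)
    (h : IsRayDecomposition μ T Y A) (hrec : ∀ᵐ x ∂μ, ∃ᶠ n in atTop, T^[n] x ∈ Y) (hs : 0 < s)
    (hκ : ∀ i, 0 ≤ κ i) (i : Fin d) :
    ∫ x in Y, (A i).indicator (entranceWeight T Y A s κ) (T x) ∂μ
      = μ.real (firstVisit T Y 1 ∩ A i)
        - (Real.exp (s + κ i) - 1) * ∫ x in A i, entranceWeight T Y A s κ x ∂μ := by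
  have hint := integrable_entranceWeight hT h hrec hs hκ
  have hi := hint.indicator (h.measurableSet_ray i)
  have hiT : Integrable (fun x => (A i).indicator (entranceWeight T Y A s κ) (T x)) μ :=
    hT.integrable_comp_of_integrable hi
  have h1 := integral_comp_of_measurePreserving hT hi.1
  rw [h.integral_eq hiT, integral_indicator (h.measurableSet_ray i),
    Finset.sum_eq_single i] at h1
  · have hF := measurableSet_firstVisit_inter hT.measurable h.measurableSet_junction
      (h.measurableSet_ray i) 1
    -- The subtracted indicator corrects for points stepping into `Y`, where exp(s + κ i) times the
    -- weight is 1 but the image has left `A i`.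
    have h2 : ∫ x in A i, (A i).indicator (entranceWeight T Y A s κ) (T x) ∂μ
        = ∫ x in A i, (Real.exp (s + κ i) * entranceWeight T Y A s κ x
          - (firstVisit T Y 1 ∩ A i).indicator (fun _ => (1 : ℝ)) x) ∂μ := by
      refine setIntegral_congr_ae (h.measurableSet_ray i) ?_
      filter_upwards [ae_exists_mem hrec] with x hx hxi
      rw [entranceWeight_of_mem_ray h hxi hx.1, ← mul_assoc, ← Real.exp_add, add_neg_cancel,
        Real.exp_zero, one_mul]
      have hxY : x ∉ Y := fun hxY => h.notMem_ray hxY hxi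
      by_cases hTY : T x ∈ Y
      · have : x ∈ firstVisit T Y 1 ∩ A i :=
          ⟨mem_firstVisit_succ.2 ⟨hxY, by rwa [firstVisit_zero]⟩, hxi⟩
        rw [indicator_of_notMem (h.notMem_ray hTY), indicator_of_mem this,
          entranceWeight_of_mem_junction hTY, sub_self]
      · have : x ∉ firstVisit T Y 1 ∩ A i := fun hx1 => hTY (by
          simpa [firstVisit_zero] using (mem_firstVisit_succ.1 hx1.1).2)
        rw [indicator_of_mem (h.map_mem hxi hTY), indicator_of_notMem this, sub_zero]
    have h3 : Integrable ((firstVisit T Y 1 ∩ A i).indicator fun _ => (1 : ℝ)) μ :=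
      (integrable_indicator_iff hF).2 (integrableOn_const (measure_firstVisit_inter_ne_top hT
        h.measurableSet_junction h.junction_lt_top (A i) 1))
    rw [h2, integral_sub (hint.integrableOn.const_mul _) h3.integrableOn, integral_const_mul,
      setIntegral_indicator hF, setIntegral_const, smul_eq_mul, mul_one,
      inter_eq_right.2 inter_subset_right] at h1
    linarith
  -- A step from another ray `A j` cannot land in `A i`, so these integrals vanish.
  · intro j _ hj
    refine (setIntegral_congr_fun (h.measurableSet_ray j) fun x hx => ?_).trans (integral_zero X ℝ)
    refine indicator_of_notMem (fun hi' => ?_) _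
    by_cases hTY : T x ∈ Y
    · exact h.notMem_ray hTY hi'
    · exact hj (h.eq_of_mem (h.map_mem hx hTY) hi')
  · simp

/-- The renewal identity for the resolvent. -/
theorem renewal_identity (hT : MeasurePreserving T μ μ)
    (h : IsRayDecomposition μ T Y A) (hrec : ∀ᵐ x ∂μ, ∃ᶠ n in atTop, T^[n] x ∈ Y) (hs : 0 < s)
    (hκ : ∀ i, 0 ≤ κ i) :
    (1 - Real.exp (-s)) * ∫ x in Y, resolvent T A s κ x ∂μ
      + Real.exp (-s) * ∑ i, (Real.exp (s + κ i) - 1)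
        * ∫ x in A i, entranceResolvent T Y A s κ x ∂μ
      = μ.real Y + ∑ i, ∫ x in A i, entranceWeight T Y A s κ x ∂μ := by
  have hY := h.measurableSet_junction
  have hint := integrable_entranceWeight hT h hrec hs hκ
  have hD := integrable_entranceResolvent hT h hrec hs hκ
  have hDT : Integrable (fun x => entranceResolvent T Y A s κ (T x)) μ :=
    hT.integrable_comp_of_integrable hD
  have h1 := integral_comp_of_measurePreserving hT hD.1
  have hray : ∀ i, ∫ x in A i, entranceResolvent T Y A s κ (T x) ∂μ
      = Real.exp (s + κ i) * ∫ x in A i, entranceResolvent T Y A s κ x ∂μ := fun i => by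
    rw [← integral_const_mul]
    refine setIntegral_congr_ae (h.measurableSet_ray i) ?_
    filter_upwards [ae_exists_mem hrec] with x hx hxi
    rw [entranceResolvent_of_mem_ray h hxi hx.1, ← mul_assoc, ← Real.exp_add, add_neg_cancel,
      Real.exp_zero, one_mul]
  have hYD : ∫ x in Y, entranceResolvent T Y A s κ x ∂μ = ∫ x in Y, resolvent T A s κ x ∂μ :=
    setIntegral_congr_fun hY fun x hx => entranceResolvent_of_mem_junction hx
  -- The time spent in `A i`, discounted, on an excursion that enters `A i` at the given point.
  let K : Fin d → X → ℝ := fun i => (A i).indicator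
    (fun y => (1 - entranceWeight T Y A s κ y) / (Real.exp (s + κ i) - 1))
  have hone : ∀ i, IntegrableOn (fun x => (A i).indicator (fun _ => (1 : ℝ)) (T x)) Y μ := fun i =>
    IntegrableOn.of_bound h.junction_lt_top ((measurable_const.indicator
      (h.measurableSet_ray i)).comp hT.measurable).aestronglyMeasurable 1
      (Eventually.of_forall fun x => (norm_indicator_le_norm_self _ _).trans (by simp))
  have hwT : ∀ i, IntegrableOn
      (fun x => (A i).indicator (entranceWeight T Y A s κ) (T x)) Y μ := fun i =>
    (hT.integrable_comp_of_integrable (hint.indicator (h.measurableSet_ray i))).integrableOn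
  have hKeq : ∀ i x, K i (T x) = (Real.exp (s + κ i) - 1)⁻¹ *
      ((A i).indicator (fun _ => (1 : ℝ)) (T x)
        - (A i).indicator (entranceWeight T Y A s κ) (T x)) := fun i x => by
    by_cases hx : T x ∈ A i
    · simp only [K, indicator_of_mem hx]; ring
    · simp [K, indicator_of_notMem hx]
  have hKint : ∀ i, IntegrableOn (fun x => K i (T x)) Y μ := fun i => by
    simp only [hKeq]
    exact ((hone i).sub (hwT i)).const_mul _
  -- The flux into `A i` equals the flux out of it and cancels. What remains is exp(s + κ i) - 1
  -- times the integral of the weight, divided by the same factor.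
  have hK : ∀ i, ∫ x in Y, K i (T x) ∂μ = ∫ x in A i, entranceWeight T Y A s κ x ∂μ := fun i => by
    have hc : Real.exp (s + κ i) - 1 ≠ 0 := by
      have : 1 < Real.exp (s + κ i) := by rw [Real.one_lt_exp_iff]; linarith [hκ i]
      linarith
    have hpre : MeasurableSet (T ⁻¹' A i) := hT.measurable (h.measurableSet_ray i)
    have e1 : ∫ x in Y, (A i).indicator (fun _ => (1 : ℝ)) (T x) ∂μ
        = μ.real (firstVisit T Y 1 ∩ A i) := by
      rw [← measureReal_junction_inter_preimage_ray hT h hrec i]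
      have : (fun x => (A i).indicator (fun _ => (1 : ℝ)) (T x))
          = (T ⁻¹' A i).indicator fun _ => (1 : ℝ) := rfl
      rw [this, setIntegral_indicator hpre, setIntegral_const, smul_eq_mul, mul_one]
    simp only [hKeq]
    rw [integral_const_mul, integral_sub (hone i) (hwT i), e1,
      exp_sub_one_mul_setIntegral_entranceWeight hT h hrec hs hκ i]
    field_simp
    ring
  have hVY : ∫ x in Y, resolvent T A s κ x ∂μ = μ.real Y
      + ∑ i, ∫ x in A i, entranceWeight T Y A s κ x ∂μ
      + Real.exp (-s) * ∫ x in Y, entranceResolvent T Y A s κ (T x) ∂μ := by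
    have e1 : ∫ x in Y, resolvent T A s κ x ∂μ = ∫ x in Y, (1 + ∑ i, K i (T x)
        + Real.exp (-s) * entranceResolvent T Y A s κ (T x)) ∂μ := by
      refine setIntegral_congr_ae hY ?_
      filter_upwards [ae_exists_mem hrec] with x hx _
      exact resolvent_of_mem_junction h hs hκ hx.2
    have i1 : IntegrableOn (fun _ => (1 : ℝ)) Y μ := integrableOn_const h.junction_lt_top.ne
    have i2 : IntegrableOn (fun x => ∑ i, K i (T x)) Y μ :=
      integrable_finsetSum _ fun i _ => hKint i
    have i12 : IntegrableOn (fun x => 1 + ∑ i, K i (T x)) Y μ := i1.add i2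
    rw [e1, integral_add i12 (hDT.integrableOn.const_mul _), integral_add i1 i2,
      integral_finsetSum _ fun i _ => hKint i, setIntegral_const, smul_eq_mul, mul_one,
      integral_const_mul]
    simp only [hK]
  -- Invariance of μ, split over `Y` and the rays, eliminates the integral over `Y` of the shifted
  -- entrance resolvent.
  rw [h.integral_eq hDT, h.integral_eq hD, hYD] at h1
  simp only [hray] at h1
  have e2 : ∑ i, (Real.exp (s + κ i) - 1) * ∫ x in A i, entranceResolvent T Y A s κ x ∂μ
      = ∑ i, Real.exp (s + κ i) * ∫ x in A i, entranceResolvent T Y A s κ x ∂μ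
        - ∑ i, ∫ x in A i, entranceResolvent T Y A s κ x ∂μ := by
    rw [← Finset.sum_sub_distrib]
    exact Finset.sum_congr rfl fun i _ => by ring
  rw [e2]
  linear_combination hVY + Real.exp (-s) * h1

end Renewal

/-! ### Summation by parts -/

section Abel

theorem summable_pow_mul_of_le {y : ℕ → ℝ} {C z : ℝ} (hy : ∀ n, |y n| ≤ C) (hz0 : 0 ≤ z)
    (hz1 : z < 1) : Summable fun n => z ^ n * y n := by
  refine Summable.of_norm_bounded ((summable_geometric_of_lt_one hz0 hz1).mul_right C) fun n => ?_
  rw [Real.norm_eq_abs, abs_mul, abs_of_nonneg (pow_nonneg hz0 n)]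
  exact mul_le_mul_of_nonneg_left (hy n) (pow_nonneg hz0 n)

/-- Summation by parts for power series. -/
theorem hasSum_pow_mul_sum_range {y : ℕ → ℝ} {C z : ℝ} (hy : ∀ n, |y n| ≤ C) (hz0 : 0 ≤ z)
    (hz1 : z < 1) :
    HasSum (fun n => (1 - z) * (z ^ n * ∑ k ∈ Finset.range (n + 1), y k)) (∑' n, z ^ n * y n) := by
  have hs := (summable_pow_mul_of_le hy hz0 hz1).norm
  have hg := (summable_geometric_of_lt_one hz0 hz1).norm
  -- The Cauchy product with the geometric series produces the partial sums; the factor 1 - z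
  -- cancels the geometric sum.
  have h := (hasSum_sum_range_mul_of_summable_norm hs hg).mul_left (1 - z)
  rw [tsum_geometric_of_lt_one hz0 hz1, mul_comm (1 - z), mul_assoc,
    inv_mul_cancel₀ (sub_pos.2 hz1).ne', mul_one] at h
  refine h.congr_fun fun n => ?_
  congr 1
  rw [Finset.mul_sum]
  refine Finset.sum_congr rfl fun k hk => ?_
  rw [Finset.mem_range] at hk
  rw [mul_right_comm, ← pow_add, Nat.add_sub_cancel' (by omega)]

theorem abs_mul_pow_mul_sub_le {z ρ ε b y : ℝ} {n : ℕ} (hz0 : 0 ≤ z) (hz1 : z ≤ 1)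
    (h : |b - ρ * y| ≤ ε * y) :
    |(1 - z) * (z ^ n * b) - ρ * ((1 - z) * (z ^ n * y))| ≤ ε * ((1 - z) * (z ^ n * y)) := by
  have hc : 0 ≤ (1 - z) * z ^ n := mul_nonneg (sub_nonneg.2 hz1) (pow_nonneg hz0 n)
  calc |(1 - z) * (z ^ n * b) - ρ * ((1 - z) * (z ^ n * y))|
      = (1 - z) * z ^ n * |b - ρ * y| := by
        rw [show (1 - z) * (z ^ n * b) - ρ * ((1 - z) * (z ^ n * y))
          = (1 - z) * z ^ n * (b - ρ * y) by ring, abs_mul, abs_of_nonneg hc]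
    _ ≤ (1 - z) * z ^ n * (ε * y) := mul_le_mul_of_nonneg_left h hc
    _ = _ := by ring

end Abel

/-! ### Entrance densities and the precompactness hypothesis -/

section Entrances

variable {X : Type*} [MeasurableSpace X] {μ : Measure X} {T : X → X} {Y : Set X} {d : ℕ}
  {A : Fin d → Set X} {s : ℝ} {κ : Fin d → ℝ}

theorem setIntegral_eq_tsum_firstVisit (hT : MeasurePreserving T μ μ) (hY : MeasurableSet Y)
    (hrec : ∀ᵐ x ∂μ, ∃ᶠ n in atTop, T^[n] x ∈ Y) {B : Set X} (hB : MeasurableSet B) {f : X → ℝ}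
    (hf : Integrable f μ) : ∫ x in B, f x ∂μ = ∑' n, ∫ x in firstVisit T Y n ∩ B, f x ∂μ := by
  rw [← integral_iUnion (fun n => measurableSet_firstVisit_inter hT.measurable hY hB n)
    (fun m n hmn => (disjoint_firstVisit T Y hmn).mono inter_subset_left inter_subset_left)
    hf.integrableOn]
  refine setIntegral_congr_set ?_
  filter_upwards [ae_mem_iUnion_firstVisit hrec] with x hx
  rw [← iUnion_inter]
  exact propext ⟨fun hxB => ⟨hx, hxB⟩, fun hxB => hxB.2⟩

theorem setIntegral_entranceWeight (hT : MeasurePreserving T μ μ) (h : IsRayDecomposition μ T Y A)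
    (hrec : ∀ᵐ x ∂μ, ∃ᶠ n in atTop, T^[n] x ∈ Y) (hs : 0 < s) (hκ : ∀ i, 0 ≤ κ i) (i : Fin d) :
    ∫ x in A i, entranceWeight T Y A s κ x ∂μ
      = ∑' n, Real.exp (-(s + κ i)) ^ n * μ.real (firstVisit T Y n ∩ A i) := by
  rw [setIntegral_eq_tsum_firstVisit hT h.measurableSet_junction hrec (h.measurableSet_ray i)
    (integrable_entranceWeight hT h hrec hs hκ)]
  refine tsum_congr fun n => ?_
  rw [setIntegral_congr_fun (measurableSet_firstVisit_inter hT.measurable h.measurableSet_junction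
    (h.measurableSet_ray i) n) fun x hx => entranceWeight_of_mem h hx, setIntegral_const,
    smul_eq_mul, mul_comm]

theorem setIntegral_entranceResolvent (hT : MeasurePreserving T μ μ)
    (h : IsRayDecomposition μ T Y A) (hrec : ∀ᵐ x ∂μ, ∃ᶠ n in atTop, T^[n] x ∈ Y) (hs : 0 < s)
    (hκ : ∀ i, 0 ≤ κ i) (i : Fin d) :
    ∫ x in A i, entranceResolvent T Y A s κ x ∂μ = ∑' n, Real.exp (-(s + κ i)) ^ n
      * ∫ x in firstVisit T Y n ∩ A i, resolvent T A s κ (T^[n] x) ∂μ := by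
  rw [setIntegral_eq_tsum_firstVisit hT h.measurableSet_junction hrec (h.measurableSet_ray i)
    (integrable_entranceResolvent hT h hrec hs hκ)]
  refine tsum_congr fun n => ?_
  rw [setIntegral_congr_fun (measurableSet_firstVisit_inter hT.measurable h.measurableSet_junction
    (h.measurableSet_ray i) n) fun x hx => entranceResolvent_of_mem h hx, integral_const_mul]

/-- A point that visits `Y` before time n has its first visit at exactly one time k < n, so the
union may be rewritten with the disjoint sets Y_k. -/
theorem wanderingRateFrom_eq_sum (hT : MeasurePreserving T μ μ) (hY : MeasurableSet Y)
    (hfin : μ Y < ∞) {B : Set X} (hB : MeasurableSet B) (n : ℕ) :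
    wanderingRateFrom μ T Y B n = ∑ k ∈ Finset.range n, μ.real (firstVisit T Y k ∩ B) := by
  rw [wanderingRateFrom, ← measureReal_biUnion_finset
    (h := fun k _ => measure_firstVisit_inter_ne_top hT hY hfin B k)]
  · congr 1
    ext x
    simp only [mem_iUnion, Finset.mem_range, exists_prop]
    constructor
    · rintro ⟨k, hk, hx⟩
      obtain ⟨m, hm⟩ := exists_mem_firstVisit ⟨k, hx.1⟩
      exact ⟨m, (not_lt.1 fun hlt => hm.2 k hlt hx.1).trans_lt hk, hm, hx.2⟩
    · rintro ⟨k, hk, hx⟩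
      exact ⟨k, hk, hx.1.1, hx.2⟩
  · exact fun m _ n _ hmn => (disjoint_firstVisit T Y hmn).mono inter_subset_left inter_subset_left
  · exact fun k _ => measurableSet_firstVisit_inter hT.measurable hY hB k

theorem wanderingRateFrom_univ (n : ℕ) :
    wanderingRateFrom μ T Y univ n = wanderingRate μ T Y n := by
  simp [wanderingRateFrom, wanderingRate]

theorem integral_iterate_dualOperator_mul [SigmaFinite μ] (hT : MeasurePreserving T μ μ)
    (f : Lp ℝ 1 μ) (k : ℕ) {g : X → ℝ} (hg : Measurable g) {C : ℝ} (hC : ∀ x, |g x| ≤ C) :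
    ∫ x, (dualOperator μ T)^[k] f x * g x ∂μ = ∫ x, f x * g (T^[k] x) ∂μ := by
  induction k generalizing g with
  | zero => rfl
  | succ k ih =>
    rw [Function.iterate_succ_apply', integral_dualOperator_mul hT _ hg hC,
      ih (g := fun x => g (T x)) (hg.comp hT.measurable) fun x => hC (T x)]
    simp only [Function.iterate_succ_apply']

/-- Integration against the elements of `normalizedEntrances`. -/
theorem exists_mem_normalizedEntrances [SigmaFinite μ] (hT : MeasurePreserving T μ μ)
    (h : IsRayDecomposition μ T Y A) (i : Fin d) (n : ℕ) :
    ∃ u ∈ normalizedEntrances hT h i, ∀ g : X → ℝ, Measurable g → (∃ C, ∀ x, |g x| ≤ C) →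
      wanderingRateFrom μ T Y (A i) (n + 1) * ∫ x, u x * g x ∂μ
        = ∑ k ∈ Finset.range (n + 1), ∫ x in firstVisit T Y k ∩ A i, g (T^[k] x) ∂μ := by
  refine ⟨_, ⟨n + 1, by omega, rfl⟩, fun g hg ⟨C, hC⟩ => ?_⟩
  have hY := h.measurableSet_junction
  have hF := fun k => measurableSet_firstVisit_inter hT.measurable hY (h.measurableSet_ray i) k
  set W := wanderingRateFrom μ T Y (A i) (n + 1) with hW
  set v : ℕ → Lp ℝ 1 μ := fun k => (dualOperator μ T)^[k] (firstVisitIndicator hT h i k)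
  have hpair : ∀ k, ∫ x, v k x * g x ∂μ = ∫ x in firstVisit T Y k ∩ A i, g (T^[k] x) ∂μ := by
    intro k
    rw [integral_iterate_dualOperator_mul hT _ k hg hC, ← integral_indicator (hF k)]
    refine integral_congr_ae ?_
    filter_upwards [indicatorConstLp_coeFn (p := 1) (hs := hF k) (c := (1 : ℝ))
      (hμs := measure_firstVisit_inter_ne_top hT hY h.junction_lt_top (A i) k)] with x hx
    rw [firstVisitIndicator, hx]
    by_cases hxF : x ∈ firstVisit T Y k ∩ A i <;> simp [hxF]
  have h1 : ∫ x, (W⁻¹ • ∑ k ∈ Finset.range (n + 1), v k : Lp ℝ 1 μ) x * g x ∂μ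
      = W⁻¹ * ∑ k ∈ Finset.range (n + 1), ∫ x, v k x * g x ∂μ := by
    have hi : ∀ k ∈ Finset.range (n + 1), Integrable (fun x => v k x * g x) μ := fun k _ =>
      integrable_mul_of_abs_le (L1.integrable_coeFn (v k)) hg hC
    rw [← integral_finsetSum _ hi, ← integral_const_mul]
    refine integral_congr_ae ?_
    filter_upwards [Lp.coeFn_smul W⁻¹ (∑ k ∈ Finset.range (n + 1), v k),
      Lp.coeFn_finsetSum (Finset.range (n + 1)) v] with x hx1 hx2
    rw [hx1, Pi.smul_apply, hx2, Finset.sum_apply, smul_eq_mul, mul_assoc, Finset.sum_mul]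
  rw [h1]
  simp only [hpair]
  -- If the normalization is 0, each Y_k ∩ A i with k ≤ n is null, and both sides vanish.
  by_cases hW0 : W = 0
  · rw [hW0, zero_mul]
    refine (Finset.sum_eq_zero fun k hk => ?_).symm
    rw [wanderingRateFrom_eq_sum hT hY h.junction_lt_top (h.measurableSet_ray i)] at hW
    have h0 := (Finset.sum_eq_zero_iff_of_nonneg fun _ _ => measureReal_nonneg).1
      (hW.symm.trans hW0) k hk
    rw [measureReal_eq_zero_iff (measure_firstVisit_inter_ne_top hT hY h.junction_lt_top _ k)] at h0
    rw [Measure.restrict_eq_zero.2 h0, integral_zero_measure]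
  · rw [← mul_assoc, mul_inv_cancel₀ hW0, one_mul]

/-- If the resolvent is almost constant on the normalized entrance densities, then so is its mean
at the entrance from `A i`. -/
theorem abs_setIntegral_entranceResolvent_sub_le [SigmaFinite μ] (hT : MeasurePreserving T μ μ)
    (h : IsRayDecomposition μ T Y A) (hrec : ∀ᵐ x ∂μ, ∃ᶠ n in atTop, T^[n] x ∈ Y) (hs : 0 < s)
    (hκ : ∀ i, 0 ≤ κ i) (i : Fin d) {ε ρ : ℝ}
    (hε : ∀ u ∈ normalizedEntrances hT h i,
      |∫ x, u x * ((1 - Real.exp (-s)) * resolvent T A s κ x) ∂μ - (∫ x, u x ∂μ) * ρ| ≤ ε) :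
    |(1 - Real.exp (-s)) * ∫ x in A i, entranceResolvent T Y A s κ x ∂μ
        - ρ * ∫ x in A i, entranceWeight T Y A s κ x ∂μ|
      ≤ ε * ∫ x in A i, entranceWeight T Y A s κ x ∂μ := by
  have hY := h.measurableSet_junction
  set R : X → ℝ := fun x => (1 - Real.exp (-s)) * resolvent T A s κ x
  have hRm : Measurable R := measurable_const.mul (measurable_resolvent hT.measurable h s κ)
  have hR1 : ∀ x, |R x| ≤ 1 := abs_one_sub_exp_mul_resolvent_le hs hκ
  set z := Real.exp (-(s + κ i)) with hz
  have hz0 : 0 ≤ z := (Real.exp_pos _).le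
  have hz1 : z < 1 := by
    rw [hz, Real.exp_lt_one_iff]; linarith [hκ i]
  let y : ℕ → ℝ := fun n => μ.real (firstVisit T Y n ∩ A i)
  let b : ℕ → ℝ := fun n => ∫ x in firstVisit T Y n ∩ A i, R (T^[n] x) ∂μ
  have hy : ∀ n, |y n| ≤ μ.real Y := fun n => by
    rw [abs_of_nonneg measureReal_nonneg]
    exact measureReal_firstVisit_inter_le hT hY h.junction_lt_top _ n
  have hb : ∀ n, |b n| ≤ μ.real Y := fun n => by
    refine le_trans ?_ (measureReal_firstVisit_inter_le hT hY h.junction_lt_top (A i) n)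
    have := norm_setIntegral_le_of_norm_le_const (μ := μ) (f := fun x => R (T^[n] x)) (C := 1)
      (measure_firstVisit_inter_ne_top hT hY h.junction_lt_top (A i) n).lt_top
      fun x _ => hR1 (T^[n] x)
    simpa using this
  have h1 := hasSum_pow_mul_sum_range hy hz0 hz1
  have h2 := hasSum_pow_mul_sum_range hb hz0 hz1
  have e1 : ∫ x in A i, entranceWeight T Y A s κ x ∂μ = ∑' n, z ^ n * y n :=
    setIntegral_entranceWeight hT h hrec hs hκ i
  have e2 : (1 - Real.exp (-s)) * ∫ x in A i, entranceResolvent T Y A s κ x ∂μ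
      = ∑' n, z ^ n * b n := by
    rw [setIntegral_entranceResolvent hT h hrec hs hκ i, ← tsum_mul_left]
    refine tsum_congr fun n => ?_
    simp only [b, R]
    rw [integral_const_mul]; ring
  rw [e1, e2]
  -- The hypothesis concerns normalized partial sums only. Multiplied by w_i(n+1) it compares the
  -- partial sums of `b` and `y`; summing with the positive weights (1 - z) zⁿ transfers the
  -- comparison to the power series.
  have hterm : ∀ n, |∑ k ∈ Finset.range (n + 1), b k - ρ * ∑ k ∈ Finset.range (n + 1), y k|
      ≤ ε * ∑ k ∈ Finset.range (n + 1), y k := by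
    intro n
    obtain ⟨u, hu, hug⟩ := exists_mem_normalizedEntrances hT h i n
    have hw := wanderingRateFrom_eq_sum hT hY h.junction_lt_top (h.measurableSet_ray i) (n + 1)
    have g1 := hug R hRm ⟨1, hR1⟩
    have g2 := hug (fun _ => 1) measurable_const ⟨1, by simp⟩
    simp only [mul_one, setIntegral_const, smul_eq_mul] at g2
    rw [hw] at g1 g2
    have hnn : 0 ≤ ∑ k ∈ Finset.range (n + 1), y k :=
      Finset.sum_nonneg fun _ _ => measureReal_nonneg
    have := mul_le_mul_of_nonneg_left (hε u hu) hnn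
    rw [← abs_of_nonneg hnn, ← abs_mul, abs_of_nonneg hnn, mul_sub, ← mul_assoc] at this
    rw [g1, g2] at this
    rw [mul_comm ρ, mul_comm ε]
    exact this
  have h3 := h2.sub (h1.mul_left ρ)
  have h4 := h1.mul_left ε
  have hle : ∀ n, |(1 - z) * (z ^ n * ∑ k ∈ Finset.range (n + 1), b k)
      - ρ * ((1 - z) * (z ^ n * ∑ k ∈ Finset.range (n + 1), y k))|
      ≤ ε * ((1 - z) * (z ^ n * ∑ k ∈ Finset.range (n + 1), y k)) := by
    intro n
    exact abs_mul_pow_mul_sub_le hz0 hz1.le (hterm n)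
  rw [abs_le]
  constructor
  · have := hasSum_le (fun n => (abs_le.1 (hle n)).1) h4.neg h3
    exact this
  · exact hasSum_le (fun n => (abs_le.1 (hle n)).2) h3 h4

end Entrances

/-! ### An Abelian theorem for Laplace sums -/

section Abelian

/-- In integral form the series can be rescaled in time, after which dominated convergence applies.
-/
theorem tsum_eq_integral_floor {f : ℕ → ℝ} (hf0 : ∀ n, 0 ≤ f n) (hf : Summable f) :
    ∑' n, f n = ∫ t in Ioi (0 : ℝ), f ⌊t⌋₊ := by
  have hU : ⋃ n : ℕ, Ico (n : ℝ) (n + 1) = Ici 0 := by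
    ext t
    simp only [mem_iUnion, mem_Ico, mem_Ici]
    exact ⟨fun ⟨n, h1, _⟩ => n.cast_nonneg.trans h1,
      fun ht => ⟨⌊t⌋₊, Nat.floor_le ht, Nat.lt_floor_add_one t⟩⟩
  have hfl : ∀ n : ℕ, ∀ t ∈ Ico (n : ℝ) (n + 1), ⌊t⌋₊ = n := fun n t ht =>
    Nat.floor_eq_on_Ico n t ht
  have hv : ∀ n : ℕ, volume.real (Ico (n : ℝ) (n + 1)) = 1 := fun n => by simp
  have hi : ∀ n : ℕ, ∫ t in Ico (n : ℝ) (n + 1), f ⌊t⌋₊ = f n := fun n => by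
    rw [setIntegral_congr_fun (g := fun _ => f n) measurableSet_Ico fun t ht => by
      simp only [hfl n t ht], setIntegral_const, hv]
    simp
  have hion : ∀ n : ℕ, IntegrableOn (fun t : ℝ => f ⌊t⌋₊) (Ico (n : ℝ) (n + 1)) := fun n =>
    (integrableOn_congr_fun (g := fun _ => f n) (fun t ht => by
      simp only [hfl n t ht]) measurableSet_Ico).2 (integrableOn_const (by simp))
  have hint : IntegrableOn (fun t : ℝ => f ⌊t⌋₊) (⋃ n : ℕ, Ico (n : ℝ) (n + 1)) := by
    refine integrableOn_iUnion_of_summable_integral_norm hion ?_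
    simpa only [Real.norm_of_nonneg (hf0 _), hi] using hf
  rw [← integral_Ici_eq_integral_Ioi, ← hU, integral_iUnion (fun n => measurableSet_Ico) ?_ hint]
  · simp only [hi]
  · intro m n hmn
    exact Set.disjoint_left.2 fun t h1 h2 => hmn ((hfl m t h1).symm.trans (hfl n t h2))

/-- The difference quotient at 0 of y ↦ exp(x y), taken along y = 1 / N. -/
theorem tendsto_mul_exp_sub_one (x : ℝ) :
    Tendsto (fun N : ℕ => (N : ℝ) * (Real.exp (x / N) - 1)) atTop (𝓝 x) := by
  have hε : Tendsto (fun N : ℕ => (N : ℝ)⁻¹) atTop (𝓝[≠] 0) := by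
    rw [tendsto_nhdsWithin_iff]
    refine ⟨tendsto_inv_atTop_nhds_zero_nat, ?_⟩
    filter_upwards [eventually_gt_atTop 0] with N hN
    simpa using hN.ne'
  have hd : HasDerivAt (fun y : ℝ => Real.exp (x * y)) x 0 := by
    simpa using ((hasDerivAt_id (0 : ℝ)).const_mul x).exp
  refine (hd.tendsto_slope_zero.comp hε).congr fun N => ?_
  simp [div_eq_mul_inv]

theorem tendsto_mul_one_sub_exp (x : ℝ) :
    Tendsto (fun N : ℕ => (N : ℝ) * (1 - Real.exp (-(x / N)))) atTop (𝓝 x) := by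
  have h := (tendsto_mul_exp_sub_one (-x)).neg
  rw [neg_neg] at h
  refine h.congr fun N => ?_
  rw [neg_div]; ring

theorem tendsto_exp_div (x : ℝ) : Tendsto (fun N : ℕ => Real.exp (x / N)) atTop (𝓝 1) := by
  have := (tendsto_const_div_atTop_nhds_zero_nat x).rexp
  simpa using this

theorem le_nat_mul_of_subadditive {w : ℕ → ℝ} (hsub : ∀ m n, w (m + n) ≤ w m + w n)
    (hw0 : w 0 = 0) (m n : ℕ) : w (m * n) ≤ m * w n := by
  induction m with
  | zero => simp [hw0]
  | succ m ih =>
    rw [Nat.succ_mul]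
    push_cast
    linarith [hsub (m * n) n]

/-- A direct Abelian theorem for regularly varying sequences with a subadditive majorant. -/
theorem tendsto_abelian {w v : ℕ → ℝ} (hsub : ∀ m n, w (m + n) ≤ w m + w n) (hmono : Monotone w)
    (hw0 : w 0 = 0) (hv0 : ∀ n, 0 ≤ v n) (hvw : ∀ n, v n ≤ w (n + 1)) {b γ : ℝ} (hγ : 0 ≤ γ)
    (hlim : ∀ t : ℝ, 0 < t → Tendsto (fun N : ℕ => v ⌊t * N⌋₊ / w N) atTop (𝓝 (b * t ^ γ)))
    {x : ℝ} (hx : 0 < x) :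
    Tendsto (fun N : ℕ => (1 - Real.exp (-(x / N)))
        * (∑' n, Real.exp (-(x / N)) ^ n * v n) / w N) atTop
      (𝓝 (b * Real.Gamma (γ + 1) * x ^ (-γ))) := by
  have hwnn : ∀ n, 0 ≤ w n := fun n => hw0 ▸ hmono n.zero_le
  let G : ℕ → ℝ → ℝ := fun N t =>
    Real.exp (-(x / N)) ^ ⌊t * N⌋₊ * (v ⌊t * N⌋₊ / w N)
  have hGm : ∀ N, Measurable (G N) := fun N => by
    have : Measurable fun t : ℝ => ⌊t * N⌋₊ := Nat.measurable_floor.comp (measurable_id.mul_const _)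
    exact (measurable_from_nat (f := fun n => Real.exp (-(x / N)) ^ n * (v n / w N))).comp this
  -- The integer part costs a factor exp(x/N) ≤ exp x. Subadditivity bounds the quotient by t + 1
  -- uniformly in N, and half of the exponential decay absorbs this factor.
  have hbound : ∀ N : ℕ, 1 ≤ N → ∀ t : ℝ, 0 < t → ‖G N t‖
      ≤ Real.exp x * ((2 / x + 1) * Real.exp (-(x / 2) * t)) := by
    intro N hN t ht
    have hN' : (1 : ℝ) ≤ N := by exact_mod_cast hN
    have hN0 : (0 : ℝ) < N := by linarith
    have h1 : Real.exp (-(x / N)) ^ ⌊t * N⌋₊ ≤ Real.exp x * Real.exp (-(x * t)) := by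
      rw [← Real.exp_nat_mul, ← Real.exp_add, Real.exp_le_exp]
      have h2 := Nat.lt_floor_add_one (t * N)
      have h3 : (t * N - 1) * (x / N) ≤ ⌊t * N⌋₊ * (x / N) :=
        mul_le_mul_of_nonneg_right (by linarith) (by positivity)
      have h4 : (t * N - 1) * (x / N) = x * t - x / N := by field_simp
      have h5 : x / N ≤ x := div_le_self hx.le hN'
      linarith
    have h2 : v ⌊t * N⌋₊ / w N ≤ t + 1 := by
      refine div_le_of_le_mul₀ (hwnn N) (by positivity) ?_
      have h3 : ⌊t * N⌋₊ + 1 ≤ (⌊t⌋₊ + 1) * N := by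
        rw [Nat.succ_le_iff, Nat.floor_lt (by positivity)]
        push_cast
        exact mul_lt_mul_of_pos_right (Nat.lt_floor_add_one t) hN0
      calc v ⌊t * N⌋₊ ≤ w (⌊t * N⌋₊ + 1) := hvw _
        _ ≤ w ((⌊t⌋₊ + 1) * N) := hmono h3
        _ ≤ ((⌊t⌋₊ + 1 : ℕ) : ℝ) * w N := le_nat_mul_of_subadditive hsub hw0 _ _
        _ ≤ (t + 1) * w N := by
          refine mul_le_mul_of_nonneg_right ?_ (hwnn N)
          push_cast
          linarith [Nat.floor_le ht.le]
    have h0 : 0 ≤ v ⌊t * N⌋₊ / w N := div_nonneg (hv0 _) (hwnn N)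
    have h3 : t + 1 ≤ (2 / x + 1) * Real.exp (x / 2 * t) := by
      have h4 := Real.add_one_le_exp (x / 2 * t)
      have h5 : 0 < x / 2 * t := by positivity
      have h6 : t = 2 / x * (x / 2 * t) := by field_simp
      have h7 : 2 / x * (x / 2 * t) ≤ 2 / x * Real.exp (x / 2 * t) :=
        mul_le_mul_of_nonneg_left (by linarith) (by positivity)
      linarith
    simp only [G]
    rw [Real.norm_of_nonneg (mul_nonneg (by positivity) h0)]
    calc _ ≤ Real.exp x * Real.exp (-(x * t)) * (t + 1) :=
          mul_le_mul h1 h2 h0 (by positivity)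
      _ ≤ Real.exp x * Real.exp (-(x * t)) * ((2 / x + 1) * Real.exp (x / 2 * t)) :=
          mul_le_mul_of_nonneg_left h3 (by positivity)
      _ = _ := by
        have : -(x / 2) * t = -(x * t) + x / 2 * t := by ring
        rw [this, Real.exp_add]; ring
  have hG : Tendsto (fun N : ℕ => ∫ t in Ioi (0 : ℝ), G N t) atTop
      (𝓝 (∫ t in Ioi (0 : ℝ), Real.exp (-(x * t)) * (b * t ^ γ))) := by
    refine tendsto_integral_filter_of_dominated_convergence
      (fun t => Real.exp x * ((2 / x + 1) * Real.exp (-(x / 2) * t)))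
      (Eventually.of_forall fun N => (hGm N).aestronglyMeasurable) ?_
      (((exp_neg_integrableOn_Ioi 0 (half_pos hx)).const_mul _).const_mul (Real.exp x)) ?_
    · filter_upwards [eventually_ge_atTop 1] with N hN
      exact ae_restrict_of_forall_mem measurableSet_Ioi fun t ht => hbound N hN t ht
    · refine ae_restrict_of_forall_mem measurableSet_Ioi fun t ht => ?_
      refine Tendsto.mul ?_ (hlim t ht)
      have h1 := (tendsto_nat_floor_mul_div_atTop (le_of_lt ht)).comp
        (tendsto_natCast_atTop_atTop (R := ℝ))
      have h2 := (h1.const_mul x).neg.rexp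
      refine h2.congr fun N => ?_
      simp only [Function.comp]
      rw [← Real.exp_nat_mul]
      congr 1; ring
  -- The limit integral is a Gamma integral of order γ + 1; the prefactor x is the limit of N (1 -
  -- exp(-x/N)).
  have hval : x * ∫ t in Ioi (0 : ℝ), Real.exp (-(x * t)) * (b * t ^ γ)
      = b * Real.Gamma (γ + 1) * x ^ (-γ) := by
    have h1 := Real.integral_rpow_mul_exp_neg_mul_Ioi (a := γ + 1) (r := x) (by linarith) hx
    have h2 : ∫ t in Ioi (0 : ℝ), Real.exp (-(x * t)) * (b * t ^ γ)
        = b * ∫ t in Ioi (0 : ℝ), t ^ (γ + 1 - 1) * Real.exp (-(x * t)) := by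
      rw [← integral_const_mul]
      congr 1; funext t
      rw [add_sub_cancel_right]; ring
    rw [h2, h1, one_div, Real.inv_rpow hx.le, Real.rpow_add_one hx.ne', Real.rpow_neg hx.le]
    field_simp
  have h := (tendsto_mul_one_sub_exp x).mul hG
  rw [hval] at h
  refine h.congr' ?_
  filter_upwards [eventually_ge_atTop 1] with N hN
  have hN0 : (0 : ℝ) < N := by exact_mod_cast hN
  have hz1 : Real.exp (-(x / N)) < 1 := by
    rw [Real.exp_lt_one_iff]; have : 0 < x / N := by positivity
    linarith
  have hz0 := (Real.exp_pos (-(x / N))).le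
  let f : ℕ → ℝ := fun n => Real.exp (-(x / N)) ^ n * (v n / w N)
  have hf0 : ∀ n, 0 ≤ f n := fun n =>
    mul_nonneg (pow_nonneg hz0 n) (div_nonneg (hv0 n) (hwnn N))
  have hf : Summable f := by
    have hs := (summable_pow_mul_geometric_of_norm_lt_one (R := ℝ) 1
      (r := Real.exp (-(x / N))) (by rwa [Real.norm_of_nonneg hz0])).add
      (summable_geometric_of_lt_one hz0 hz1)
    -- Subadditivity also gives v(n) ≤ (n + 1) w(1), which makes the series converge.
    refine Summable.of_nonneg_of_le hf0 (fun n => ?_) (hs.mul_right (w 1 / w N))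
    have h1 : v n ≤ (n + 1) * w 1 := by
      have := le_nat_mul_of_subadditive hsub hw0 (n + 1) 1
      rw [mul_one] at this
      push_cast at this
      exact (hvw n).trans this
    calc f n ≤ Real.exp (-(x / N)) ^ n * ((n + 1) * w 1 / w N) :=
          mul_le_mul_of_nonneg_left (div_le_div_of_nonneg_right h1 (hwnn N)) (pow_nonneg hz0 n)
      _ = _ := by ring
  have e1 : ∫ t in Ioi (0 : ℝ), G N t = (N : ℝ)⁻¹ * ∑' n, f n := by
    rw [tsum_eq_integral_floor hf0 hf]
    have := integral_comp_mul_right_Ioi (fun t : ℝ => f ⌊t⌋₊) 0 hN0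
    rw [zero_mul] at this
    exact this
  have e2 : ∑' n, f n = (∑' n, Real.exp (-(x / N)) ^ n * v n) / w N := by
    rw [← tsum_div_const]
    exact tsum_congr fun n => (mul_div_assoc _ _ _).symm
  rw [e1, e2]
  field_simp

end Abelian

/-! ### Growth of the wandering rates -/

section WanderingRate

variable {X : Type*} [MeasurableSpace X] {μ : Measure X} {T : X → X} {Y : Set X} {d : ℕ}
  {A : Fin d → Set X}

theorem wanderingRate_eq_sum (hT : MeasurePreserving T μ μ) (hY : MeasurableSet Y)
    (hfin : μ Y < ∞) (n : ℕ) :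
    wanderingRate μ T Y n = ∑ k ∈ Finset.range n, μ.real (firstVisit T Y k) := by
  rw [← wanderingRateFrom_univ, wanderingRateFrom_eq_sum hT hY hfin MeasurableSet.univ]
  simp

theorem monotone_wanderingRate (hT : MeasurePreserving T μ μ) (hY : MeasurableSet Y)
    (hfin : μ Y < ∞) : Monotone (wanderingRate μ T Y) := by
  refine monotone_nat_of_le_succ fun n => ?_
  rw [wanderingRate_eq_sum hT hY hfin, wanderingRate_eq_sum hT hY hfin, Finset.sum_range_succ]
  exact le_add_of_nonneg_right measureReal_nonneg

/-- The mass balance for the whole space: going from Y_n to Y_{n+1} loses the mass of the points of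
`Y` that step into Y_n. -/
theorem antitone_measureReal_firstVisit (hT : MeasurePreserving T μ μ) (hY : MeasurableSet Y)
    (hfin : μ Y < ∞) : Antitone fun n => μ.real (firstVisit T Y n) := by
  refine antitone_nat_of_succ_le fun n => ?_
  have := measureReal_firstVisit_eq_add hT hY hfin MeasurableSet.univ (n := n) (by simp)
  simp only [inter_univ] at this
  rw [this]
  exact le_add_of_nonneg_right measureReal_nonneg

/-- The wandering rate is a sum of decreasing terms. Its subadditivity supplies the dominating
function in `tendsto_abelian`. -/
theorem wanderingRate_add_le (hT : MeasurePreserving T μ μ) (hY : MeasurableSet Y)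
    (hfin : μ Y < ∞) (m n : ℕ) :
    wanderingRate μ T Y (m + n) ≤ wanderingRate μ T Y m + wanderingRate μ T Y n := by
  simp only [wanderingRate_eq_sum hT hY hfin]
  rw [Finset.sum_range_add]
  exact add_le_add_right (Finset.sum_le_sum fun k _ =>
    antitone_measureReal_firstVisit hT hY hfin (Nat.le_add_left k m)) _

/-- A finite limit would make ∑ μ(Y_n) finite, but the Y_n cover almost all of a space of infinite
measure. -/
theorem tendsto_wanderingRate (hT : MeasurePreserving T μ μ) (hY : MeasurableSet Y)
    (hfin : μ Y < ∞) (hrec : ∀ᵐ x ∂μ, ∃ᶠ n in atTop, T^[n] x ∈ Y) (htop : μ univ = ∞) :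
    Tendsto (wanderingRate μ T Y) atTop atTop := by
  refine (tendsto_atTop_of_monotone (monotone_wanderingRate hT hY hfin)).resolve_right ?_
  rintro ⟨l, hl⟩
  have hne : ∀ n, μ (firstVisit T Y n) ≠ ∞ := fun n => by
    simpa using measure_firstVisit_inter_ne_top hT hY hfin univ n
  have hU : ∑' n, μ (firstVisit T Y n) = ∞ := by
    rw [← measure_iUnion (disjoint_firstVisit T Y) (measurableSet_firstVisit hT.measurable hY),
      ← htop]
    exact measure_congr (eventuallyEq_univ.2 (ae_mem_iUnion_firstVisit hrec))
  have hs : Summable fun n => μ.real (firstVisit T Y n) := by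
    refine summable_of_sum_range_le (c := l) (fun _ => measureReal_nonneg) fun n => ?_
    rw [← wanderingRate_eq_sum hT hY hfin]
    exact (monotone_wanderingRate hT hY hfin).ge_of_tendsto hl n
  have := hs.tsum_ofReal_ne_top
  simp only [ofReal_measureReal (hne _)] at this
  exact this hU

theorem wanderingRateFrom_le (hT : MeasurePreserving T μ μ) (hY : MeasurableSet Y)
    (hfin : μ Y < ∞) {B : Set X} (hB : MeasurableSet B) (n : ℕ) :
    wanderingRateFrom μ T Y B n ≤ wanderingRate μ T Y n := by
  rw [wanderingRate_eq_sum hT hY hfin, wanderingRateFrom_eq_sum hT hY hfin hB]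
  refine Finset.sum_le_sum fun k _ => measureReal_mono inter_subset_left ?_
  simpa using measure_firstVisit_inter_ne_top hT hY hfin univ k

/-- The quotient is a product of three: w_B / w at ⌊tN⌋ + 1, with limit b; w(n + 1) / w(n), with
limit 1 by subadditivity and divergence; and w(⌊tN⌋) / w(N), handled by regular variation. -/
theorem tendsto_wanderingRateFrom_floor (hT : MeasurePreserving T μ μ) (hY : MeasurableSet Y)
    (hfin : μ Y < ∞) (hrec : ∀ᵐ x ∂μ, ∃ᶠ n in atTop, T^[n] x ∈ Y) (htop : μ univ = ∞)
    {ρ b : ℝ} (hw : IsRegularlyVaryingSeq (wanderingRate μ T Y) ρ) {B : Set X}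
    (hb : Tendsto (fun n => wanderingRateFrom μ T Y B n / wanderingRate μ T Y n) atTop (𝓝 b))
    {t : ℝ} (ht : 0 < t) :
    Tendsto (fun N : ℕ => wanderingRateFrom μ T Y B (⌊t * N⌋₊ + 1) / wanderingRate μ T Y N) atTop
      (𝓝 (b * t ^ ρ)) := by
  have hwtop := tendsto_wanderingRate hT hY hfin hrec htop
  have hfloor : Tendsto (fun N : ℕ => ⌊t * N⌋₊) atTop atTop :=
    tendsto_nat_floor_atTop.comp (tendsto_natCast_atTop_atTop.const_mul_atTop ht)
  have h1 : Tendsto (fun N : ℕ => wanderingRateFrom μ T Y B (⌊t * N⌋₊ + 1)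
      / wanderingRate μ T Y (⌊t * N⌋₊ + 1)) atTop (𝓝 b) :=
    hb.comp ((tendsto_add_atTop_nat 1).comp hfloor)
  have h2 : Tendsto (fun n : ℕ => wanderingRate μ T Y (n + 1) / wanderingRate μ T Y n) atTop
      (𝓝 1) := by
    have h3 : Tendsto (fun n : ℕ => 1 + wanderingRate μ T Y 1 / wanderingRate μ T Y n) atTop
        (𝓝 1) := by
      simpa using (hwtop.const_div_atTop (wanderingRate μ T Y 1)).const_add 1
    refine tendsto_of_tendsto_of_tendsto_of_le_of_le' tendsto_const_nhds h3 ?_ ?_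
    · filter_upwards [hwtop.eventually_gt_atTop 0] with n hn
      rw [one_le_div hn]
      exact monotone_wanderingRate hT hY hfin n.le_succ
    · filter_upwards [hwtop.eventually_gt_atTop 0] with n hn
      rw [div_le_iff₀ hn, add_mul, div_mul_cancel₀ _ hn.ne', one_mul]
      exact wanderingRate_add_le hT hY hfin n 1
  have h3 : Tendsto (fun N : ℕ => wanderingRate μ T Y ⌊t * N⌋₊ / wanderingRate μ T Y N) atTop
      (𝓝 (t ^ ρ)) := by
    refine ((hw.2.2 t ht).comp tendsto_natCast_atTop_atTop).congr fun N => ?_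
    simp
  have h4 := (h1.mul (h2.comp hfloor)).mul h3
  rw [mul_one] at h4
  refine h4.congr' ?_
  filter_upwards [(hwtop.comp hfloor).eventually_gt_atTop 0,
    (hwtop.comp ((tendsto_add_atTop_nat 1).comp hfloor)).eventually_gt_atTop 0] with N hN1 hN2
  simp only [Function.comp] at hN1 hN2 ⊢
  field_simp

end WanderingRate

/-! ### The limit of the scaled resolvent -/

section ResolventLimit

variable {X : Type*} {T : X → X} {d : ℕ} {A : Fin d → Set X}

/-- The resolvent normalized to values in `[0, 1]`, at rates scaled by `1 / N`. -/
noncomputable def scaledResolvent (T : X → X) (A : Fin d → Set X) (q : ℝ) (κ : Fin d → ℝ) (N : ℕ)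
    (x : X) : ℝ :=
  (1 - Real.exp (-(q / N))) * resolvent T A (q / N) (fun i => κ i / N) x

theorem abs_scaledResolvent_le {q : ℝ} (hq : 0 < q) {κ : Fin d → ℝ} (hκ : ∀ i, 0 ≤ κ i) (N : ℕ)
    (x : X) : |scaledResolvent T A q κ N x| ≤ 1 := by
  rcases N.eq_zero_or_pos with rfl | hN
  -- For N = 0 division by zero gives the rate 0, and the prefactor 1 - exp 0 vanishes.
  · simp [scaledResolvent]
  · exact abs_one_sub_exp_mul_resolvent_le (by positivity) (fun i => by have := hκ i; positivity) x

theorem eventually_abs_scaledResolvent_map_sub_le {q : ℝ} (hq : 0 < q) {κ : Fin d → ℝ}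
    (hκ : ∀ i, 0 ≤ κ i) {ε : ℝ} (hε : 0 < ε) : ∀ᶠ N in atTop, ∀ x,
      |scaledResolvent T A q κ N (T x) - scaledResolvent T A q κ N x| ≤ ε := by
  have h1 : Tendsto (fun N : ℕ => (1 - Real.exp (-q / N))
      + (1 - Real.exp (-(q + ∑ i, κ i) / N))) atTop (𝓝 0) := by
    have := ((tendsto_exp_div (-q)).const_sub 1).add
      ((tendsto_exp_div (-(q + ∑ i, κ i))).const_sub 1)
    simpa using this
  filter_upwards [h1.eventually (gt_mem_nhds hε), eventually_gt_atTop 0] with N hN hN0 x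
  have hN0' : (0 : ℝ) < N := by exact_mod_cast hN0
  have := abs_resolvent_map_sub_le (T := T) (A := A) (s := q / N) (κ := fun i => κ i / N)
    (by positivity) (fun i => by have := hκ i; positivity) x
  rw [← Finset.sum_div, ← add_div, ← neg_div, ← neg_div] at this
  refine le_trans ?_ hN.le
  simpa only [scaledResolvent, neg_div] using this

variable [MeasurableSpace X] {μ : Measure X} {Y : Set X}

theorem measurable_scaledResolvent (hT : Measurable T) (h : IsRayDecomposition μ T Y A) (q : ℝ)
    (κ : Fin d → ℝ) (N : ℕ) : Measurable (scaledResolvent T A q κ N) :=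
  measurable_const.mul (measurable_resolvent hT h _ _)

/-- Summation by parts replaces the measures of Y_n ∩ A i, about which nothing is assumed
individually, by the partial sums w_i(n + 1), to which the Abelian theorem applies. -/
theorem tendsto_setIntegral_entranceWeight (hT : MeasurePreserving T μ μ)
    (h : IsRayDecomposition μ T Y A) (hrec : ∀ᵐ x ∂μ, ∃ᶠ n in atTop, T^[n] x ∈ Y)
    (htop : μ univ = ∞) {α : ℝ} (hα : α ≤ 1)
    (hw : IsRegularlyVaryingSeq (wanderingRate μ T Y) (1 - α)) {b : ℝ} {i : Fin d}
    (hb : Tendsto (fun n => wanderingRateFrom μ T Y (A i) n / wanderingRate μ T Y n) atTop (𝓝 b))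
    {q : ℝ} (hq : 0 < q) {κ : Fin d → ℝ} (hκ : ∀ i, 0 ≤ κ i) :
    Tendsto (fun N : ℕ => (∫ x in A i, entranceWeight T Y A (q / N) (fun i => κ i / N) x ∂μ)
      / wanderingRate μ T Y N) atTop
      (𝓝 (b * Real.Gamma (1 - α + 1) * (q + κ i) ^ (-(1 - α)))) := by
  have hY := h.measurableSet_junction
  have hfin := h.junction_lt_top
  have hx : 0 < q + κ i := by have := hκ i; positivity
  have hlim := tendsto_abelian (w := wanderingRate μ T Y)
    (v := fun n => wanderingRateFrom μ T Y (A i) (n + 1)) (wanderingRate_add_le hT hY hfin)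
    (monotone_wanderingRate hT hY hfin) (by simp [wanderingRate]) (fun n => measureReal_nonneg)
    (fun n => wanderingRateFrom_le hT hY hfin (h.measurableSet_ray i) (n + 1)) (sub_nonneg.2 hα)
    (fun t ht => tendsto_wanderingRateFrom_floor hT hY hfin hrec htop hw hb ht) hx
  refine hlim.congr' ?_
  filter_upwards [eventually_gt_atTop 0] with N hN
  have hN' : (0 : ℝ) < N := by exact_mod_cast hN
  rw [setIntegral_entranceWeight hT h hrec (by positivity) (fun i => by have := hκ i; positivity) i,
    ← add_div]
  congr 1
  have hz1 : Real.exp (-((q + κ i) / N)) < 1 := by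
    rw [Real.exp_lt_one_iff]; have : 0 < (q + κ i) / N := by positivity
    linarith
  rw [← (hasSum_pow_mul_sum_range (y := fun n => μ.real (firstVisit T Y n ∩ A i))
    (C := μ.real Y) (fun n => by
    rw [abs_of_nonneg measureReal_nonneg]
    exact measureReal_firstVisit_inter_le hT hY hfin (A i) n) (Real.exp_pos _).le hz1).tsum_eq,
    tsum_mul_left]
  simp only [wanderingRateFrom_eq_sum hT hY hfin (h.measurableSet_ray i)]

/-- The renewal identity, multiplied by N (1 - exp(-q/N)) / w(N), becomes a linear equation for the
mean over `Y` once the entrance resolvents are replaced by this mean times the entrance weights. -/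
theorem tendsto_scaledResolvent_junction [SigmaFinite μ] (hT : Ergodic T μ)
    (h : IsRayDecomposition μ T Y A) (hrec : ∀ᵐ x ∂μ, ∃ᶠ n in atTop, T^[n] x ∈ Y)
    (htop : μ univ = ∞)
    (hcomp : ∀ i, IsCompact (closure (normalizedEntrances hT.toMeasurePreserving h i)))
    {α : ℝ} (hα : α ≤ 1) {β : Fin d → ℝ} (hβ : ∀ i, 0 ≤ β i) (hβsum : ∑ i, β i = 1)
    (hw : IsRegularlyVaryingSeq (wanderingRate μ T Y) (1 - α))
    (hwi : ∀ i, Tendsto (fun n => wanderingRateFrom μ T Y (A i) n / wanderingRate μ T Y n) atTop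
      (𝓝 (β i))) {q : ℝ} (hq : 0 < q) {κ : Fin d → ℝ} (hκ : ∀ i, 0 ≤ κ i) :
    Tendsto (fun N : ℕ => (μ.real Y)⁻¹ * ∫ x in Y, scaledResolvent T A q κ N x ∂μ) atTop
      (𝓝 (q * (∑ i, β i * (q + κ i) ^ (α - 1)) / ∑ i, β i * (q + κ i) ^ α)) := by
  have hmp := hT.toMeasurePreserving
  have hY := h.measurableSet_junction
  have hfin := h.junction_lt_top
  have hYpos : 0 < μ.real Y := ENNReal.toReal_pos h.junction_pos.ne' hfin.ne
  have hx : ∀ i, 0 < q + κ i := fun i => by have := hκ i; positivity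
  have hwtop := tendsto_wanderingRate hmp hY hfin hrec htop
  set w := wanderingRate μ T Y
  set ρ : ℕ → ℝ := fun N => (μ.real Y)⁻¹ * ∫ x in Y, scaledResolvent T A q κ N x ∂μ with hρ
  let W : Fin d → ℕ → ℝ := fun i N =>
    ∫ x in A i, entranceWeight T Y A (q / N) (fun i => κ i / N) x ∂μ
  let D : Fin d → ℕ → ℝ := fun i N =>
    ∫ x in A i, entranceResolvent T Y A (q / N) (fun i => κ i / N) x ∂μ
  let ω : Fin d → ℝ := fun i => β i * Real.Gamma (1 - α + 1) * (q + κ i) ^ (-(1 - α))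
  have hW : ∀ i, Tendsto (fun N => W i N / w N) atTop (𝓝 (ω i)) := fun i =>
    tendsto_setIntegral_entranceWeight hmp h hrec htop hα hw (hwi i) hq hκ
  -- The error of that replacement; precompactness makes it o(w(N)).
  let E : Fin d → ℕ → ℝ := fun i N => (1 - Real.exp (-(q / N))) * D i N - ρ N * W i N
  have hW0 : ∀ i N, 0 ≤ W i N := fun i N => integral_nonneg fun x => (Real.exp_pos _).le
  have hE : ∀ i, Tendsto (fun N => E i N / w N) atTop (𝓝 0) := by
    intro i
    -- The reference density is uniform on `Y`, so that integrating the scaled resolvent against it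
    -- yields `ρ N`.
    have hv : Integrable (Y.indicator fun _ => (μ.real Y)⁻¹) μ :=
      (integrable_indicator_iff hY).2 (integrableOn_const hfin.ne)
    have hv1 : ∫ x, Y.indicator (fun _ => (μ.real Y)⁻¹) x ∂μ = 1 := by
      rw [integral_indicator hY, setIntegral_const, smul_eq_mul, mul_inv_cancel₀ hYpos.ne']
    have hvR : ∀ N, ∫ x, Y.indicator (fun _ => (μ.real Y)⁻¹) x * scaledResolvent T A q κ N x ∂μ
        = ρ N := fun N => by
      simp only [ρ]
      rw [← integral_const_mul, ← integral_indicator hY]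
      congr 1; funext x
      by_cases hxY : x ∈ Y <;> simp [hxY]
    have hmeas := measurable_scaledResolvent (A := A) hT.measurable h q κ
    rw [Metric.tendsto_nhds]
    intro δ hδ
    have hω : 0 ≤ ω i := ge_of_tendsto (hW i) (by
      filter_upwards [hwtop.eventually_gt_atTop 0] with N hN
      exact div_nonneg (hW0 i N) hN.le)
    have hunif := eventually_abs_integral_mul_sub_le hT hmeas
      (fun N x => abs_scaledResolvent_le hq hκ N x)
      (fun ε hε => eventually_abs_scaledResolvent_map_sub_le hq hκ hε) hv hv1
      ((hcomp i).totallyBounded.subset subset_closure)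
      -- Eventually W_i < (ω_i + 1) w(N), so this accuracy makes the error less than δ w(N).
      (ε := δ / (ω i + 1)) (by positivity)
    filter_upwards [hunif, eventually_gt_atTop 0, hwtop.eventually_gt_atTop 0,
      (hW i).eventually (gt_mem_nhds (lt_add_one (ω i)))] with N hN hN0 hwN hWN
    have hN0' : (0 : ℝ) < N := by exact_mod_cast hN0
    rw [hvR N] at hN
    have hest := abs_setIntegral_entranceResolvent_sub_le hmp h hrec (s := q / N)
      (κ := fun i => κ i / N) (by positivity) (fun i => by have := hκ i; positivity) i hN
    rw [Real.dist_eq, sub_zero, abs_div, abs_of_pos hwN, div_lt_iff₀ hwN]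
    rw [div_lt_iff₀ hwN] at hWN
    calc |E i N| ≤ δ / (ω i + 1) * W i N := hest
      _ < δ / (ω i + 1) * ((ω i + 1) * w N) := mul_lt_mul_of_pos_left hWN (by positivity)
      _ = δ * w N := by field_simp
  let a : ℕ → ℝ := fun N => N * (1 - Real.exp (-(q / N)))
  let b : Fin d → ℕ → ℝ := fun i N => N * (Real.exp ((q + κ i) / N) - 1)
  let e : ℕ → ℝ := fun N => Real.exp (-(q / N))
  have ha : Tendsto a atTop (𝓝 q) := tendsto_mul_one_sub_exp q
  have hb : ∀ i, Tendsto (b i) atTop (𝓝 (q + κ i)) := fun i => tendsto_mul_exp_sub_one _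
  have he : Tendsto e atTop (𝓝 1) := by
    have := tendsto_exp_div (-q)
    simpa only [neg_div] using this
  have hYw : Tendsto (fun N => μ.real Y / w N) atTop (𝓝 0) := hwtop.const_div_atTop _
  -- `hP` concerns the coefficient of `ρ N` in the linear equation and `hQ` the right-hand side. The
  -- terms with μ(Y) vanish since w(N) tends to infinity, and the limiting coefficient is positive
  -- because some β_i is.
  have hP : Tendsto (fun N => a N * (μ.real Y / w N) + e N * ∑ i, b i N * (W i N / w N)) atTop
      (𝓝 (q * 0 + 1 * ∑ i, (q + κ i) * ω i)) :=
    (ha.mul hYw).add (he.mul (tendsto_finsetSum _ fun i _ => (hb i).mul (hW i)))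
  have hQ : Tendsto (fun N => a N * (μ.real Y / w N + ∑ i, W i N / w N)
      - e N * ∑ i, b i N * (E i N / w N)) atTop
      (𝓝 (q * (0 + ∑ i, ω i) - 1 * ∑ i, (q + κ i) * 0)) :=
    (ha.mul (hYw.add (tendsto_finsetSum _ fun i _ => hW i))).sub
      (he.mul (tendsto_finsetSum _ fun i _ => (hb i).mul (hE i)))
  have hG : 0 < Real.Gamma (1 - α + 1) := Real.Gamma_pos_of_pos (by linarith)
  have e1 : ∑ i, (q + κ i) * ω i = Real.Gamma (1 - α + 1) * ∑ i, β i * (q + κ i) ^ α := by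
    rw [Finset.mul_sum]
    refine Finset.sum_congr rfl fun i _ => ?_
    have : (q + κ i) ^ α = (q + κ i) * (q + κ i) ^ (-(1 - α)) := by
      rw [mul_comm, ← Real.rpow_add_one (hx i).ne']; congr 1; ring
    rw [this]; simp only [ω]; ring
  have e2 : ∑ i, ω i = Real.Gamma (1 - α + 1) * ∑ i, β i * (q + κ i) ^ (α - 1) := by
    rw [Finset.mul_sum]
    refine Finset.sum_congr rfl fun i _ => ?_
    simp only [ω, neg_sub]; ring
  have hpos : 0 < ∑ i, β i * (q + κ i) ^ α := by
    refine Finset.sum_pos' (fun i _ => mul_nonneg (hβ i) (Real.rpow_nonneg (hx i).le _)) ?_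
    by_contra hcon
    push Not at hcon
    have : ∑ i, β i ≤ 0 := Finset.sum_nonpos fun i hi => by
      by_contra hi'
      exact (hcon i hi).not_gt (mul_pos (not_le.1 hi') (Real.rpow_pos_of_pos (hx i) _))
    linarith
  have hPne : q * 0 + 1 * ∑ i, (q + κ i) * ω i ≠ 0 := by
    rw [e1]; simp only [mul_zero, zero_add, one_mul]; positivity
  have hlim := hQ.div hP hPne
  have e3 : (q * (0 + ∑ i, ω i) - 1 * ∑ i, (q + κ i) * 0)
      / (q * 0 + 1 * ∑ i, (q + κ i) * ω i)
      = q * (∑ i, β i * (q + κ i) ^ (α - 1)) / ∑ i, β i * (q + κ i) ^ α := by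
    rw [e1, e2]
    simp only [mul_zero, Finset.sum_const_zero, zero_add, sub_zero, one_mul]
    field_simp
  rw [e3] at hlim
  refine hlim.congr' ?_
  filter_upwards [eventually_gt_atTop 0, hwtop.eventually_gt_atTop 0,
    hP.eventually_ne hPne] with N hN0 hwN hPN
  have hN0' : (0 : ℝ) < N := by exact_mod_cast hN0
  simp only [Pi.div_apply]
  rw [div_eq_iff hPN]
  have hid := renewal_identity hmp h hrec (s := q / N) (κ := fun i => κ i / N) (by positivity)
    (fun i => by have := hκ i; positivity)
  simp only [← add_div] at hid
  have hρN : (1 - Real.exp (-(q / N))) * ∫ x in Y, resolvent T A (q / N) (fun i => κ i / N) x ∂μ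
      = μ.real Y * ρ N := by
    simp only [ρ, scaledResolvent]
    rw [integral_const_mul, mul_inv_cancel_left₀ hYpos.ne']
  rw [hρN] at hid
  have s1 : ∑ i, b i N * (E i N / w N) = (N * (1 - Real.exp (-(q / N))) / w N)
      * (∑ i, (Real.exp ((q + κ i) / N) - 1) * D i N) - ρ N * ∑ i, b i N * (W i N / w N) := by
    rw [Finset.mul_sum, Finset.mul_sum, ← Finset.sum_sub_distrib]
    refine Finset.sum_congr rfl fun i _ => ?_
    simp only [b, E]; ring
  rw [s1, ← Finset.sum_div]
  have hid' : μ.real Y * ρ N + e N * ∑ i, (Real.exp ((q + κ i) / N) - 1) * D i N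
      = μ.real Y + ∑ i, W i N := hid
  have : a N / w N * (μ.real Y * ρ N + e N * ∑ i, (Real.exp ((q + κ i) / N) - 1) * D i N)
      = a N / w N * (μ.real Y + ∑ i, W i N) := by rw [hid']
  simp only [a] at this ⊢
  linear_combination -this

/-- The density of ν minus the uniform density on `Y` has integral zero, so asymptotic invariance
carries the limit from `Y` to ν. -/
theorem tendsto_integral_scaledResolvent [SigmaFinite μ] (hT : Ergodic T μ)
    (h : IsRayDecomposition μ T Y A) (hrec : ∀ᵐ x ∂μ, ∃ᶠ n in atTop, T^[n] x ∈ Y)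
    (htop : μ univ = ∞)
    (hcomp : ∀ i, IsCompact (closure (normalizedEntrances hT.toMeasurePreserving h i)))
    {α : ℝ} (hα : α ≤ 1) {β : Fin d → ℝ} (hβ : ∀ i, 0 ≤ β i) (hβsum : ∑ i, β i = 1)
    (hw : IsRegularlyVaryingSeq (wanderingRate μ T Y) (1 - α))
    (hwi : ∀ i, Tendsto (fun n => wanderingRateFrom μ T Y (A i) n / wanderingRate μ T Y n) atTop
      (𝓝 (β i))) {ν : Measure X} [IsProbabilityMeasure ν] (hν : ν ≪ μ)
    {q : ℝ} (hq : 0 < q) {κ : Fin d → ℝ} (hκ : ∀ i, 0 ≤ κ i) :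
    Tendsto (fun N : ℕ => ∫ x, scaledResolvent T A q κ N x ∂ν) atTop
      (𝓝 (q * (∑ i, β i * (q + κ i) ^ (α - 1)) / ∑ i, β i * (q + κ i) ^ α)) := by
  have h1 := tendsto_scaledResolvent_junction hT h hrec htop hcomp hα hβ hβsum hw hwi hq hκ
  have hY := h.measurableSet_junction
  have hYpos : 0 < μ.real Y := ENNReal.toReal_pos h.junction_pos.ne' h.junction_lt_top.ne
  let u : X → ℝ := fun x => (ν.rnDeriv μ x).toReal
  have hu : Integrable u μ := Measure.integrable_toReal_rnDeriv
  let v : X → ℝ := Y.indicator fun _ => (μ.real Y)⁻¹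
  have hv : Integrable v μ :=
    (integrable_indicator_iff hY).2 (integrableOn_const h.junction_lt_top.ne)
  have hu1 : ∫ x, u x ∂μ = 1 := by
    simp only [u]
    rw [Measure.integral_toReal_rnDeriv hν]; simp
  have hv1 : ∫ x, v x ∂μ = 1 := by
    rw [integral_indicator hY, setIntegral_const, smul_eq_mul, mul_inv_cancel₀ hYpos.ne']
  have hmeas := measurable_scaledResolvent (A := A) hT.measurable h q κ
  have hbd := fun N x => abs_scaledResolvent_le (T := T) (A := A) hq hκ N x
  have h2 := tendsto_integral_mul_of_asymptotically_invariant hT hmeas hbd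
    (fun ε hε => eventually_abs_scaledResolvent_map_sub_le hq hκ hε) (hu.sub hv)
    (by simp only [Pi.sub_apply]; rw [integral_sub hu hv, hu1, hv1, sub_self])
  have h3 := h1.add h2
  rw [add_zero] at h3
  refine h3.congr fun N => ?_
  have hvR : ∫ x, v x * scaledResolvent T A q κ N x ∂μ
      = (μ.real Y)⁻¹ * ∫ x in Y, scaledResolvent T A q κ N x ∂μ := by
    rw [← integral_const_mul, ← integral_indicator hY]
    congr 1; funext x
    by_cases hxY : x ∈ Y <;> simp [hxY, v]
  have huR : ∫ x, u x * scaledResolvent T A q κ N x ∂μ = ∫ x, scaledResolvent T A q κ N x ∂ν := by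
    simp only [u]
    exact integral_rnDeriv_smul hν
  simp only [Pi.sub_apply, sub_mul]
  rw [integral_sub (integrable_mul_of_abs_le hu (hmeas N) (hbd N))
    (integrable_mul_of_abs_le hv (hmeas N) (hbd N)), hvR, huR]
  ring

end ResolventLimit

/-! ### Stieltjes transform of the generalized arcsine law -/

section Arcsine

theorem ae_nonneg_stableLaw {α b : ℝ} (h0 : 0 < α) (h1 : α < 1) (hb : 0 ≤ b) :
    ∀ᵐ x ∂(stableLaw α b), 0 ≤ x := by
  have := measure_eq_zero_iff_ae_notMem.1 (stableLaw_Iio h0 h1 hb)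
  filter_upwards [this] with x hx
  simpa using hx

theorem integrable_exp_stableLaw {α b : ℝ} (h0 : 0 < α) (h1 : α < 1) (hb : 0 ≤ b) {t : ℝ}
    (ht : t ≤ 0) : Integrable (fun x => Real.exp (t * x)) (stableLaw α b) := by
  refine Integrable.of_bound (by fun_prop) 1 ?_
  filter_upwards [ae_nonneg_stableLaw h0 h1 hb] with x hx
  rw [Real.norm_of_nonneg (Real.exp_pos _).le, Real.exp_le_one_iff]
  exact mul_nonpos_of_nonpos_of_nonneg ht hx

/-- The explicit Laplace transform is differentiated; -a is interior to the domain of the moment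
generating function, which allows differentiation under the integral. -/
theorem integral_mul_exp_stableLaw {α b : ℝ} (h0 : 0 < α) (h1 : α < 1) (hb : 0 ≤ b) {a : ℝ}
    (ha : 0 < a) : ∫ x, x * Real.exp (-a * x) ∂(stableLaw α b)
      = α * b * a ^ (α - 1) * Real.exp (-b * a ^ α) := by
  have hmem : -a ∈ interior (integrableExpSet (fun x : ℝ => x) (stableLaw α b)) := by
    refine mem_interior.2 ⟨Iio 0, fun t ht => ?_, isOpen_Iio, by simpa using ha⟩
    exact integrable_exp_stableLaw h0 h1 hb (le_of_lt ht)
  have hd1 := hasDerivAt_mgf hmem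
  have hd2 : HasDerivAt (fun t : ℝ => Real.exp (-b * (-t) ^ α))
      (Real.exp (-b * (- -a) ^ α) * (-b * (-1 * α * (- -a) ^ (α - 1)))) (-a) := by
    have h := (hasDerivAt_id (-a)).neg.rpow_const (p := α) (Or.inl (by simpa using ha.ne'))
    exact (h.const_mul (-b)).exp
  have heq : mgf (fun x : ℝ => x) (stableLaw α b) =ᶠ[𝓝 (-a)]
      fun t : ℝ => Real.exp (-b * (-t) ^ α) := by
    filter_upwards [isOpen_Iio.mem_nhds (show -a ∈ Iio (0 : ℝ) by simpa using ha)] with t ht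
    have := integral_exp_stableLaw h0 h1 hb (r := -t) (by simpa using ht)
    rw [neg_neg] at this
    exact this
  have := hd1.unique (hd2.congr_of_eventuallyEq heq)
  simp only at this
  rw [this, neg_neg]
  ring

variable {d : ℕ} {α : ℝ} {β : Fin d → ℝ}

theorem integral_exp_pi_stableLaw (h0 : 0 < α) (h1 : α < 1) (hβ : ∀ i, 0 ≤ β i) {a : Fin d → ℝ}
    (ha : ∀ i, 0 < a i) :
    ∫ x, Real.exp (-∑ i, a i * x i) ∂(Measure.pi fun i => stableLaw α (β i))
      = Real.exp (-∑ i, β i * a i ^ α) := by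
  have h := integral_fintype_prod_eq_prod (μ := fun i => stableLaw α (β i))
    (fun i x => Real.exp (-a i * x))
  simp only [integral_exp_stableLaw h0 h1 (hβ _) (ha _), ← Real.exp_sum] at h
  simpa [Finset.sum_neg_distrib] using h

theorem integral_mul_exp_pi_stableLaw (h0 : 0 < α) (h1 : α < 1) (hβ : ∀ i, 0 ≤ β i)
    {a : Fin d → ℝ} (ha : ∀ i, 0 < a i) (j : Fin d) :
    ∫ x, x j * Real.exp (-∑ i, a i * x i) ∂(Measure.pi fun i => stableLaw α (β i))
      = α * β j * a j ^ (α - 1) * Real.exp (-∑ i, β i * a i ^ α) := by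
  have h := integral_fintype_prod_eq_prod (μ := fun i => stableLaw α (β i))
    (fun i x => (if i = j then x else 1) * Real.exp (-a i * x))
  have h2 : ∀ i, ∫ x, (if i = j then x else 1) * Real.exp (-a i * x) ∂(stableLaw α (β i))
      = (if i = j then α * β i * a i ^ (α - 1) else 1) * Real.exp (-β i * a i ^ α) := by
    intro i
    by_cases hij : i = j
    · simp only [hij, if_true]
      rw [integral_mul_exp_stableLaw h0 h1 (hβ j) (ha j)]
    · simp only [hij, if_false, one_mul]
      rw [integral_exp_stableLaw h0 h1 (hβ i) (ha i)]
  simp only [h2, Finset.prod_mul_distrib, ← Real.exp_sum, Finset.prod_ite_eq',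
    Finset.mem_univ, if_true] at h
  simpa [Finset.sum_neg_distrib] using h

/-- The sum is positive because the indicator of ∑ x ≤ 0 is bounded by exp(-r ∑ x), of mean
exp(-r^α), for every r > 0; now r tends to infinity. -/
theorem ae_pi_stableLaw (h0 : 0 < α) (h1 : α < 1) (hβ : ∀ i, 0 ≤ β i) (hβsum : ∑ i, β i = 1) :
    ∀ᵐ x ∂(Measure.pi fun i => stableLaw α (β i)), (∀ i, 0 ≤ x i) ∧ 0 < ∑ i, x i := by
  set Q := Measure.pi fun i => stableLaw α (β i)
  have hnn : ∀ᵐ x ∂Q, ∀ i, 0 ≤ x i := ae_all_iff.2 fun i =>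
    (Measure.quasiMeasurePreserving_eval _ i).ae (ae_nonneg_stableLaw h0 h1 (hβ i))
  have hS : MeasurableSet {x : Fin d → ℝ | ∑ i, x i ≤ 0} :=
    measurableSet_le (by fun_prop) measurable_const
  have hle : ∀ r : ℝ, 0 < r → Q.real {x | ∑ i, x i ≤ 0} ≤ Real.exp (-r ^ α) := by
    intro r hr
    have h := integral_exp_pi_stableLaw h0 h1 hβ (a := fun _ => r) (fun _ => hr)
    rw [← Finset.sum_mul, hβsum, one_mul] at h
    have hint : Integrable (fun x : Fin d → ℝ => Real.exp (-∑ i, r * x i)) Q := by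
      refine Integrable.of_bound (Measurable.aestronglyMeasurable (by fun_prop)) 1 ?_
      filter_upwards [hnn] with x hx
      rw [Real.norm_of_nonneg (Real.exp_pos _).le, Real.exp_le_one_iff, neg_nonpos]
      exact Finset.sum_nonneg fun i _ => mul_nonneg hr.le (hx i)
    rw [← h, ← integral_indicator_one hS]
    refine integral_mono ((integrable_indicator_iff hS).2
      (integrableOn_const (measure_ne_top _ _))) hint fun x => ?_
    by_cases hx : x ∈ {x : Fin d → ℝ | ∑ i, x i ≤ 0}
    · rw [indicator_of_mem hx, Pi.one_apply, ← Finset.mul_sum, Real.one_le_exp_iff, neg_nonneg]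
      exact mul_nonpos_of_nonneg_of_nonpos hr.le hx
    · rw [indicator_of_notMem hx]; positivity
  have hzero : Q.real {x | ∑ i, x i ≤ 0} ≤ 0 := by
    refine ge_of_tendsto ((Real.tendsto_exp_neg_atTop_nhds_zero.comp (tendsto_rpow_atTop h0))) ?_
    filter_upwards [eventually_gt_atTop 0] with r hr using hle r hr
  have hz : Q {x | ∑ i, x i ≤ 0} = 0 :=
    (measureReal_eq_zero_iff (measure_ne_top _ _)).1 (le_antisymm hzero measureReal_nonneg)
  filter_upwards [hnn, measure_eq_zero_iff_ae_notMem.1 hz] with x hx hx'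
  exact ⟨hx, not_le.1 hx'⟩

theorem integral_Ioi_mul_exp_neg {s L : ℝ} (hL : 0 < L) :
    IntegrableOn (fun r : ℝ => s * Real.exp (-(r * L))) (Ioi 0) ∧
      ∫ r in Ioi (0 : ℝ), s * Real.exp (-(r * L)) = s / L := by
  have h1 := (exp_neg_integrableOn_Ioi 0 hL).const_mul s
  have e : (fun r : ℝ => s * Real.exp (-L * r)) = fun r => s * Real.exp (-(r * L)) := by
    funext r; congr 2; ring
  refine ⟨by rwa [e] at h1, ?_⟩
  rw [← e, integral_const_mul, integral_exp_mul_Ioi (by linarith)]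
  simp [neg_div]
  rfl

theorem integral_Ioi_rpow_mul_exp {B : ℝ} (h0 : 0 < α) (hB : 0 < B) :
    ∫ r in Ioi (0 : ℝ), α * B * r ^ (α - 1) * Real.exp (-(B * r ^ α)) = 1 := by
  have h := integral_Ioi_of_hasDerivAt_of_nonneg (a := 0) (l := 0)
    (g := fun r : ℝ => -Real.exp (-(B * r ^ α)))
    (g' := fun r : ℝ => α * B * r ^ (α - 1) * Real.exp (-(B * r ^ α))) ?_ ?_ ?_ ?_
  · rw [h]; simp [h0.ne']
  · exact (((Real.continuousAt_rpow_const 0 α (Or.inr h0.le)).const_mul B).neg.rexp.neg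
      ).continuousWithinAt
  · intro r hr
    have h := (((hasDerivAt_id r).rpow_const (p := α) (Or.inl (ne_of_gt hr))).const_mul
      B).neg.exp.neg
    refine h.congr_deriv ?_
    simp only [id, Pi.neg_apply]
    ring
  · intro r hr
    have : 0 ≤ r := le_of_lt hr
    positivity
  · have := (Real.tendsto_exp_neg_atTop_nhds_zero.comp
      ((tendsto_rpow_atTop h0).const_mul_atTop hB)).neg
    simpa using this

/-- With 1 / L = ∫₀^∞ exp(-r L) dr and Fubini the quotient becomes a mean of ∑ x_j exp(-r a · x),
known from the differentiated transforms. As a function of r it is a constant times the probability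
density α B r^(α-1) exp(-B r^α), and the constant is the claimed value. -/
theorem integral_div_pi_stableLaw (h0 : 0 < α) (h1 : α < 1) (hβ : ∀ i, 0 ≤ β i)
    (hβsum : ∑ i, β i = 1) {a : Fin d → ℝ} (ha : ∀ i, 0 < a i) (hB : 0 < ∑ i, β i * a i ^ α) :
    ∫ x, (∑ i, x i) / (∑ i, a i * x i) ∂(Measure.pi fun i => stableLaw α (β i))
      = (∑ i, β i * a i ^ (α - 1)) / ∑ i, β i * a i ^ α := by
  set Q := Measure.pi fun i => stableLaw α (β i) with hQ
  have hae := ae_pi_stableLaw h0 h1 hβ hβsum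
  set B := ∑ i, β i * a i ^ α with hBdef
  have hd : (Finset.univ : Finset (Fin d)).Nonempty := by
    by_contra hne
    rw [Finset.not_nonempty_iff_eq_empty] at hne
    simp [hne] at hβsum
  -- The least coefficient a_{i₀} bounds the quotient by 1 / a_{i₀}, which gives the integrability
  -- needed for Fubini.
  obtain ⟨i₀, -, hi₀⟩ := Finset.exists_min_image Finset.univ a hd
  have hL : ∀ x : Fin d → ℝ, (∀ i, 0 ≤ x i) → a i₀ * ∑ i, x i ≤ ∑ i, a i * x i := fun x hx => by
    rw [Finset.mul_sum]
    exact Finset.sum_le_sum fun i hi => mul_le_mul_of_nonneg_right (hi₀ i hi) (hx i)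
  let F : (Fin d → ℝ) → ℝ → ℝ := fun x r => (∑ i, x i) * Real.exp (-(r * ∑ i, a i * x i))
  have hpos : ∀ᵐ x ∂Q, 0 < ∑ i, x i ∧ 0 < ∑ i, a i * x i
      ∧ (∑ i, x i) / (∑ i, a i * x i) ≤ (a i₀)⁻¹ := by
    filter_upwards [hae] with x hx
    have h2 := hL x hx.1
    have h3 : 0 < a i₀ * ∑ i, x i := mul_pos (ha i₀) hx.2
    refine ⟨hx.2, h3.trans_le h2, ?_⟩
    rw [div_le_iff₀ (h3.trans_le h2)]
    rwa [← div_eq_inv_mul, le_div_iff₀ (ha i₀), mul_comm]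
  have hint : Integrable (Function.uncurry F) (Q.prod (volume.restrict (Ioi (0 : ℝ)))) := by
    have hm : Measurable (Function.uncurry F) := by
      simp only [F, Function.uncurry_def]; fun_prop
    rw [integrable_prod_iff hm.aestronglyMeasurable]
    constructor
    · filter_upwards [hpos] with x hx
      exact (integral_Ioi_mul_exp_neg (s := ∑ i, x i) hx.2.1).1
    · have he : (fun x => ∫ r in Ioi (0 : ℝ), ‖Function.uncurry F (x, r)‖) =ᵐ[Q]
          fun x => (∑ i, x i) / (∑ i, a i * x i) := by
        filter_upwards [hpos] with x hx
        rw [← (integral_Ioi_mul_exp_neg hx.2.1).2]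
        refine setIntegral_congr_fun measurableSet_Ioi fun r _ => ?_
        exact Real.norm_of_nonneg (mul_nonneg hx.1.le (Real.exp_pos _).le)
      refine Integrable.congr ?_ he.symm
      refine Integrable.of_bound (Measurable.aestronglyMeasurable (by fun_prop)) (a i₀)⁻¹ ?_
      filter_upwards [hpos] with x hx
      rw [Real.norm_of_nonneg (div_nonneg hx.1.le hx.2.1.le)]
      exact hx.2.2
  have e1 : ∫ x, (∑ i, x i) / (∑ i, a i * x i) ∂Q = ∫ x, (∫ r in Ioi (0 : ℝ), F x r) ∂Q := by
    refine integral_congr_ae ?_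
    filter_upwards [hpos] with x hx
    exact ((integral_Ioi_mul_exp_neg hx.2.1).2).symm
  rw [e1, integral_integral_swap hint]
  have e2 : ∀ r ∈ Ioi (0 : ℝ), ∫ x, F x r ∂Q = (∑ i, β i * a i ^ (α - 1)) / B
      * (α * B * r ^ (α - 1) * Real.exp (-(B * r ^ α))) := by
    intro r hr
    have hr : 0 < r := hr
    have hra : ∀ i, 0 < r * a i := fun i => mul_pos hr (ha i)
    have hsum : ∀ x : Fin d → ℝ, r * ∑ i, a i * x i = ∑ i, r * a i * x i := fun x => by
      rw [Finset.mul_sum]; exact Finset.sum_congr rfl fun i _ => (mul_assoc _ _ _).symm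
    have hintj : ∀ j ∈ Finset.univ,
        Integrable (fun x : Fin d → ℝ => x j * Real.exp (-∑ i, r * a i * x i)) Q := by
      intro j _
      -- The bound comes from y exp(-y) ≤ 1 with y = ∑ r a_i x_i ≥ r a_j x_j.
      refine Integrable.of_bound (Measurable.aestronglyMeasurable (by fun_prop)) (r * a j)⁻¹ ?_
      filter_upwards [hae] with x hx
      rw [Real.norm_of_nonneg (mul_nonneg (hx.1 j) (Real.exp_pos _).le)]
      have h2 : r * a j * x j ≤ ∑ i, r * a i * x i :=
        Finset.single_le_sum (f := fun i => r * a i * x i)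
          (fun i _ => mul_nonneg (hra i).le (hx.1 i)) (Finset.mem_univ j)
      have h3 := Real.add_one_le_exp (∑ i, r * a i * x i)
      rw [Real.exp_neg, ← div_eq_mul_inv, div_le_iff₀ (Real.exp_pos _), ← div_eq_inv_mul,
        le_div_iff₀ (hra j)]
      linarith
    have e3 : ∫ x, F x r ∂Q = ∑ j, α * β j * (r * a j) ^ (α - 1)
        * Real.exp (-∑ i, β i * (r * a i) ^ α) := by
      simp only [← integral_mul_exp_pi_stableLaw h0 h1 hβ hra]
      rw [← integral_finsetSum _ hintj]
      refine integral_congr_ae (Eventually.of_forall fun x => ?_)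
      simp only [F]
      rw [hsum, Finset.sum_mul]
    have e4 : ∑ i, β i * (r * a i) ^ α = B * r ^ α := by
      rw [hBdef, Finset.sum_mul]
      refine Finset.sum_congr rfl fun i _ => ?_
      rw [Real.mul_rpow hr.le (ha i).le]; ring
    rw [e3, e4, ← Finset.sum_mul]
    have e5 : ∑ j, α * β j * (r * a j) ^ (α - 1)
        = α * r ^ (α - 1) * ∑ j, β j * a j ^ (α - 1) := by
      rw [Finset.mul_sum]
      refine Finset.sum_congr rfl fun i _ => ?_
      rw [Real.mul_rpow hr.le (ha i).le]; ring
    rw [e5]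
    field_simp
  rw [setIntegral_congr_fun measurableSet_Ioi e2, integral_const_mul,
    integral_Ioi_rpow_mul_exp h0 hB, mul_one]

/-- The generalized arcsine law is supported by the unit simplex. -/
theorem ae_arcsineLaw (hα0 : 0 ≤ α) (hα1 : α ≤ 1) (hβ : ∀ i, 0 ≤ β i) (hβsum : ∑ i, β i = 1) :
    ∀ᵐ x ∂(arcsineLaw α β), (∀ i, 0 ≤ x i) ∧ ∑ i, x i = 1 := by
  have hm : MeasurableSet {x : Fin d → ℝ | (∀ i, 0 ≤ x i) ∧ ∑ i, x i = 1} := by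
    measurability
  unfold arcsineLaw
  split_ifs with h h'
  · rw [ae_iff, Measure.finsetSum_apply]
    refine Finset.sum_eq_zero fun i _ => ?_
    have hi : ∀ᵐ x ∂(Measure.dirac (Pi.single i (1 : ℝ) : Fin d → ℝ)),
        (∀ i, 0 ≤ x i) ∧ ∑ i, x i = 1 := by
      refine (ae_dirac_iff hm).2 ⟨fun j => ?_, by simp⟩
      rw [Pi.single_apply]
      split_ifs <;> simp
    rw [Measure.smul_apply, ae_iff.1 hi, smul_zero]
  · exact (ae_dirac_iff hm).2 ⟨hβ, hβsum⟩
  · rw [ae_map_iff (by fun_prop) hm]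
    filter_upwards [ae_pi_stableLaw (lt_of_le_of_ne hα0 (Ne.symm h)) (lt_of_le_of_ne hα1 h') hβ
      hβsum] with x hx
    refine ⟨fun i => div_nonneg (hx.1 i) hx.2.le, ?_⟩
    rw [← Finset.sum_div, div_self hx.2.ne']

/-- The generalized Stieltjes transform of the generalized arcsine law. -/
theorem integral_inv_arcsineLaw (hα0 : 0 ≤ α) (hα1 : α ≤ 1) (hβ : ∀ i, 0 ≤ β i)
    (hβsum : ∑ i, β i = 1) {q : ℝ} (hq : 0 < q) {κ : Fin d → ℝ} (hκ : ∀ i, 0 ≤ κ i) :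
    ∫ x, (q + ∑ i, κ i * x i)⁻¹ ∂(arcsineLaw α β)
      = (∑ i, β i * (q + κ i) ^ (α - 1)) / ∑ i, β i * (q + κ i) ^ α := by
  have hx : ∀ i, 0 < q + κ i := fun i => by have := hκ i; positivity
  have hmeas : Measurable fun x : Fin d → ℝ => (q + ∑ i, κ i * x i)⁻¹ := by fun_prop
  unfold arcsineLaw
  split_ifs with h h'
  · subst h
    rw [integral_finsetSum_measure]
    · simp [integral_smul_measure, Pi.single_apply, hβ, hβsum, Real.rpow_neg_one]
    · intro i _
      exact (integrable_dirac (by simp)).smul_measure ENNReal.ofReal_ne_top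
  · subst h'
    rw [integral_dirac]
    simp [hβsum, mul_add, Finset.sum_add_distrib, ← Finset.sum_mul, mul_comm (κ _)]
  · have h0 := lt_of_le_of_ne hα0 (Ne.symm h)
    have h1 := lt_of_le_of_ne hα1 h'
    have hB : 0 < ∑ i, β i * (q + κ i) ^ α := by
      refine Finset.sum_pos' (fun i _ => mul_nonneg (hβ i) (Real.rpow_nonneg (hx i).le _)) ?_
      by_contra hcon
      push Not at hcon
      have : ∑ i, β i ≤ 0 := Finset.sum_nonpos fun i hi => by
        by_contra hi'
        exact (hcon i hi).not_gt (mul_pos (not_le.1 hi') (Real.rpow_pos_of_pos (hx i) _))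
      linarith
    rw [integral_map (by fun_prop) hmeas.aestronglyMeasurable,
      ← integral_div_pi_stableLaw h0 h1 hβ hβsum hx hB]
    refine integral_congr_ae ?_
    filter_upwards [ae_pi_stableLaw h0 h1 hβ hβsum] with x hx
    have h2 : ∑ i, κ i * (x i / ∑ j, x j) = (∑ i, κ i * x i) / ∑ j, x j := by
      rw [Finset.sum_div]
      exact Finset.sum_congr rfl fun i _ => (mul_div_assoc _ _ _).symm
    have h3 : ∑ i, (q + κ i) * x i = q * ∑ i, x i + ∑ i, κ i * x i := by
      rw [Finset.mul_sum, ← Finset.sum_add_distrib]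
      exact Finset.sum_congr rfl fun i _ => by ring
    have hs := hx.2.ne'
    rw [h2, h3, ← inv_div]
    field_simp

end Arcsine

/-! ### From Abel means to the diagonal -/

section Inversion

theorem exp_neg_inv_mem_Icc (N n : ℕ) : Real.exp (-(1 / (N : ℝ))) ^ n ∈ Icc (0 : ℝ) 1 :=
  ⟨by positivity, pow_le_one₀ (Real.exp_pos _).le (by
    rw [Real.exp_le_one_iff, neg_nonpos]; positivity)⟩

theorem exp_neg_inv_lt_one {N : ℕ} (hN : 0 < N) : Real.exp (-(1 / (N : ℝ))) < 1 := by
  rw [Real.exp_lt_one_iff, neg_lt_zero]; positivity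

theorem exp_neg_mem_Icc {t : ℝ} (ht : t ∈ Ioi (0 : ℝ)) : Real.exp (-t) ∈ Icc (0 : ℝ) 1 :=
  ⟨(Real.exp_pos _).le, Real.exp_le_one_iff.2 (by have : 0 < t := ht; linarith)⟩

/-- The sum `N⁻¹ ∑ₙ exp (-n / N) g (exp (-n / N)) φ(n)`. -/
noncomputable def discreteLaplace (N : ℕ) (g : ℝ → ℝ) (φ : ℕ → ℝ) : ℝ :=
  (N : ℝ)⁻¹ * ∑' n, Real.exp (-(1 / (N : ℝ))) ^ n * (g (Real.exp (-(1 / (N : ℝ))) ^ n) * φ n)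

/-- The integral `∫_0^∞ exp (-t) g (exp (-t)) Φ(t) dt`. -/
noncomputable def continuousLaplace (g : ℝ → ℝ) (Φ : ℝ → ℝ) : ℝ :=
  ∫ t in Ioi (0 : ℝ), Real.exp (-t) * (g (Real.exp (-t)) * Φ t)

theorem summable_discreteLaplace {N : ℕ} (hN : 0 < N) {g : ℝ → ℝ} {C : ℝ}
    (hg : ∀ z ∈ Icc (0 : ℝ) 1, |g z| ≤ C) {φ : ℕ → ℝ} (hφ : ∀ n, |φ n| ≤ 1) :
    Summable fun n =>
      Real.exp (-(1 / (N : ℝ))) ^ n * (g (Real.exp (-(1 / (N : ℝ))) ^ n) * φ n) := by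
  refine summable_pow_mul_of_le (C := C) (fun n => ?_) (Real.exp_pos _).le (exp_neg_inv_lt_one hN)
  rw [abs_mul]
  have := hg _ (exp_neg_inv_mem_Icc N n)
  exact (mul_le_of_le_one_right (abs_nonneg _) (hφ n)).trans this

theorem integrableOn_exp_neg : IntegrableOn (fun t : ℝ => Real.exp (-t)) (Ioi 0) := by
  simpa using exp_neg_integrableOn_Ioi 0 one_pos

theorem integrableOn_continuousLaplace {g : ℝ → ℝ} (hgm : Measurable g) {C : ℝ}
    (hg : ∀ z ∈ Icc (0 : ℝ) 1, |g z| ≤ C) {Φ : ℝ → ℝ} (hΦm : Measurable Φ)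
    (hΦ : ∀ t, 0 < t → |Φ t| ≤ 1) :
    IntegrableOn (fun t => Real.exp (-t) * (g (Real.exp (-t)) * Φ t)) (Ioi 0) := by
  refine (integrableOn_exp_neg.mul_const C).mono' (Measurable.aestronglyMeasurable (by fun_prop)) ?_
  refine ae_restrict_of_forall_mem measurableSet_Ioi fun t ht => ?_
  rw [Real.norm_eq_abs, abs_mul, abs_mul, Real.abs_exp]
  refine mul_le_mul_of_nonneg_left ?_ (Real.exp_pos _).le
  exact (mul_le_of_le_one_right (abs_nonneg _) (hΦ t ht)).trans (hg _ (exp_neg_mem_Icc ht))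

theorem abs_continuousLaplace_le {g : ℝ → ℝ} {C : ℝ}
    (hg : ∀ z ∈ Icc (0 : ℝ) 1, |g z| ≤ C) {Φ : ℝ → ℝ} (hΦ : ∀ t, 0 < t → |Φ t| ≤ 1) :
    |continuousLaplace g Φ| ≤ C := by
  have h : ∫ t in Ioi (0 : ℝ), Real.exp (-t) * C = C := by
    rw [integral_mul_const, integral_exp_neg_Ioi_zero, one_mul]
  rw [← h, ← Real.norm_eq_abs, continuousLaplace]
  refine norm_integral_le_of_norm_le (integrableOn_exp_neg.mul_const C) ?_
  refine ae_restrict_of_forall_mem measurableSet_Ioi fun t ht => ?_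
  rw [Real.norm_eq_abs, abs_mul, abs_mul, Real.abs_exp]
  refine mul_le_mul_of_nonneg_left ?_ (Real.exp_pos _).le
  exact (mul_le_of_le_one_right (abs_nonneg _) (hΦ t ht)).trans (hg _ (exp_neg_mem_Icc ht))

theorem abs_discreteLaplace_le {N : ℕ} (hN : 0 < N) {g : ℝ → ℝ} {C : ℝ}
    (hg : ∀ z ∈ Icc (0 : ℝ) 1, |g z| ≤ C) {φ : ℕ → ℝ} (hφ : ∀ n, |φ n| ≤ 1) :
    |discreteLaplace N g φ| ≤ C * ((N : ℝ) * (1 - Real.exp (-(1 / (N : ℝ)))))⁻¹ := by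
  have hs := summable_discreteLaplace hN hg hφ
  have hz1 := exp_neg_inv_lt_one hN
  have hgeo := summable_geometric_of_lt_one (Real.exp_pos (-(1 / (N : ℝ)))).le hz1
  rw [discreteLaplace, abs_mul, abs_of_nonneg (by positivity : (0 : ℝ) ≤ (N : ℝ)⁻¹), mul_inv,
    ← tsum_geometric_of_lt_one (Real.exp_pos _).le hz1, mul_left_comm]
  refine mul_le_mul_of_nonneg_left ?_ (by positivity)
  rw [← tsum_mul_left]
  refine (norm_tsum_le_tsum_norm hs.norm).trans (hs.norm.tsum_le_tsum (fun n => ?_)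
    (hgeo.mul_left C))
  rw [Real.norm_eq_abs, abs_mul, abs_mul, abs_of_nonneg (exp_neg_inv_mem_Icc N n).1, mul_comm C]
  refine mul_le_mul_of_nonneg_left ?_ (exp_neg_inv_mem_Icc N n).1
  exact (mul_le_of_le_one_right (abs_nonneg _) (hφ n)).trans (hg _ (exp_neg_inv_mem_Icc N n))

variable {φ : ℕ → ℕ → ℝ} {Φ : ℝ → ℝ}

/-- A monomial z^k turns the weight exp(-t) into exp(-(k + 1) t), which is the hypothesis at q = k +
1; natural values of q therefore suffice. -/
theorem tendsto_discreteLaplace_polynomial (hφ : ∀ N n, |φ N n| ≤ 1) (hΦm : Measurable Φ)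
    (hΦ : ∀ t, 0 < t → |Φ t| ≤ 1)
    (hlim : ∀ q : ℕ, 0 < q → Tendsto (fun N : ℕ => (1 - Real.exp (-(q / (N : ℝ))))
      * ∑' n, Real.exp (-(q / (N : ℝ))) ^ n * φ N n) atTop
      (𝓝 (q * ∫ t in Ioi (0 : ℝ), Real.exp (-(q * t)) * Φ t))) (p : Polynomial ℝ) :
    Tendsto (fun N => discreteLaplace N (fun z => p.eval z) (φ N)) atTop
      (𝓝 (continuousLaplace (fun z => p.eval z) Φ)) := by
  have hbdd : ∀ p : Polynomial ℝ, ∃ C, ∀ z ∈ Icc (0 : ℝ) 1, |p.eval z| ≤ C := fun p => by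
    obtain ⟨C, hC⟩ := isCompact_Icc.exists_bound_of_continuousOn
      (p.continuous.continuousOn (s := Icc (0 : ℝ) 1))
    exact ⟨C, hC⟩
  induction p using Polynomial.induction_on' with
  | add p₁ p₂ h₁ h₂ =>
    obtain ⟨C₁, hC₁⟩ := hbdd p₁
    obtain ⟨C₂, hC₂⟩ := hbdd p₂
    have e : continuousLaplace (fun z => (p₁ + p₂).eval z) Φ
        = continuousLaplace (fun z => p₁.eval z) Φ + continuousLaplace (fun z => p₂.eval z) Φ := by
      rw [continuousLaplace, continuousLaplace, continuousLaplace, ← integral_add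
        (integrableOn_continuousLaplace p₁.continuous.measurable hC₁ hΦm hΦ)
        (integrableOn_continuousLaplace p₂.continuous.measurable hC₂ hΦm hΦ)]
      congr 1; funext t
      rw [Polynomial.eval_add]; ring
    rw [e]
    refine (h₁.add h₂).congr' ?_
    filter_upwards [eventually_gt_atTop 0] with N hN
    rw [discreteLaplace, discreteLaplace, discreteLaplace, ← mul_add,
      ← (summable_discreteLaplace hN hC₁ (hφ N)).tsum_add
        (summable_discreteLaplace hN hC₂ (hφ N))]
    congr 1
    refine tsum_congr fun n => ?_
    rw [Polynomial.eval_add]; ring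
  | monomial k c =>
    have hq : (0 : ℝ) < (k + 1 : ℕ) := by positivity
    have h := ((hlim (k + 1) k.succ_pos).div (tendsto_mul_one_sub_exp ((k + 1 : ℕ) : ℝ))
      hq.ne').const_mul c
    have e1 : continuousLaplace (fun z => (Polynomial.monomial k c).eval z) Φ
        = c * ((k + 1 : ℕ) * (∫ t in Ioi (0 : ℝ), Real.exp (-((k + 1 : ℕ) * t)) * Φ t)
          / ((k + 1 : ℕ) : ℝ)) := by
      rw [mul_div_cancel_left₀ _ hq.ne', ← integral_const_mul, continuousLaplace]
      congr 1; funext t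
      have : Real.exp (-(((k + 1 : ℕ) : ℝ) * t)) = Real.exp (-t) * Real.exp (-t) ^ k := by
        rw [← pow_succ', ← Real.exp_nat_mul]; congr 1; ring
      rw [Polynomial.eval_monomial, this]; ring
    rw [e1]
    refine h.congr' ?_
    filter_upwards [eventually_gt_atTop 0] with N hN
    have hN' : (0 : ℝ) < N := by exact_mod_cast hN
    have hne : 1 - Real.exp (-(((k + 1 : ℕ) : ℝ) / N)) ≠ 0 := by
      have : Real.exp (-(((k + 1 : ℕ) : ℝ) / N)) < 1 := by
        rw [Real.exp_lt_one_iff, neg_lt_zero]; positivity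
      linarith
    have e2 : ∑' n, Real.exp (-(1 / (N : ℝ))) ^ n
        * ((Polynomial.monomial k c).eval (Real.exp (-(1 / (N : ℝ))) ^ n) * φ N n)
        = c * ∑' n, Real.exp (-(((k + 1 : ℕ) : ℝ) / N)) ^ n * φ N n := by
      rw [← tsum_mul_left]
      refine tsum_congr fun n => ?_
      have : Real.exp (-(((k + 1 : ℕ) : ℝ) / N)) = Real.exp (-(1 / (N : ℝ))) ^ (k + 1) := by
        rw [← Real.exp_nat_mul]; congr 1; ring
      rw [Polynomial.eval_monomial, this, ← pow_mul, ← pow_mul, mul_comm (k + 1), mul_add, mul_one,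
        pow_add]
      ring
    rw [discreteLaplace, e2]
    simp only [Pi.div_apply]
    field_simp

/-- Weierstrass approximation on [0, 1]: the discrete weights have total mass tending to 1, so
uniform closeness of the test functions is preserved. -/
theorem tendsto_discreteLaplace (hφ : ∀ N n, |φ N n| ≤ 1) (hΦm : Measurable Φ)
    (hΦ : ∀ t, 0 < t → |Φ t| ≤ 1)
    (hlim : ∀ q : ℕ, 0 < q → Tendsto (fun N : ℕ => (1 - Real.exp (-(q / (N : ℝ))))
      * ∑' n, Real.exp (-(q / (N : ℝ))) ^ n * φ N n) atTop
      (𝓝 (q * ∫ t in Ioi (0 : ℝ), Real.exp (-(q * t)) * Φ t))) {g : ℝ → ℝ} (hg : Continuous g) :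
    Tendsto (fun N => discreteLaplace N g (φ N)) atTop (𝓝 (continuousLaplace g Φ)) := by
  obtain ⟨C, hC⟩ := isCompact_Icc.exists_bound_of_continuousOn
    (hg.continuousOn (s := Icc (0 : ℝ) 1))
  rw [Metric.tendsto_nhds]
  intro ε hε
  obtain ⟨p, hp⟩ := exists_polynomial_near_of_continuousOn 0 1 g hg.continuousOn (ε / 6)
    (by positivity)
  obtain ⟨C', hC'⟩ := isCompact_Icc.exists_bound_of_continuousOn
    (p.continuous.continuousOn (s := Icc (0 : ℝ) 1))
  have hpg : ∀ z ∈ Icc (0 : ℝ) 1, |p.eval z - g z| ≤ ε / 6 := fun z hz => (hp z hz).le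
  -- With mass below 2 the errors are at most 2 · ε/6 on the discrete side, ε/6 on the continuous
  -- side, and less than ε/2 for the polynomial.
  have hmass : ∀ᶠ N : ℕ in atTop, ((N : ℝ) * (1 - Real.exp (-(1 / (N : ℝ)))))⁻¹ < 2 := by
    have := (tendsto_mul_one_sub_exp 1).inv₀ one_ne_zero
    rw [inv_one] at this
    exact this.eventually (gt_mem_nhds one_lt_two)
  have hp' := Metric.tendsto_nhds.1 (tendsto_discreteLaplace_polynomial hφ hΦm hΦ hlim p) (ε / 2)
    (by positivity)
  filter_upwards [hmass, hp', eventually_gt_atTop 0] with N h1 h2 hN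
  have e1 : discreteLaplace N (fun z => p.eval z) (φ N) - discreteLaplace N g (φ N)
      = discreteLaplace N (fun z => p.eval z - g z) (φ N) := by
    rw [discreteLaplace, discreteLaplace, discreteLaplace, ← mul_sub,
      ← (summable_discreteLaplace hN hC' (hφ N)).tsum_sub
        (summable_discreteLaplace hN hC (hφ N))]
    congr 1
    exact tsum_congr fun n => by ring
  have e2 : continuousLaplace (fun z => p.eval z) Φ - continuousLaplace g Φ
      = continuousLaplace (fun z => p.eval z - g z) Φ := by
    rw [continuousLaplace, continuousLaplace, continuousLaplace, ← integral_sub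
      (integrableOn_continuousLaplace p.continuous.measurable hC' hΦm hΦ)
      (integrableOn_continuousLaplace hg.measurable hC hΦm hΦ)]
    congr 1; funext t; ring
  have h3 := abs_discreteLaplace_le hN hpg (hφ N)
  have h4 := abs_continuousLaplace_le hpg hΦ
  have h5 : ε / 6 * ((N : ℝ) * (1 - Real.exp (-(1 / (N : ℝ)))))⁻¹ ≤ ε / 6 * 2 :=
    mul_le_mul_of_nonneg_left h1.le (by positivity)
  rw [← e1] at h3
  rw [← e2] at h4
  rw [Real.dist_eq, abs_lt] at h2 ⊢
  rw [abs_le] at h3 h4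
  constructor <;> linarith [h2.1, h2.2, h3.1, h3.2, h4.1, h4.2]

/-- A bump at `exp (-1)`, supported by `exp (-t)` with `|t - 1| < η`. -/
noncomputable def logBump (η z : ℝ) : ℝ := max 0 (η - |-Real.log z - 1|)

/-- Only z = 0 needs care. There `Real.log 0 = 0` gives max(0, η - 1) = 0, and the bump also
vanishes near 0, where -log|z| > 2. -/
theorem continuous_logBump {η : ℝ} (hη : η < 1) : Continuous (logBump η) := by
  rw [continuous_iff_continuousAt]
  intro z
  by_cases hz : z = 0
  · subst hz
    refine (continuousAt_const (y := (0 : ℝ))).congr ?_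
    filter_upwards [Metric.ball_mem_nhds (0 : ℝ) (Real.exp_pos (-2))] with z hz
    rw [logBump, eq_comm, max_eq_left_iff, sub_nonpos]
    by_cases hz0 : z = 0
    · simp [hz0, hη.le]
    · have h1 : |z| < Real.exp (-2) := by simpa using hz
      have h2 : Real.log z < -2 := by
        rw [← Real.log_abs, Real.log_lt_iff_lt_exp (abs_pos.2 hz0)]; exact h1
      have := le_abs_self (-Real.log z - 1)
      linarith
  · have := Real.continuousAt_log hz
    unfold logBump
    fun_prop

/-- The Lipschitz bounds in time replace the monotonicity of a Tauberian theorem: averages against a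
narrow bump at t = 1 differ little from the bump's mass times the value at t = 1, on both sides. -/
theorem tendsto_diagonal_of_tendsto_laplace (hφ : ∀ N n, |φ N n| ≤ 1) (hΦm : Measurable Φ)
    (hΦ : ∀ t, 0 < t → |Φ t| ≤ 1) {C : ℝ} (hC : 0 ≤ C)
    (hφC : ∀ N : ℕ, 0 < N → ∀ n, |φ N n - φ N N| ≤ C * |(n : ℝ) / N - 1|)
    (hΦC : ∀ t, 0 < t → |Φ t - Φ 1| ≤ C * |t - 1|)
    (hlim : ∀ q : ℕ, 0 < q → Tendsto (fun N : ℕ => (1 - Real.exp (-(q / (N : ℝ))))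
      * ∑' n, Real.exp (-(q / (N : ℝ))) ^ n * φ N n) atTop
      (𝓝 (q * ∫ t in Ioi (0 : ℝ), Real.exp (-(q * t)) * Φ t))) :
    Tendsto (fun N => φ N N) atTop (𝓝 (Φ 1)) := by
  rw [Metric.tendsto_nhds]
  intro ε hε
  -- The bound 1/2 keeps the bump continuous; the other one makes the oscillation Cη over its
  -- support at most ε/4.
  set η := min (1 / 2) (ε / (4 * (C + 1))) with hηdef
  have hη0 : 0 < η := by positivity
  have hη1 : η < 1 := (min_le_left _ _).trans_lt (by norm_num)
  have hηC : C * η ≤ ε / 4 := by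
    calc C * η ≤ (C + 1) * (ε / (4 * (C + 1))) :=
          mul_le_mul (by linarith) (min_le_right _ _) hη0.le (by linarith)
      _ = ε / 4 := by field_simp
  have hg := continuous_logBump hη1
  have hg0 : ∀ z, 0 ≤ logBump η z := fun z => le_max_left _ _
  have hgη : ∀ z, |logBump η z| ≤ η := fun z => by
    rw [abs_of_nonneg (hg0 z)]
    exact max_le hη0.le (by linarith [abs_nonneg (-Real.log z - 1)])
  have hgexp : ∀ t y c : ℝ, |c| ≤ C * |t - 1| → y = -t →
      |logBump η (Real.exp y) * c| ≤ C * η * logBump η (Real.exp y) := by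
    intro t y c hc hy
    rw [abs_mul, abs_of_nonneg (hg0 _), mul_comm (C * η)]
    rcases le_or_gt η |t - 1| with h | h
    · have : logBump η (Real.exp y) = 0 := by
        rw [logBump, Real.log_exp, hy, neg_neg, max_eq_left_iff]; linarith
      rw [this]; simp
    · exact mul_le_mul_of_nonneg_left (hc.trans (mul_le_mul_of_nonneg_left h.le hC)) (hg0 _)
  have h1 := tendsto_discreteLaplace hφ hΦm hΦ hlim hg
  -- Constant functions satisfy the same hypothesis, so the discrete mass of the bump converges to
  -- its continuous mass.
  have h2 : Tendsto (fun N => discreteLaplace N (logBump η) fun _ => 1) atTop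
      (𝓝 (continuousLaplace (logBump η) fun _ => 1)) := by
    refine tendsto_discreteLaplace (φ := fun _ _ => 1) (Φ := fun _ => 1) (by simp)
      measurable_const (by simp) (fun q hq => ?_) hg
    have hq' : (0 : ℝ) < q := by exact_mod_cast hq
    have e : (q : ℝ) * ∫ t in Ioi (0 : ℝ), Real.exp (-(q * t)) * 1 = 1 := by
      have := (integral_Ioi_mul_exp_neg (s := (1 : ℝ)) hq').2
      simp only [one_mul, mul_comm _ (q : ℝ)] at this
      simp only [mul_one]
      rw [this]; field_simp
    rw [e]
    refine tendsto_const_nhds.congr' ?_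
    filter_upwards [eventually_gt_atTop 0] with N hN
    have hN' : (0 : ℝ) < N := by exact_mod_cast hN
    have hz1 : Real.exp (-((q : ℝ) / N)) < 1 := by
      rw [Real.exp_lt_one_iff, neg_lt_zero]; positivity
    simp only [mul_one]
    rw [tsum_geometric_of_lt_one (Real.exp_pos _).le hz1, mul_inv_cancel₀ (sub_pos.2 hz1).ne']
  set m := continuousLaplace (logBump η) fun _ => 1 with hm
  set M := fun N : ℕ => discreteLaplace N (logBump η) fun _ => 1 with hM
  have hint1 := integrableOn_continuousLaplace hg.measurable (fun z _ => hgη z)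
    (Φ := fun _ => (1 : ℝ)) measurable_const (by simp)
  have hint2 := integrableOn_continuousLaplace hg.measurable (fun z _ => hgη z) hΦm hΦ
  have hmpos : 0 < m := by
    rw [hm, continuousLaplace, setIntegral_pos_iff_support_of_nonneg_ae _ hint1]
    · have hsub : Ioo (1 : ℝ) (1 + η) ⊆ Function.support (fun t =>
          Real.exp (-t) * (logBump η (Real.exp (-t)) * 1)) ∩ Ioi 0 := by
        intro t ht
        refine ⟨?_, by have := ht.1; simp only [mem_Ioi]; linarith⟩
        rw [Function.mem_support]
        have : 0 < logBump η (Real.exp (-t)) := by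
          rw [logBump, Real.log_exp, neg_neg, lt_max_iff, abs_of_pos (by linarith [ht.1])]
          right; linarith [ht.2]
        positivity
      refine lt_of_lt_of_le ?_ (measure_mono hsub)
      simp [hη0]
    · exact Eventually.of_forall fun t => by
        have := hg0 (Real.exp (-t))
        simp only [Pi.zero_apply]; positivity
  have hdisc : ∀ N : ℕ, 0 < N →
      |discreteLaplace N (logBump η) (φ N) - φ N N * M N| ≤ C * η * M N := by
    intro N hN
    have hN' : (0 : ℝ) < N := by exact_mod_cast hN
    have hs1 := summable_discreteLaplace hN (fun z _ => hgη z) (hφ N)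
    have hs2 := summable_discreteLaplace hN (fun z _ => hgη z) (φ := fun _ => (1 : ℝ)) (by simp)
    simp only [hM, discreteLaplace]
    rw [mul_left_comm (φ N N), mul_left_comm (C * η), ← mul_sub, abs_mul,
      abs_of_pos (inv_pos.2 hN'), ← tsum_mul_left, ← tsum_mul_left,
      ← hs1.tsum_sub (hs2.mul_left _)]
    refine mul_le_mul_of_nonneg_left ?_ (inv_pos.2 hN').le
    have hs3 := hs1.sub (hs2.mul_left (φ N N))
    refine (norm_tsum_le_tsum_norm hs3.norm).trans (hs3.norm.tsum_le_tsum (fun n => ?_)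
      (hs2.mul_left _))
    have hpow : Real.exp (-(1 / (N : ℝ))) ^ n = Real.exp (-((n : ℝ) / N)) := by
      rw [← Real.exp_nat_mul]; congr 1; ring
    have := hgexp (n / N) (-((n : ℝ) / N)) _ (hφC N hN n) rfl
    rw [hpow, Real.norm_eq_abs]
    have e : Real.exp (-((n : ℝ) / N)) * (logBump η (Real.exp (-((n : ℝ) / N))) * φ N n)
        - φ N N * (Real.exp (-((n : ℝ) / N)) * (logBump η (Real.exp (-((n : ℝ) / N))) * 1))
        = Real.exp (-((n : ℝ) / N))
          * (logBump η (Real.exp (-((n : ℝ) / N))) * (φ N n - φ N N)) := by ring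
    rw [e, abs_mul, Real.abs_exp]
    refine (mul_le_mul_of_nonneg_left this (Real.exp_pos _).le).trans_eq (by ring)
  have hcont : |continuousLaplace (logBump η) Φ - Φ 1 * m| ≤ C * η * m := by
    rw [hm, continuousLaplace, continuousLaplace, ← integral_const_mul, ← integral_const_mul,
      ← integral_sub hint2 (hint1.const_mul _), ← Real.norm_eq_abs]
    refine norm_integral_le_of_norm_le (hint1.const_mul _) ?_
    refine ae_restrict_of_forall_mem measurableSet_Ioi fun t ht => ?_
    have := hgexp t (-t) _ (hΦC t ht) rfl
    have e : Real.exp (-t) * (logBump η (Real.exp (-t)) * Φ t)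
        - Φ 1 * (Real.exp (-t) * (logBump η (Real.exp (-t)) * 1))
        = Real.exp (-t) * (logBump η (Real.exp (-t)) * (Φ t - Φ 1)) := by ring
    rw [e, Real.norm_eq_abs, abs_mul, Real.abs_exp]
    refine (mul_le_mul_of_nonneg_left this (Real.exp_pos _).le).trans_eq (by ring)
  -- With M N ≤ 2m, the errors add up to at most εm (1/16 + 1/2 + 1/16 + 1/4) < εm.
  have hδ : 0 < ε * m / 16 := by positivity
  have hδ' : 0 < min (ε * m / 16) m := lt_min hδ hmpos
  filter_upwards [Metric.tendsto_nhds.1 h1 _ hδ, Metric.tendsto_nhds.1 h2 _ hδ',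
    eventually_gt_atTop 0] with N k1 k2 hN
  have k3 := hdisc N hN
  have k4 : |φ N N * (M N - m)| ≤ ε * m / 16 := by
    rw [abs_mul]
    rw [Real.dist_eq] at k2
    exact (mul_le_of_le_one_left (abs_nonneg _) (hφ N N)).trans (k2.le.trans (min_le_left _ _))
  have k5 : M N ≤ 2 * m := by
    rw [Real.dist_eq] at k2
    have := (abs_lt.1 (k2.trans_le (min_le_right _ _))).2
    linarith
  have k6 : C * η * M N ≤ ε / 4 * (2 * m) := by
    have hMnn : 0 ≤ M N := mul_nonneg (by positivity) (tsum_nonneg fun n =>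
      mul_nonneg (exp_neg_inv_mem_Icc N n).1 (mul_nonneg (hg0 _) zero_le_one))
    exact mul_le_mul hηC k5 hMnn (by positivity)
  have k7 : C * η * m ≤ ε / 4 * m := mul_le_mul_of_nonneg_right hηC hmpos.le
  rw [Real.dist_eq] at k1 ⊢
  have k8 : |φ N N * m - Φ 1 * m| < ε * m := by
    rw [abs_lt] at k1 ⊢
    rw [abs_le] at k3 k4 hcont
    constructor <;> nlinarith
  rw [← sub_mul, abs_mul, abs_of_pos hmpos] at k8
  exact lt_of_mul_lt_mul_right k8 hmpos.le

end Inversion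

/-! ### Laplace transforms and weak convergence on the cube -/

section LaplaceConvergence

variable {d : ℕ}

/-- Laplace transforms determine weak convergence of probability measures on the unit cube. -/
theorem tendsto_integral_of_tendsto_laplace {ι : Type*} {l : Filter ι}
    {m : ι → Measure (Fin d → ℝ)} [∀ n, IsProbabilityMeasure (m n)] {m' : Measure (Fin d → ℝ)}
    [IsProbabilityMeasure m'] (hm : ∀ n, ∀ᵐ x ∂(m n), x ∈ Icc (0 : Fin d → ℝ) 1)
    (hm' : ∀ᵐ x ∂m', x ∈ Icc (0 : Fin d → ℝ) 1)
    (hlim : ∀ κ : Fin d → ℝ, (∀ i, 0 ≤ κ i) →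
      Tendsto (fun n => ∫ x, Real.exp (-∑ i, κ i * x i) ∂(m n)) l
        (𝓝 (∫ x, Real.exp (-∑ i, κ i * x i) ∂m')))
    {f : (Fin d → ℝ) → ℝ} (hf : Continuous f) :
    Tendsto (fun n => ∫ x, f x ∂(m n)) l (𝓝 (∫ x, f x ∂m')) := by
  have hint : ∀ (M : Measure (Fin d → ℝ)) [IsProbabilityMeasure M],
      (∀ᵐ x ∂M, x ∈ Icc (0 : Fin d → ℝ) 1) → ∀ G : (Fin d → ℝ) → ℝ, Continuous G →
      Integrable G M := fun M _ hM G hG => by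
    obtain ⟨C, hC⟩ := isCompact_Icc.exists_bound_of_continuousOn
      (hG.continuousOn (s := Icc (0 : Fin d → ℝ) 1))
    exact Integrable.of_bound hG.aestronglyMeasurable C (hM.mono fun x hx => hC x hx)
  let e : (Fin d → ℝ≥0) → C(Icc (0 : Fin d → ℝ) 1, ℝ) := fun κ =>
    ⟨fun x => Real.exp (-∑ i, κ i * x.1 i), (continuous_finsetSum _ fun i _ =>
      ((continuous_apply i).comp continuous_subtype_val).const_mul _).neg.rexp⟩
  let S : Subalgebra ℝ C(Icc (0 : Fin d → ℝ) 1, ℝ) := Algebra.adjoin ℝ (range e)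
  have hsep : S.SeparatesPoints := by
    intro x y hxy
    obtain ⟨i, hi⟩ : ∃ i, x.1 i ≠ y.1 i := by
      by_contra hcon
      push Not at hcon
      exact hxy (Subtype.ext (funext hcon))
    -- The exponential of a single coordinate is injective in it.
    refine ⟨_, ⟨e (Pi.single i 1), Algebra.subset_adjoin (mem_range_self _), rfl⟩, ?_⟩
    simpa [e, Pi.single_apply, apply_ite NNReal.toReal] using hi
  have hP : ∀ g ∈ S, ∃ G : (Fin d → ℝ) → ℝ, Continuous G ∧
      (∀ x : Icc (0 : Fin d → ℝ) 1, G x = g x) ∧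
      Tendsto (fun n => ∫ x, G x ∂(m n)) l (𝓝 (∫ x, G x ∂m')) := by
    intro g hg
    -- The exponentials are closed under multiplication, so the algebra they generate is their
    -- linear span, and convergence extends by linearity.
    rw [← Subalgebra.mem_toSubmodule, Algebra.adjoin_eq_span] at hg
    induction hg using Submodule.span_induction with
    | mem g hg =>
      obtain ⟨κ, rfl⟩ : g ∈ range e := by
        induction hg using Submonoid.closure_induction with
        | mem g hg => exact hg
        | one => exact ⟨0, by ext x; simp [e]⟩
        | mul g₁ g₂ _ _ h₁ h₂ =>
          obtain ⟨κ₁, rfl⟩ := h₁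
          obtain ⟨κ₂, rfl⟩ := h₂
          refine ⟨κ₁ + κ₂, ?_⟩
          ext x
          simp [e, ← Real.exp_add, add_mul, Finset.sum_add_distrib, add_comm]
      exact ⟨fun x => Real.exp (-∑ i, κ i * x i), by fun_prop, fun x => rfl,
        hlim (fun i => κ i) fun i => (κ i).2⟩
    | zero => exact ⟨0, continuous_const, fun x => rfl, by simpa using tendsto_const_nhds⟩
    | add g₁ g₂ _ _ h₁ h₂ =>
      obtain ⟨G₁, hc₁, he₁, hl₁⟩ := h₁
      obtain ⟨G₂, hc₂, he₂, hl₂⟩ := h₂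
      refine ⟨fun x => G₁ x + G₂ x, hc₁.add hc₂, fun x => by simp [he₁, he₂], ?_⟩
      rw [integral_add (hint m' hm' G₁ hc₁) (hint m' hm' G₂ hc₂)]
      refine (hl₁.add hl₂).congr fun n => ?_
      rw [integral_add (hint _ (hm n) G₁ hc₁) (hint _ (hm n) G₂ hc₂)]
    | smul c g _ h =>
      obtain ⟨G, hc, he, hl⟩ := h
      refine ⟨fun x => c * G x, hc.const_mul c, fun x => by simp [he], ?_⟩
      simp only [integral_const_mul]
      exact hl.const_mul c
  rw [Metric.tendsto_nhds]
  intro ε hε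
  obtain ⟨g, hg⟩ := ContinuousMap.exists_mem_subalgebra_near_continuousMap_of_separatesPoints S hsep
    ⟨fun x : Icc (0 : Fin d → ℝ) 1 => f x, by fun_prop⟩ (ε / 3) (by positivity)
  obtain ⟨G, hGc, hGe, hGl⟩ := hP g.1 g.2
  have hGf : ∀ x ∈ Icc (0 : Fin d → ℝ) 1, |G x - f x| ≤ ε / 3 := fun x hx => by
    have h1 := (ContinuousMap.norm_coe_le_norm _ (⟨x, hx⟩ : Icc (0 : Fin d → ℝ) 1)).trans hg.le
    rw [hGe ⟨x, hx⟩]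
    exact h1
  have hdiff : ∀ (M : Measure (Fin d → ℝ)) [IsProbabilityMeasure M],
      (∀ᵐ x ∂M, x ∈ Icc (0 : Fin d → ℝ) 1) → |∫ x, G x ∂M - ∫ x, f x ∂M| ≤ ε / 3 := by
    intro M _ hM
    rw [← integral_sub (hint M hM G hGc) (hint M hM f hf)]
    simpa using norm_integral_le_of_norm_le_const (μ := M) (f := fun x => G x - f x)
      (hM.mono fun x hx => hGf x hx)
  filter_upwards [Metric.tendsto_nhds.1 hGl (ε / 3) (by positivity)] with n hn
  have h1 := hdiff (m n) (hm n)
  have h2 := hdiff m' hm'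
  rw [Real.dist_eq, abs_lt] at hn ⊢
  rw [abs_le] at h1 h2
  constructor <;> linarith [hn.1, hn.2, h1.1, h1.2, h2.1, h2.2]

theorem abs_exp_neg_sub_le {a b : ℝ} (ha : 0 ≤ a) (hb : 0 ≤ b) :
    |Real.exp (-a) - Real.exp (-b)| ≤ |a - b| := by
  wlog h : a ≤ b generalizing a b
  · rw [abs_sub_comm, abs_sub_comm a]
    exact this hb ha (le_of_not_ge h)
  have h1 : Real.exp (-b) ≤ Real.exp (-a) := Real.exp_le_exp.2 (by linarith)
  rw [abs_of_nonneg (sub_nonneg.2 h1), abs_of_nonpos (sub_nonpos.2 h)]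
  have h2 : Real.exp (-b) = Real.exp (-a) * Real.exp (-(b - a)) := by
    rw [← Real.exp_add]; congr 1; ring
  have h3 := Real.one_sub_le_exp_neg (b - a)
  have h4 : Real.exp (-a) ≤ 1 := Real.exp_le_one_iff.2 (by linarith)
  have h5 := Real.exp_pos (-a)
  rw [h2]
  nlinarith

end LaplaceConvergence

/-! ### Occupation times and the resolvent -/

section OccupationTime

variable {X : Type*} {T : X → X} {d : ℕ} {A : Fin d → Set X}

theorem occupationTime_succ (n : ℕ) (x : X) (i : Fin d) :
    occupationTime T A (n + 1) x i
      = occupationTime T A n x i + (A i).indicator (fun _ => 1) (T^[n + 1] x) :=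
  Finset.sum_Icc_succ_top (by omega) _

theorem occupationTime_le_add (n k : ℕ) (x : X) (i : Fin d) :
    occupationTime T A n x i ≤ occupationTime T A (n + k) x i ∧
      occupationTime T A (n + k) x i ≤ occupationTime T A n x i + k := by
  induction k with
  | zero => simp
  | succ k ih =>
    rw [← add_assoc, occupationTime_succ]
    have h1 : (0 : ℝ) ≤ (A i).indicator (fun _ => 1) (T^[n + k + 1] x) :=
      indicator_nonneg (fun _ _ => zero_le_one) _
    have h2 : (A i).indicator (fun _ => (1 : ℝ)) (T^[n + k + 1] x) ≤ 1 :=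
      indicator_le_self' (fun _ _ => zero_le_one) _
    push_cast
    constructor <;> linarith

theorem abs_occupationTime_sub_le (n m : ℕ) (x : X) (i : Fin d) :
    |occupationTime T A n x i - occupationTime T A m x i| ≤ |(n : ℝ) - m| := by
  wlog h : m ≤ n generalizing m n
  · rw [abs_sub_comm, abs_sub_comm (n : ℝ)]
    exact this m n (le_of_not_ge h)
  obtain ⟨k, rfl⟩ := Nat.exists_eq_add_of_le h
  have h1 := occupationTime_le_add (T := T) (A := A) m k x i
  push_cast
  rw [add_sub_cancel_left, abs_of_nonneg (by linarith : 0 ≤ occupationTime T A (m + k) x i - occupationTime T A m x i),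
    abs_of_nonneg (Nat.cast_nonneg (α := ℝ) k)]
  linarith

theorem occupationTime_nonneg (n : ℕ) (x : X) (i : Fin d) : 0 ≤ occupationTime T A n x i :=
  Finset.sum_nonneg fun _ _ => indicator_nonneg (fun _ _ => zero_le_one) _

theorem occupationTime_le (n : ℕ) (x : X) (i : Fin d) : occupationTime T A n x i ≤ n := by
  have := (occupationTime_le_add (T := T) (A := A) 0 n x i).2
  simpa [occupationTime] using this

theorem measurable_occupationTime [MeasurableSpace X] (hT : Measurable T)
    (hA : ∀ i, MeasurableSet (A i)) (n : ℕ) : Measurable (occupationTime T A n) :=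
  measurable_pi_lambda _ fun i => Finset.measurable_sum _ fun k _ =>
    (measurable_const.indicator (hA i)).comp (hT.iterate k)

/-- Each survival factor contributes exp(-q/N), and exp(-κ_i/N) when the orbit is in `A i`, so their
product records the occupation times. -/
theorem scaledResolvent_eq_tsum (q : ℝ) (κ : Fin d → ℝ) (N : ℕ) (x : X) :
    scaledResolvent T A q κ N x = (1 - Real.exp (-(q / N))) * ∑' n, Real.exp (-(q / N)) ^ n
      * Real.exp (-((∑ i, κ i * occupationTime T A n x i) / N)) := by
  rw [scaledResolvent, resolvent, discountedSum]
  congr 1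
  refine tsum_congr fun n => ?_
  induction n with
  | zero => simp [occupationTime]
  | succ n ih =>
    rw [Finset.prod_range_succ, ih, survival, killingRate, neg_add, Real.exp_add, pow_succ]
    have : (∑ i, κ i * occupationTime T A (n + 1) x i) / N
        = (∑ i, κ i * occupationTime T A n x i) / N
          + ∑ i, (A i).indicator (fun _ => κ i / N) (T^[n + 1] x) := by
      rw [Finset.sum_div, Finset.sum_div, ← Finset.sum_add_distrib]
      refine Finset.sum_congr rfl fun i _ => ?_
      rw [occupationTime_succ]
      by_cases h : T^[n + 1] x ∈ A i
      · rw [indicator_of_mem h, indicator_of_mem h]; ring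
      · rw [indicator_of_notMem h, indicator_of_notMem h]; ring
    rw [this, neg_add, Real.exp_add]
    ring

theorem integral_scaledResolvent_eq_tsum [MeasurableSpace X] (hT : Measurable T)
    (hA : ∀ i, MeasurableSet (A i)) {ν : Measure X} [IsProbabilityMeasure ν] {q : ℝ} (hq : 0 < q)
    {κ : Fin d → ℝ} (hκ : ∀ i, 0 ≤ κ i) {N : ℕ} (hN : 0 < N) :
    ∫ x, scaledResolvent T A q κ N x ∂ν = (1 - Real.exp (-(q / N))) *
      ∑' n, Real.exp (-(q / N)) ^ n
        * ∫ x, Real.exp (-((∑ i, κ i * occupationTime T A n x i) / N)) ∂ν := by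
  have hN' : (0 : ℝ) < N := by exact_mod_cast hN
  have hz1 : Real.exp (-(q / N)) < 1 := by
    rw [Real.exp_lt_one_iff, neg_lt_zero]; positivity
  have hocc := fun n => measurable_occupationTime (T := T) hT hA n
  have hm : ∀ n, Measurable fun x => Real.exp (-((∑ i, κ i * occupationTime T A n x i) / N)) :=
    fun n => ((Finset.measurable_sum _ fun i _ =>
      ((measurable_pi_apply i).comp (hocc n)).const_mul (κ i)).div_const _).neg.exp
  have hb : ∀ n x, ‖Real.exp (-((∑ i, κ i * occupationTime T A n x i) / N))‖ ≤ 1 := fun n x => by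
    rw [Real.norm_of_nonneg (Real.exp_pos _).le, Real.exp_le_one_iff, neg_nonpos]
    exact div_nonneg (Finset.sum_nonneg fun i _ =>
      mul_nonneg (hκ i) (occupationTime_nonneg n x i)) hN'.le
  have hi : ∀ n, Integrable
      (fun x => Real.exp (-((∑ i, κ i * occupationTime T A n x i) / N))) ν := fun n =>
    Integrable.of_bound (hm n).aestronglyMeasurable 1 (Eventually.of_forall (hb n))
  simp only [scaledResolvent_eq_tsum]
  rw [integral_const_mul, ← integral_tsum_of_summable_integral_norm fun n => (hi n).const_mul _]
  · simp only [integral_const_mul]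
  · refine Summable.of_nonneg_of_le (fun n => integral_nonneg fun x => norm_nonneg _) (fun n => ?_)
      (summable_geometric_of_lt_one (Real.exp_pos (-(q / (N : ℝ)))).le hz1)
    have : ∫ _x, Real.exp (-(q / (N : ℝ))) ^ n ∂ν = Real.exp (-(q / (N : ℝ))) ^ n := by simp
    refine (integral_mono ((hi n).const_mul _).norm (integrable_const _) fun x => ?_).trans_eq this
    simp only
    rw [norm_mul, Real.norm_of_nonneg (by positivity)]
    exact mul_le_of_le_one_right (by positivity) (hb n x)

end OccupationTime

/-! ### Convergence of the Laplace transforms and the main theorem -/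

section Conclusion

variable {d : ℕ} {α : ℝ} {β : Fin d → ℝ}

theorem mem_Icc_of_sum_eq_one {x : Fin d → ℝ} (hx : ∀ i, 0 ≤ x i) (hsum : ∑ i, x i = 1) :
    x ∈ Icc (0 : Fin d → ℝ) 1 :=
  ⟨hx, fun i => (Finset.single_le_sum (f := x) (fun j _ => hx j) (Finset.mem_univ i)).trans_eq hsum⟩

theorem sum_mul_mem_Icc {κ x : Fin d → ℝ} (hκ : ∀ i, 0 ≤ κ i) (hx : x ∈ Icc (0 : Fin d → ℝ) 1) :
    ∑ i, κ i * x i ∈ Icc (0 : ℝ) (∑ i, κ i) :=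
  ⟨Finset.sum_nonneg fun i _ => mul_nonneg (hκ i) (hx.1 i),
    Finset.sum_le_sum fun i _ => mul_le_of_le_one_right (hκ i) (hx.2 i)⟩

/-- Fubini and ∫₀^∞ exp(-t L) dt = 1 / L. This links the Abel means in time with the Stieltjes
transform of the limit law. -/
theorem integral_Ioi_laplace {m : Measure (Fin d → ℝ)} [IsProbabilityMeasure m]
    (hm : ∀ᵐ x ∂m, x ∈ Icc (0 : Fin d → ℝ) 1) {q : ℝ} (hq : 0 < q) {κ : Fin d → ℝ}
    (hκ : ∀ i, 0 ≤ κ i) :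
    ∫ t in Ioi (0 : ℝ), Real.exp (-(q * t)) * ∫ x, Real.exp (-(t * ∑ i, κ i * x i)) ∂m
      = ∫ x, (q + ∑ i, κ i * x i)⁻¹ ∂m := by
  have hint : Integrable (Function.uncurry fun (t : ℝ) (x : Fin d → ℝ) =>
      Real.exp (-(q * t)) * Real.exp (-(t * ∑ i, κ i * x i)))
      ((volume.restrict (Ioi (0 : ℝ))).prod m) := by
    have h1 : Integrable (fun t : ℝ => Real.exp (-(q * t))) (volume.restrict (Ioi 0)) := by
      have := exp_neg_integrableOn_Ioi 0 hq
      simp only [neg_mul] at this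
      exact this
    refine (h1.comp_fst m).mono' (Measurable.aestronglyMeasurable
      (by simp only [Function.uncurry_def]; fun_prop)) ?_
    have ht : ∀ᵐ z ∂((volume.restrict (Ioi (0 : ℝ))).prod m), 0 < z.1 :=
      Measure.quasiMeasurePreserving_fst.ae (ae_restrict_mem measurableSet_Ioi)
    have hx : ∀ᵐ z ∂((volume.restrict (Ioi (0 : ℝ))).prod m), z.2 ∈ Icc (0 : Fin d → ℝ) 1 :=
      Measure.quasiMeasurePreserving_snd.ae hm
    filter_upwards [ht, hx] with z h2 h3
    rw [Function.uncurry_def, Real.norm_of_nonneg (by positivity)]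
    refine mul_le_of_le_one_right (by positivity) (Real.exp_le_one_iff.2 ?_)
    exact neg_nonpos.2 (mul_nonneg h2.le (sum_mul_mem_Icc hκ h3).1)
  simp only [← integral_const_mul]
  rw [integral_integral_swap hint]
  refine integral_congr_ae ?_
  filter_upwards [hm] with x hx
  have hL : 0 < q + ∑ i, κ i * x i := by
    have := (sum_mul_mem_Icc hκ hx).1
    linarith
  have := (integral_Ioi_mul_exp_neg (s := (1 : ℝ)) hL).2
  rw [one_div] at this
  rw [← this]
  congr 1; funext t
  rw [one_mul, ← Real.exp_add]
  congr 1; ring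

variable {X : Type*} [MeasurableSpace X] {μ : Measure X} {T : X → X} {Y : Set X}
  {A : Fin d → Set X}

theorem tendsto_integral_exp_occupationTime [SigmaFinite μ] (hT : Ergodic T μ)
    (h : IsRayDecomposition μ T Y A) (hrec : ∀ᵐ x ∂μ, ∃ᶠ n in atTop, T^[n] x ∈ Y)
    (htop : μ univ = ∞)
    (hcomp : ∀ i, IsCompact (closure (normalizedEntrances hT.toMeasurePreserving h i)))
    (hα0 : 0 ≤ α) (hα1 : α ≤ 1) (hβ : ∀ i, 0 ≤ β i) (hβsum : ∑ i, β i = 1)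
    (hw : IsRegularlyVaryingSeq (wanderingRate μ T Y) (1 - α))
    (hwi : ∀ i, Tendsto (fun n => wanderingRateFrom μ T Y (A i) n / wanderingRate μ T Y n) atTop
      (𝓝 (β i))) {ν : Measure X} [IsProbabilityMeasure ν] (hν : ν ≪ μ)
    {κ : Fin d → ℝ} (hκ : ∀ i, 0 ≤ κ i) :
    Tendsto (fun N : ℕ => ∫ x, Real.exp (-((∑ i, κ i * occupationTime T A N x i) / N)) ∂ν) atTop
      (𝓝 (∫ x, Real.exp (-∑ i, κ i * x i) ∂(arcsineLaw α β))) := by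
  have := isProbabilityMeasure_arcsineLaw α hβ hβsum
  have hsupp : ∀ᵐ x ∂(arcsineLaw α β), x ∈ Icc (0 : Fin d → ℝ) 1 :=
    (ae_arcsineLaw hα0 hα1 hβ hβsum).mono fun x hx => mem_Icc_of_sum_eq_one hx.1 hx.2
  have hκs : 0 ≤ ∑ i, κ i := Finset.sum_nonneg fun i _ => hκ i
  let φ : ℕ → ℕ → ℝ := fun N n =>
    ∫ x, Real.exp (-((∑ i, κ i * occupationTime T A n x i) / N)) ∂ν
  let Φ : ℝ → ℝ := fun t => ∫ x, Real.exp (-(t * ∑ i, κ i * x i)) ∂(arcsineLaw α β)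
  have hocc := fun n => measurable_occupationTime (T := T) hT.measurable h.measurableSet_ray n
  have hnn : ∀ (N n : ℕ) x, 0 ≤ (∑ i, κ i * occupationTime T A n x i) / N := fun N n x =>
    div_nonneg (Finset.sum_nonneg fun i _ => mul_nonneg (hκ i) (occupationTime_nonneg n x i))
      N.cast_nonneg
  have hb : ∀ (N n : ℕ) x, ‖Real.exp (-((∑ i, κ i * occupationTime T A n x i) / N))‖ ≤ 1 :=
    fun N n x => by
      rw [Real.norm_of_nonneg (Real.exp_pos _).le, Real.exp_le_one_iff, neg_nonpos]
      exact hnn N n x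
  have hi : ∀ N n : ℕ, Integrable
      (fun x => Real.exp (-((∑ i, κ i * occupationTime T A n x i) / N))) ν := fun N n =>
    Integrable.of_bound (((Finset.measurable_sum _ fun i _ => ((measurable_pi_apply i).comp
      (hocc n)).const_mul (κ i)).div_const _).neg.exp).aestronglyMeasurable 1
      (Eventually.of_forall (hb N n))
  have hΦb : ∀ t, 0 ≤ t → ∀ᵐ x ∂(arcsineLaw α β), ‖Real.exp (-(t * ∑ i, κ i * x i))‖ ≤ 1 :=
    fun t ht => hsupp.mono fun x hx => by
      rw [Real.norm_of_nonneg (Real.exp_pos _).le, Real.exp_le_one_iff, neg_nonpos]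
      exact mul_nonneg ht (sum_mul_mem_Icc hκ hx).1
  have hΦi : ∀ t, 0 ≤ t → Integrable (fun x : Fin d → ℝ => Real.exp (-(t * ∑ i, κ i * x i)))
      (arcsineLaw α β) := fun t ht =>
    Integrable.of_bound (Measurable.aestronglyMeasurable (by fun_prop)) 1 (hΦb t ht)
  have hΦm : Measurable Φ := by
    have hm2 : Measurable (Function.uncurry fun (t : ℝ) (x : Fin d → ℝ) =>
        Real.exp (-(t * ∑ i, κ i * x i))) := by
      simp only [Function.uncurry_def]; fun_prop
    exact (hm2.stronglyMeasurable.integral_prod_right (ν := arcsineLaw α β)).measurable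
  -- The Lipschitz constant ∑ κ_i serves both sides: occupation times grow by at most one per step,
  -- and the limit law lives on the unit cube.
  have key := tendsto_diagonal_of_tendsto_laplace (φ := φ) (Φ := Φ) (C := ∑ i, κ i)
    (fun N n => ?_) hΦm (fun t ht => ?_) hκs (fun N hN n => ?_) (fun t ht => ?_) (fun q hq => ?_)
  · simpa only [Φ, one_mul] using key
  · simpa using norm_integral_le_of_norm_le_const (μ := ν) (Eventually.of_forall (hb N n))
  · simpa using norm_integral_le_of_norm_le_const (hΦb t ht.le)
  · have hN' : (0 : ℝ) < N := by exact_mod_cast hN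
    simp only [φ]
    rw [← integral_sub (hi N n) (hi N N)]
    suffices hbd : ∀ x, ‖Real.exp (-((∑ i, κ i * occupationTime T A n x i) / N))
        - Real.exp (-((∑ i, κ i * occupationTime T A N x i) / N))‖
          ≤ (∑ i, κ i) * |(n : ℝ) / N - 1| by
      simpa using norm_integral_le_of_norm_le_const (μ := ν) (Eventually.of_forall hbd)
    intro x
    refine (abs_exp_neg_sub_le (hnn N n x) (hnn N N x)).trans ?_
    have e : (n : ℝ) / N - 1 = (n - N) / N := by field_simp
    rw [← sub_div, ← Finset.sum_sub_distrib, e, abs_div, abs_div, ← mul_div_assoc]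
    refine div_le_div_of_nonneg_right ?_ (abs_nonneg _)
    rw [Finset.sum_mul]
    refine (Finset.abs_sum_le_sum_abs _ _).trans (Finset.sum_le_sum fun i _ => ?_)
    rw [← mul_sub, abs_mul, abs_of_nonneg (hκ i)]
    exact mul_le_mul_of_nonneg_left (abs_occupationTime_sub_le n N x i) (hκ i)
  · simp only [Φ]
    rw [← integral_sub (hΦi t ht.le) (hΦi 1 zero_le_one)]
    suffices hbd : ∀ x ∈ Icc (0 : Fin d → ℝ) 1, ‖Real.exp (-(t * ∑ i, κ i * x i))
        - Real.exp (-(1 * ∑ i, κ i * x i))‖ ≤ (∑ i, κ i) * |t - 1| by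
      simpa using norm_integral_le_of_norm_le_const (hsupp.mono hbd)
    intro x hx
    have h1 := sum_mul_mem_Icc hκ hx
    refine (abs_exp_neg_sub_le (mul_nonneg ht.le h1.1) (mul_nonneg zero_le_one h1.1)).trans ?_
    rw [← sub_mul, abs_mul, abs_of_nonneg h1.1, mul_comm]
    exact mul_le_mul_of_nonneg_right h1.2 (abs_nonneg _)
  · have hq' : (0 : ℝ) < q := by exact_mod_cast hq
    have hlim := tendsto_integral_scaledResolvent hT h hrec htop hcomp hα1 hβ hβsum hw hwi hν hq' hκ
    have e : (q : ℝ) * ∫ t in Ioi (0 : ℝ), Real.exp (-(q * t)) * Φ t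
        = q * (∑ i, β i * (q + κ i) ^ (α - 1)) / ∑ i, β i * (q + κ i) ^ α := by
      simp only [Φ]
      rw [integral_Ioi_laplace hsupp hq' hκ, integral_inv_arcsineLaw hα0 hα1 hβ hβsum hq' hκ,
        mul_div_assoc]
    rw [e]
    refine hlim.congr' ?_
    filter_upwards [eventually_gt_atTop 0] with N hN
    exact integral_scaledResolvent_eq_tsum hT.measurable h.measurableSet_ray hq' hκ hN

end Conclusion

end OccupationTimes

theorem mainTheorem1 {X : Type*} [MeasurableSpace X] (μ : Measure X) [SigmaFinite μ]
    (T : X → X) (hcons : Conservative T μ) (herg : Ergodic T μ)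
    (d : ℕ) (hd : 2 ≤ d) (Y : Set X) (A : Fin d → Set X)
    (hray : OccupationTimes.IsRayDecomposition μ T Y A)
    (hcomp : ∀ i, IsCompact (closure
      (OccupationTimes.normalizedEntrances herg.toMeasurePreserving hray i)))
    (α : ℝ) (hα : α ∈ Set.Icc (0 : ℝ) 1)
    (β : Fin d → ℝ) (hβ : ∀ i, β i ∈ Set.Icc (0 : ℝ) 1) (hβsum : ∑ i, β i = 1)
    (hw : OccupationTimes.IsRegularlyVaryingSeq
      (OccupationTimes.wanderingRate μ T Y) (1 - α))
    (hwi : ∀ i, Tendsto (fun n => OccupationTimes.wanderingRateFrom μ T Y (A i) n /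
      OccupationTimes.wanderingRate μ T Y n) atTop (𝓝 (β i)))
    {Ω : Type*} [MeasurableSpace Ω] (P : Measure Ω) [IsProbabilityMeasure P]
    (ζ : Ω → Fin d → ℝ) (hζ : HasLaw ζ (OccupationTimes.arcsineLaw α β) P) :
    OccupationTimes.TendstoStronglyInDistribution μ
      (fun n x => (n : ℝ)⁻¹ • OccupationTimes.occupationTime T A n x) ζ P := by
  intro ν _ hν
  have hβ0 : ∀ i, 0 ≤ β i := fun i => (hβ i).1
  have hprob := OccupationTimes.isProbabilityMeasure_arcsineLaw α hβ0 hβsum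
  have hrec := OccupationTimes.ae_frequently_mem hcons herg hray.measurableSet_junction
    hray.junction_pos
  -- Any ray has infinite measure, and d ≥ 2 provides one.
  have htop : μ univ = ∞ :=
    top_le_iff.1 ((hray.ray_eq_top ⟨0, by omega⟩).symm.le.trans (measure_mono (subset_univ _)))
  have hFm : ∀ n : ℕ, Measurable fun x => (n : ℝ)⁻¹ • OccupationTimes.occupationTime T A n x :=
    fun n => (OccupationTimes.measurable_occupationTime herg.measurable hray.measurableSet_ray
      n).const_smul (n : ℝ)⁻¹
  refine ⟨fun n => (hFm n).aemeasurable, hζ.aemeasurable, ?_⟩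
  refine ProbabilityMeasure.tendsto_iff_forall_integral_tendsto.2 fun f => ?_
  simp only [ProbabilityMeasure.coe_mk, hζ.map_eq]
  have hpn : ∀ n : ℕ, IsProbabilityMeasure
      (ν.map fun x => (n : ℝ)⁻¹ • OccupationTimes.occupationTime T A n x) := fun n =>
    Measure.isProbabilityMeasure_map (hFm n).aemeasurable
  refine OccupationTimes.tendsto_integral_of_tendsto_laplace (fun n => ?_)
    ((OccupationTimes.ae_arcsineLaw hα.1 hα.2 hβ0 hβsum).mono fun x hx =>
      OccupationTimes.mem_Icc_of_sum_eq_one hx.1 hx.2) (fun κ hκ => ?_) f.continuous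
  · refine (ae_map_iff (p := (· ∈ Icc (0 : Fin d → ℝ) 1)) (hFm n).aemeasurable
      measurableSet_Icc).2 ?_
    -- At n = 0 the inverse is 0 and the vector is the origin, which lies in the cube as well.
    refine Eventually.of_forall fun x => ⟨fun i => ?_, fun i => ?_⟩
    · exact mul_nonneg (by positivity) (OccupationTimes.occupationTime_nonneg n x i)
    · rw [Pi.smul_apply, smul_eq_mul, ← div_eq_inv_mul]
      exact div_le_one_of_le₀ (OccupationTimes.occupationTime_le n x i) n.cast_nonneg
  · refine (OccupationTimes.tendsto_integral_exp_occupationTime herg hray hrec htop hcomp hα.1 hα.2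
      hβ0 hβsum hw hwi hν hκ).congr fun n => ?_
    rw [integral_map (hFm n).aemeasurable (Measurable.aestronglyMeasurable (by fun_prop))]
    refine integral_congr_ae (Eventually.of_forall fun x => ?_)
    simp only [Pi.smul_apply, smul_eq_mul]
    congr 2
    rw [Finset.sum_div]
    exact Finset.sum_congr rfl fun i _ => by ring
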